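/- For $R>0$ let $Q_R=(-R/2,R/2)\times(-R/2,R/2)$, let $\mathbf A_0(x_1,x_2)=\frac12(-x_2,x_1)$ (so that $\operatorname{curl}\mathbf A_0=1$), and for $b\in(0,1]$ put $$\mathcal E_{\rm blk}(u;b,R)=\int_{Q_R}\Big(b|(\nabla-i\mathbf A_0)u|^2-|u|^2+\tfrac12|u|^4\Big)\,dx,\qquad \mathcal E_{\rm lin}(u;b,R)=\int_{Q_R}\Big(b|(\nabla-i\mathbf A_0)u|^2-|u|^2\Big)\,dx .$$ Let $\mathcal H^D_R=H^1_0(Q_R)$ and $\mathcal H^N_R=H^1(Q_R)$ (complex-valued functions), and let $\mathcal H^p_R=H^1_{\rm mag,per}(Q_R)$ be the space of all $u\in L^2_{\rm loc}(\mathbb R^2;\mathbb C)$ with $(\nabla-i\mathbf A_0)u\in L^2_{\rm loc}(\mathbb R^2)$ and $$u(x_1+R,x_2)=e^{iRx_2/2}u(x_1,x_2),\qquad u(x_1,x_2+R)=e^{-iRx_1/2}u(x_1,x_2)$$ almost everywhere. In the magnetic periodic case $\circ=p$ only values of $R$ with $R^2\in2\pi\mathbb N$ are considered, here and in all limits $R\to\infty$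 below. For $\circ\in\{D,N,p\}$ define $$e^\circ(b,R)=\inf_{u\in\mathcal H^\circ_R}\mathcal E_{\rm blk}(u;b,R),\qquad \mathfrak m^\circ(b,R)=\inf_{u\in\mathcal H^\circ_R\setminus\{0\}}\frac{\mathcal E_{\rm lin}(u;b,R)}{\big(\int_{Q_R}|u|^4\,dx\big)^{1/2}} .$$ **Theorem.** For every $b\in(0,1]$ the limit $$E_{\rm blk}(b)=\lim_{R\to\infty}\frac{e^{\circ}(b,R)}{R^2}$$ exists, is the same for all $\circ\in\{D,N,p\}$, and satisfies $E_{\rm blk}(b)\le 0$, with $E_{\rm blk}(b)<0$ if $b<1$. Moreover: 1. For every $b\in(0,1)$ there exist constants $C>0$ and $R_0>1$ such that, for all $R\ge R_0$ and all $\circ\in\{D,N,p\}$ (with $R^2\in2\pi\mathbb N$ if $\circ=p$), $$-\big(-2E_{\rm blk}(b)\big)^{1/2}-\frac CR\big(-2E_{\rm blk}(b)\big)^{-1/2}\le\frac{\mathfrak m^\circ(b,R)}R\le-\big(-2E_{\rm blk}(b)\big)^{1/2}+\frac CR .$$ 2. For every $b\in(0,1)$ and $\circ\in\{D,N,p\}$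 the limit $\lim_{R\to\infty}\mathfrak m^\circ(b,R)/R$ exists, and $$E_{\rm blk}(b)=-\frac12\left(\lim_{R\to\infty}\frac{\mathfrak m^\circ(b,R)}R\right)^2 .$$ 3. For all $b\in(0,1]$ and all $R\ge1$, $$-\big(-2E_{\rm blk}(b)\big)^{1/2}\le\frac{\mathfrak m^D(b,R)}R .$$ -/

import Mathlib

open MeasureTheory Filter Topology Set
open scoped ContDiff

noncomputable section

namespace MagneticSquare

/-- The open square `Q_R = (-R/2, R/2) × (-R/2, R/2)`. -/
def Q (R : ℝ) : Set (ℝ × ℝ) := Ioo (-R / 2) (R / 2) ×ˢ Ioo (-R / 2) (R / 2)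

/-- First component of the magnetic potential `A₀(x₁, x₂) = (1/2) (-x₂, x₁)`,
which generates the constant unit field `curl A₀ = ∂₁ A₀,₂ - ∂₂ A₀,₁ = 1`. -/
def A₁ (x : ℝ × ℝ) : ℝ := -x.2 / 2

/-- Second component of the magnetic potential `A₀`. -/
def A₂ (x : ℝ × ℝ) : ℝ := x.1 / 2

/-- `g` is the weak derivative of `u` in the direction `v` on the open set `Ω`. -/
structure IsWeakDeriv (Ω : Set (ℝ × ℝ)) (v : ℝ × ℝ) (u g : ℝ × ℝ → ℂ) : Prop where
  locallyIntegrable : LocallyIntegrableOn u Ω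
  locallyIntegrable_deriv : LocallyIntegrableOn g Ω
  integral_eq : ∀ φ : ℝ × ℝ → ℝ, ContDiff ℝ ∞ φ → HasCompactSupport φ → tsupport φ ⊆ Ω →
    ∫ x in Ω, (fderiv ℝ φ x v) • u x = -∫ x in Ω, φ x • g x

/-- `(g₁, g₂)` is the weak gradient of `u` on `Ω`. -/
def IsWeakGrad (Ω : Set (ℝ × ℝ)) (u g₁ g₂ : ℝ × ℝ → ℂ) : Prop :=
  IsWeakDeriv Ω (1, 0) u g₁ ∧ IsWeakDeriv Ω (0, 1) u g₂

/-- First component of `(∇ - i A₀) u`, where `g₁` is the weak derivative `∂₁ u`. -/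
def covDeriv₁ (u g₁ : ℝ × ℝ → ℂ) (x : ℝ × ℝ) : ℂ := g₁ x - Complex.I * (A₁ x : ℂ) * u x

/-- Second component of `(∇ - i A₀) u`, where `g₂` is the weak derivative `∂₂ u`. -/
def covDeriv₂ (u g₂ : ℝ × ℝ → ℂ) (x : ℝ × ℝ) : ℂ := g₂ x - Complex.I * (A₂ x : ℂ) * u x

/-- `u ∈ L²_loc(ℝ²)`. -/
def MemL2loc (u : ℝ × ℝ → ℂ) : Prop :=
  ∀ K : Set (ℝ × ℝ), IsCompact K → MemLp u 2 (volume.restrict K)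

/-- `u ∈ H¹(Ω)`, with weak gradient `(g₁, g₂)`. -/
structure MemH1 (Ω : Set (ℝ × ℝ)) (u g₁ g₂ : ℝ × ℝ → ℂ) : Prop where
  memLp : MemLp u 2 (volume.restrict Ω)
  memLp₁ : MemLp g₁ 2 (volume.restrict Ω)
  memLp₂ : MemLp g₂ 2 (volume.restrict Ω)
  weakGrad : IsWeakGrad Ω u g₁ g₂

/-- `u ∈ H¹₀(Ω)`, with weak gradient `(g₁, g₂)`: `u` lies in the `H¹(Ω)`-closure of the smooth
functions with compact support in `Ω`. -/
structure MemH10 (Ω : Set (ℝ × ℝ)) (u g₁ g₂ : ℝ × ℝ → ℂ) : Prop where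
  memH1 : MemH1 Ω u g₁ g₂
  approx : ∀ ε : ℝ, 0 < ε → ∃ φ : ℝ × ℝ → ℂ,
    ContDiff ℝ ∞ φ ∧ HasCompactSupport φ ∧ tsupport φ ⊆ Ω ∧
    eLpNorm (fun x => u x - φ x) 2 (volume.restrict Ω) < ENNReal.ofReal ε ∧
    eLpNorm (fun x => g₁ x - fderiv ℝ φ x (1, 0)) 2 (volume.restrict Ω) < ENNReal.ofReal ε ∧
    eLpNorm (fun x => g₂ x - fderiv ℝ φ x (0, 1)) 2 (volume.restrict Ω) < ENNReal.ofReal ε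

/-- `u ∈ H¹_mag,per(Q_R)`, with weak gradient `(g₁, g₂)` on `ℝ²`: `u` and `(∇ - i A₀) u` are in
`L²_loc(ℝ²)` and `u` is periodic up to the phases given by the magnetic translations. -/
structure MemH1per (R : ℝ) (u g₁ g₂ : ℝ × ℝ → ℂ) : Prop where
  memL2loc : MemL2loc u
  weakGrad : IsWeakGrad univ u g₁ g₂
  memL2loc₁ : MemL2loc (covDeriv₁ u g₁)
  memL2loc₂ : MemL2loc (covDeriv₂ u g₂)
  periodic₁ : ∀ᵐ x : ℝ × ℝ,
    u (x.1 + R, x.2) = Complex.exp (Complex.I * (R : ℂ) * (x.2 : ℂ) / 2) * u x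
  periodic₂ : ∀ᵐ x : ℝ × ℝ,
    u (x.1, x.2 + R) = Complex.exp (-(Complex.I * (R : ℂ) * (x.1 : ℂ) / 2)) * u x

/-- The three boundary conditions: Dirichlet, Neumann, magnetic periodic. -/
inductive BC where
  | D : BC
  | N : BC
  | p : BC

/-- The configuration space of a boundary condition: `u` belongs to `H¹₀(Q_R)`, `H¹(Q_R)` or
`H¹_mag,per(Q_R)` respectively, and has weak gradient `(g₁, g₂)`. -/
def IsConfig (c : BC) (R : ℝ) (u g₁ g₂ : ℝ × ℝ → ℂ) : Prop :=
  match c with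
  | BC.D => MemH10 (Q R) u g₁ g₂
  | BC.N => MemH1 (Q R) u g₁ g₂
  | BC.p => MemH1per R u g₁ g₂

/-- The sizes `R` considered for a boundary condition: in the magnetic periodic case `R²` has to be
in `2πℕ`, since otherwise the two periodicity conditions are compatible only for `u = 0`. -/
def admissible (c : BC) : Set ℝ :=
  match c with
  | BC.D => univ
  | BC.N => univ
  | BC.p => {R | ∃ n : ℕ, R ^ 2 = 2 * Real.pi * n}

/-- `|(∇ - i A₀) u|²`. -/
def kinetic (u g₁ g₂ : ℝ × ℝ → ℂ) (x : ℝ × ℝ) : ℝ :=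
  ‖covDeriv₁ u g₁ x‖ ^ 2 + ‖covDeriv₂ u g₂ x‖ ^ 2

/-- The non-linear functional `∫_{Q_R} (b |(∇ - i A₀) u|² - |u|² + |u|⁴ / 2)`. -/
def energyBlk (b R : ℝ) (u g₁ g₂ : ℝ × ℝ → ℂ) : ℝ :=
  ∫ x in Q R, (b * kinetic u g₁ g₂ x - ‖u x‖ ^ 2 + 1 / 2 * ‖u x‖ ^ 4)

/-- The functional `∫_{Q_R} (b |(∇ - i A₀) u|² - |u|²)`. -/
def energyLin (b R : ℝ) (u g₁ g₂ : ℝ × ℝ → ℂ) : ℝ :=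
  ∫ x in Q R, (b * kinetic u g₁ g₂ x - ‖u x‖ ^ 2)

/-- The ground state energy `e^∘(b, R)`. -/
def e (c : BC) (b R : ℝ) : ℝ :=
  sInf {E | ∃ u g₁ g₂ : ℝ × ℝ → ℂ, IsConfig c R u g₁ g₂ ∧ E = energyBlk b R u g₁ g₂}

/-- The ground state energy `m^∘(b, R)`: the infimum over the non-zero configurations of
`energyLin` divided by `(∫_{Q_R} |u|⁴)^{1/2}`. The quartic integral is finite and positive for such
`u`, as `H¹(Q_R)` embeds into `L⁴(Q_R)`. -/
def m (c : BC) (b R : ℝ) : ℝ :=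
  sInf {E | ∃ u g₁ g₂ : ℝ × ℝ → ℂ, IsConfig c R u g₁ g₂ ∧
    ¬ (u =ᵐ[volume.restrict (Q R)] 0) ∧
    E = energyLin b R u g₁ g₂ / √(∫ x in Q R, ‖u x‖ ^ 4)}

/-- `R → ∞` along the admissible sizes. -/
def toInfty (c : BC) : Filter ℝ := atTop ⊓ 𝓟 (admissible c)

/-- The reference bulk energy `E_blk(b) = lim_{R → ∞} e^D(b, R) / R²`. -/
def Eblk (b : ℝ) : ℝ := limUnder (toInfty BC.D) fun R => e BC.D b R / R ^ 2

end MagneticSquare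

end

namespace MagneticSquare

/-! ### Weak derivatives -/

/-! The bulk energy is squeezed between Dirichlet and Neumann conditions. Restriction to the square
turns every configuration into a Neumann one, so e^N ≤ e^∘ (`e_N_le`). Translations combined with a
suitable phase commute with ∇ − iA₀ (`kinetic_magT`), so a Dirichlet configuration extends at no
cost to a magnetic periodic one, and e^∘ ≤ e^D (`e_le_e_D`).

The same translations give two tiling inequalities. Dirichlet configurations can be glued,
e^D((2n+1)R) ≤ (2n+1)² e^D(R) (`e_D_tile`). Neumann configurations can be cut, (2n+1)² e^N(R) ≤
e^N((2n+1)R) (`e_N_tile`). Since e^D also decreases in R, e^D/R² converges to its infimum E_blk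
(`exists_tendsto_e_D`), and e^N(R) ≤ E_blk R² ≤ e^D(R) for every R > 0. A cutoff in a boundary layer
of width O(1) shows e^D ≤ e^N + CR (`exists_e_D_le_e_N_add`): the localization error is absorbed by
the quartic term, so neither minimizers nor sup bounds are needed. Hence |e^∘/R² − E_blk| ≤ C/R for
all boundary conditions at once (`exists_abs_e_sub_le`).

The two minimization problems are linked by scaling. The minimum over t of t²E + t⁴I/2 is −E²/(2I)
when E < 0, so m^∘ = −√(−2e^∘) as soon as e^∘ < 0 (`neg_sqrt_le_m`, `m_le_neg_sqrt`). The bounds on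
m^∘/R follow by taking square roots in the estimate for e^∘/R².

For b < 1, strict negativity comes from a truncated Gaussian: exp(−|x|²/4) has kinetic energy equal
to its mass, so its linear energy is (b − 1) times the mass (`exists_e_D_neg`). -/

theorem integrable_mul_of_tsupport_subset {Ω : Set (ℝ × ℝ)} {φ u : ℝ × ℝ → ℂ}
    (hφ : Continuous φ) (hc : HasCompactSupport φ) (hs : tsupport φ ⊆ Ω)
    (hu : LocallyIntegrableOn u Ω) : Integrable (fun x => φ x * u x) := by
  have h1 : IntegrableOn u (tsupport φ) := hu.integrableOn_compact_subset hs hc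
  have h2 : IntegrableOn (fun x => φ x * u x) (tsupport φ) :=
    h1.continuousOn_mul hφ.continuousOn hc
  refine (integrableOn_iff_integrable_of_support_subset ?_).1 h2
  intro x hx
  refine subset_tsupport _ ?_
  intro h
  exact hx (by simp [h])

theorem tsupport_fderiv_apply_subset' (φ : ℝ × ℝ → ℂ) (v : ℝ × ℝ) :
    tsupport (fun x => fderiv ℝ φ x v) ⊆ tsupport φ :=
  tsupport_fderiv_apply_subset ℝ v

theorem hasCompactSupport_fderiv_apply {φ : ℝ × ℝ → ℂ} (h : HasCompactSupport φ) (v : ℝ × ℝ) :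
    HasCompactSupport (fun x => fderiv ℝ φ x v) :=
  h.fderiv_apply ℝ v

theorem continuous_fderiv_apply_const {φ : ℝ × ℝ → ℂ} (h : ContDiff ℝ ∞ φ) (v : ℝ × ℝ) :
    Continuous (fun x => fderiv ℝ φ x v) :=
  (h.continuous_fderiv (by simp)).clm_apply continuous_const

theorem integrable_fderiv_mul {Ω : Set (ℝ × ℝ)} {φ u : ℝ × ℝ → ℂ}
    (hφ : ContDiff ℝ ∞ φ) (hc : HasCompactSupport φ) (hs : tsupport φ ⊆ Ω)
    (hu : LocallyIntegrableOn u Ω) (v : ℝ × ℝ) :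
    Integrable (fun x => fderiv ℝ φ x v * u x) :=
  integrable_mul_of_tsupport_subset (continuous_fderiv_apply_const hφ v)
    (hasCompactSupport_fderiv_apply hc v) ((tsupport_fderiv_apply_subset' φ v).trans hs) hu

theorem fderiv_ofReal_comp {φ : ℝ × ℝ → ℝ} (hφ : ContDiff ℝ ∞ φ) (x v : ℝ × ℝ) :
    fderiv ℝ (fun y => (φ y : ℂ)) x v = (fderiv ℝ φ x v : ℂ) := by
  have h := (Complex.ofRealCLM.hasFDerivAt (x := φ x)).comp x
    (hφ.differentiable (by simp) x).hasFDerivAt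
  have h' : HasFDerivAt (fun y => (φ y : ℂ)) (Complex.ofRealCLM.comp (fderiv ℝ φ x)) x := h
  rw [h'.fderiv]; rfl

/-- The weak derivative may be tested against complex-valued test functions. -/
theorem isWeakDeriv_iff {Ω : Set (ℝ × ℝ)} {v : ℝ × ℝ} {u g : ℝ × ℝ → ℂ} :
    IsWeakDeriv Ω v u g ↔ LocallyIntegrableOn u Ω ∧ LocallyIntegrableOn g Ω ∧
      ∀ φ : ℝ × ℝ → ℂ, ContDiff ℝ ∞ φ → HasCompactSupport φ → tsupport φ ⊆ Ω →
        ∫ x, fderiv ℝ φ x v * u x = -∫ x, φ x * g x := by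
  have key : ∀ φ : ℝ × ℝ → ℝ, ContDiff ℝ ∞ φ → tsupport φ ⊆ Ω →
      ((∫ x in Ω, (fderiv ℝ φ x v) • u x) = ∫ x, fderiv ℝ (fun y => (φ y : ℂ)) x v * u x) ∧
      ((∫ x in Ω, φ x • g x) = ∫ x, (φ x : ℂ) * g x) := by
    intro φ hφ hs
    constructor
    · rw [setIntegral_eq_integral_of_forall_compl_eq_zero]
      · simp_rw [fderiv_ofReal_comp hφ, Complex.real_smul]
      · intro x hx
        have : fderiv ℝ φ x v = 0 := by
          by_contra h
          exact hx (hs (tsupport_fderiv_apply_subset ℝ v (subset_tsupport _ h)))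
        simp [this]
    · rw [setIntegral_eq_integral_of_forall_compl_eq_zero]
      · simp_rw [Complex.real_smul]
      · intro x hx
        have : φ x = 0 := by
          by_contra h
          exact hx (hs (subset_tsupport _ h))
        simp [this]
  constructor
  · rintro ⟨hu, hg, h⟩
    refine ⟨hu, hg, fun φ hφ hc hs => ?_⟩
    have part : ∀ L : ℂ →L[ℝ] ℝ,
        Integrable (fun x => ((L (fderiv ℝ φ x v) : ℝ) : ℂ) * u x) ∧
        Integrable (fun x => ((L (φ x) : ℝ) : ℂ) * g x) ∧
        ∫ x, ((L (fderiv ℝ φ x v) : ℝ) : ℂ) * u x = -∫ x, ((L (φ x) : ℝ) : ℂ) * g x := by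
      intro L
      have hsm : ContDiff ℝ ∞ (fun x => L (φ x)) := L.contDiff.comp hφ
      have hsub : tsupport (fun x => L (φ x)) ⊆ tsupport φ :=
        closure_mono fun x hx => by
          intro h0; apply hx; simp [h0]
      have hcL : HasCompactSupport (fun x => L (φ x)) :=
        hc.mono' ((subset_tsupport _).trans hsub)
      have hsmC : ContDiff ℝ ∞ (fun x => ((L (φ x) : ℝ) : ℂ)) :=
        Complex.ofRealCLM.contDiff.comp hsm
      have hsubC : tsupport (fun x => ((L (φ x) : ℝ) : ℂ)) ⊆ tsupport φ :=
        closure_mono fun x hx => by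
          intro h0; apply hx; simp [h0]
      have hcC : HasCompactSupport (fun x => ((L (φ x) : ℝ) : ℂ)) :=
        hc.mono' ((subset_tsupport _).trans hsubC)
      have hd : ∀ x, fderiv ℝ (fun y => ((L (φ y) : ℝ) : ℂ)) x v
          = ((L (fderiv ℝ φ x v) : ℝ) : ℂ) := by
        intro x
        rw [fderiv_ofReal_comp hsm]
        have h := (L.hasFDerivAt (x := φ x)).comp x (hφ.differentiable (by simp) x).hasFDerivAt
        have h' : HasFDerivAt (fun y => L (φ y)) (L.comp (fderiv ℝ φ x)) x := h
        rw [h'.fderiv]; rfl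
      have h1 := integrable_fderiv_mul hsmC hcC (hsubC.trans hs) hu v
      have h2 := integrable_mul_of_tsupport_subset hsmC.continuous hcC (hsubC.trans hs) hg
      have h3 := h _ hsm hcL (hsub.trans hs)
      rw [(key _ hsm (hsub.trans hs)).1, (key _ hsm (hsub.trans hs)).2] at h3
      simp_rw [hd] at h1 h3
      exact ⟨h1, h2, h3⟩
    obtain ⟨a1, a2, a3⟩ := part Complex.reCLM
    obtain ⟨b1, b2, b3⟩ := part Complex.imCLM
    have e1 : ∀ x, fderiv ℝ φ x v * u x =
        ((Complex.reCLM (fderiv ℝ φ x v) : ℝ) : ℂ) * u x +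
        Complex.I * (((Complex.imCLM (fderiv ℝ φ x v) : ℝ) : ℂ) * u x) := by
      intro x
      conv_lhs => rw [← Complex.re_add_im (fderiv ℝ φ x v)]
      simp only [Complex.reCLM_apply, Complex.imCLM_apply]; ring
    have e2 : ∀ x, φ x * g x = ((Complex.reCLM (φ x) : ℝ) : ℂ) * g x +
        Complex.I * (((Complex.imCLM (φ x) : ℝ) : ℂ) * g x) := by
      intro x
      conv_lhs => rw [← Complex.re_add_im (φ x)]
      simp only [Complex.reCLM_apply, Complex.imCLM_apply]; ring
    simp_rw [e1, e2]
    rw [integral_add a1 (b1.const_mul _), integral_add a2 (b2.const_mul _),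
      integral_const_mul, integral_const_mul, a3, b3]
    ring
  · rintro ⟨hu, hg, h⟩
    refine ⟨hu, hg, fun φ hφ hc hs => ?_⟩
    rw [(key φ hφ hs).1, (key φ hφ hs).2]
    have hsub : tsupport (fun x => ((φ x : ℝ) : ℂ)) ⊆ tsupport φ :=
      closure_mono fun x hx => by
        intro h0; apply hx; simp [h0]
    exact h _ (Complex.ofRealCLM.contDiff.comp hφ)
      (hc.mono' ((subset_tsupport _).trans hsub)) (hsub.trans hs)

namespace IsWeakDeriv

variable {Ω Ω' : Set (ℝ × ℝ)} {v : ℝ × ℝ} {u g u' g' : ℝ × ℝ → ℂ}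

theorem mono (h : IsWeakDeriv Ω v u g) (hΩ : Ω' ⊆ Ω) : IsWeakDeriv Ω' v u g := by
  rw [isWeakDeriv_iff] at h ⊢
  exact ⟨h.1.mono_set hΩ, h.2.1.mono_set hΩ, fun φ h1 h2 h3 => h.2.2 φ h1 h2 (h3.trans hΩ)⟩

theorem congr (h : IsWeakDeriv Ω v u g) (hΩ : MeasurableSet Ω) (hu : EqOn u u' Ω)
    (hg : EqOn g g' Ω) : IsWeakDeriv Ω v u' g' := by
  refine ⟨h.1.congr (ae_restrict_of_forall_mem hΩ hu),
    h.2.congr (ae_restrict_of_forall_mem hΩ hg), fun φ h1 h2 h3 => ?_⟩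
  have e1 : ∫ x in Ω, (fderiv ℝ φ x v) • u' x = ∫ x in Ω, (fderiv ℝ φ x v) • u x :=
    setIntegral_congr_fun hΩ fun x hx => by simp only [hu hx]
  have e2 : ∫ x in Ω, φ x • g' x = ∫ x in Ω, φ x • g x :=
    setIntegral_congr_fun hΩ fun x hx => by simp only [hg hx]
  rw [e1, e2]
  exact h.3 φ h1 h2 h3

theorem add (h : IsWeakDeriv Ω v u g) (h' : IsWeakDeriv Ω v u' g') :
    IsWeakDeriv Ω v (fun x => u x + u' x) (fun x => g x + g' x) := by
  rw [isWeakDeriv_iff] at h h' ⊢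
  refine ⟨h.1.add h'.1, h.2.1.add h'.2.1, fun φ h1 h2 h3 => ?_⟩
  simp_rw [mul_add]
  rw [integral_add (integrable_fderiv_mul h1 h2 h3 h.1 v) (integrable_fderiv_mul h1 h2 h3 h'.1 v),
    integral_add (integrable_mul_of_tsupport_subset h1.continuous h2 h3 h.2.1)
      (integrable_mul_of_tsupport_subset h1.continuous h2 h3 h'.2.1), h.2.2 φ h1 h2 h3,
    h'.2.2 φ h1 h2 h3, neg_add]

theorem zero : IsWeakDeriv Ω v (fun _ => 0) (fun _ => 0) :=
  ⟨locallyIntegrableOn_zero, locallyIntegrableOn_zero, fun _ _ _ _ => by simp⟩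

/-- Leibniz rule for the product with a smooth function. -/
theorem mul_smooth (h : IsWeakDeriv Ω v u g) (hΩ : IsOpen Ω) {χ : ℝ × ℝ → ℂ}
    (hχ : ContDiff ℝ ∞ χ) :
    IsWeakDeriv Ω v (fun x => χ x * u x) (fun x => χ x * g x + fderiv ℝ χ x v * u x) := by
  rw [isWeakDeriv_iff] at h ⊢
  have hloc : ∀ {a w : ℝ × ℝ → ℂ}, Continuous a → LocallyIntegrableOn w Ω →
      LocallyIntegrableOn (fun x => a x * w x) Ω := fun ha hw =>
    hw.continuousOn_mul ha.continuousOn hΩ.isLocallyClosed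
  have hdχ := continuous_fderiv_apply_const hχ v
  refine ⟨hloc hχ.continuous h.1, (hloc hχ.continuous h.2.1).add (hloc hdχ h.1),
    fun φ h1 h2 h3 => ?_⟩
  have hsub : tsupport (fun x => φ x * χ x) ⊆ tsupport φ := tsupport_mul_subset_left
  have key := h.2.2 (fun x => φ x * χ x) (h1.mul hχ) h2.mul_right (hsub.trans h3)
  have hd : ∀ x, fderiv ℝ (fun x => φ x * χ x) x v = φ x * fderiv ℝ χ x v
      + χ x * fderiv ℝ φ x v := by
    intro x
    rw [fderiv_fun_mul (h1.differentiable (by simp) x) (hχ.differentiable (by simp) x)]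
    simp
  simp_rw [hd] at key
  have i1 : Integrable (fun x => fderiv ℝ φ x v * (χ x * u x)) :=
    integrable_fderiv_mul h1 h2 h3 (hloc hχ.continuous h.1) v
  have i2 : Integrable (fun x => φ x * (fderiv ℝ χ x v * u x)) :=
    integrable_mul_of_tsupport_subset h1.continuous h2 h3 (hloc hdχ h.1)
  have i3 : Integrable (fun x => φ x * (χ x * g x)) :=
    integrable_mul_of_tsupport_subset h1.continuous h2 h3 (hloc hχ.continuous h.2.1)
  have e1 : ∀ x, (φ x * fderiv ℝ χ x v + χ x * fderiv ℝ φ x v) * u x =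
      φ x * (fderiv ℝ χ x v * u x) + fderiv ℝ φ x v * (χ x * u x) := fun x => by ring
  have e2 : ∀ x, φ x * χ x * g x = φ x * (χ x * g x) := fun x => by ring
  simp_rw [e1, e2] at key
  rw [integral_add i2 i1] at key
  simp_rw [mul_add]
  rw [integral_add i3 i2]
  linear_combination key

theorem const_mul (h : IsWeakDeriv Ω v u g) (hΩ : IsOpen Ω) (c : ℂ) :
    IsWeakDeriv Ω v (fun x => c * u x) (fun x => c * g x) := by
  simpa using h.mul_smooth hΩ (contDiff_const (c := c))

theorem translate (h : IsWeakDeriv Ω v u g) (a : ℝ × ℝ) :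
    IsWeakDeriv ((fun x => x - a) ⁻¹' Ω) v (fun x => u (x - a)) (fun x => g (x - a)) := by
  rw [isWeakDeriv_iff] at h ⊢
  have hloc : ∀ {w : ℝ × ℝ → ℂ}, LocallyIntegrableOn w Ω →
      LocallyIntegrableOn (fun x => w (x - a)) ((fun x => x - a) ⁻¹' Ω) := by
    intro w hw x hx
    obtain ⟨s, hs, hi⟩ := hw (x - a) hx
    have hcont : Continuous fun x : ℝ × ℝ => x - a := by fun_prop
    refine ⟨(fun x => x - a) ⁻¹' s, ?_, ?_⟩
    · exact (hcont.continuousWithinAt.tendsto_nhdsWithin (fun y hy => hy)) hs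
    · have := (measurePreserving_sub_right (volume : Measure (ℝ × ℝ)) a).integrableOn_comp_preimage
        (MeasurableEquiv.subRight a).measurableEmbedding (f := w) (s := s)
      exact this.2 hi
  refine ⟨hloc h.1, hloc h.2.1, fun φ h1 h2 h3 => ?_⟩
  have hcont : ContDiff ℝ ∞ (fun x : ℝ × ℝ => x + a) := contDiff_id.add contDiff_const
  have hts : tsupport (fun x => φ (x + a)) = (fun x => x + a) ⁻¹' tsupport φ :=
    tsupport_comp_eq_preimage φ (Homeomorph.addRight a)
  have key := h.2.2 (fun x => φ (x + a)) (h1.comp hcont)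
    (h2.comp_homeomorph (Homeomorph.addRight a)) (by
      rw [hts]
      intro x hx
      simpa using h3 hx)
  simp_rw [fderiv_comp_add_right] at key
  rw [← integral_sub_right_eq_self _ a, ← integral_sub_right_eq_self (fun x => φ (x + a) * g x) a]
    at key
  simpa using key

/-- A test function has compact support, which already lies in one member of the exhaustion. This
carries the periodic extension from large squares to the whole plane. -/
theorem of_forall_isOpen_subset {Ωs : ℕ → Set (ℝ × ℝ)} (hopen : ∀ n, IsOpen (Ωs n))
    (hmono : Monotone Ωs) (hcover : ⋃ n, Ωs n = univ) (h : ∀ n, IsWeakDeriv (Ωs n) v u g) :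
    IsWeakDeriv univ v u g := by
  have hloc : ∀ {w : ℝ × ℝ → ℂ}, (∀ n, LocallyIntegrableOn w (Ωs n)) →
      LocallyIntegrableOn w univ := by
    intro w hw x _
    obtain ⟨n, hn⟩ := mem_iUnion.1 (hcover.symm ▸ mem_univ x : x ∈ ⋃ n, Ωs n)
    have := hw n x hn
    rwa [(hopen n).nhdsWithin_eq hn, ← nhdsWithin_univ] at this
  simp_rw [isWeakDeriv_iff] at h ⊢
  refine ⟨hloc fun n => (h n).1, hloc fun n => (h n).2.1, fun φ h1 h2 _ => ?_⟩
  obtain ⟨n, hn⟩ := IsCompact.elim_directed_cover h2 Ωs hopen (by rw [hcover]; exact subset_univ _)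
    (hmono.directed_le)
  exact (h n).2.2 φ h1 h2 hn

/-- Classical derivatives are weak derivatives. -/
theorem of_contDiff {w : ℝ × ℝ → ℂ} (hw : ContDiff ℝ ∞ w) :
    IsWeakDeriv Ω v w (fun x => fderiv ℝ w x v) := by
  have hdw := continuous_fderiv_apply_const hw v
  rw [isWeakDeriv_iff]
  refine ⟨hw.continuous.locallyIntegrable.locallyIntegrableOn _,
    hdw.locallyIntegrable.locallyIntegrableOn _, fun φ h1 h2 _ => ?_⟩
  have hl := hw.continuous.locallyIntegrable (μ := volume) |>.locallyIntegrableOn univ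
  have hl' := hdw.locallyIntegrable (μ := volume) |>.locallyIntegrableOn univ
  rw [eq_neg_iff_add_eq_zero, ← neg_eq_iff_add_eq_zero]
  exact (integral_mul_fderiv_eq_neg_fderiv_mul_of_integrable
    (integrable_fderiv_mul h1 h2 (subset_univ _) hl v)
    (integrable_mul_of_tsupport_subset h1.continuous h2 (subset_univ _) hl')
    (integrable_mul_of_tsupport_subset h1.continuous h2 (subset_univ _) hl)
    (fun x _ => h1.differentiable (by simp) x)
    (fun x _ => hw.differentiable (by simp) x)).symm

end IsWeakDeriv

/-! ### Mollification in `L²` -/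

open scoped Convolution Pointwise ENNReal in
/-- Continuity of translations in `L²(ℝ²)`. -/
theorem exists_eLpNorm_translate_sub_le {f : ℝ × ℝ → ℂ} (hf : MemLp f 2) {ε : ℝ≥0∞}
    (hε : 0 < ε) :
    ∃ δ : ℝ, 0 < δ ∧ ∀ t : ℝ × ℝ, ‖t‖ < δ → eLpNorm (fun x => f (x - t) - f x) 2 ≤ ε := by
  have : Fact ((2 : ℝ≥0∞) ≠ ⊤) := ⟨by simp⟩
  -- Translations act continuously on `Lp`; the claim is the continuity of one orbit map at 0.
  have hcont : Continuous fun t : ℝ × ℝ =>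
      (DomAddAct.mk (-t) +ᵥ hf.toLp f : Lp ℂ 2 (volume : Measure (ℝ × ℝ))) := by
    have h1 : Continuous fun t : ℝ × ℝ => DomAddAct.mk (-t) :=
      DomAddAct.continuous_mk.comp continuous_neg
    exact h1.vadd continuous_const
  have h0 := (EMetric.tendsto_nhds.1 (hcont.tendsto 0)) ε hε
  obtain ⟨δ, hδ, h⟩ := Metric.eventually_nhds_iff.1 h0
  refine ⟨δ, hδ, fun t ht => ?_⟩
  have h2 := (h (y := t) (by simpa using ht)).le
  rw [DomAddAct.mk_vadd_toLp, DomAddAct.mk_vadd_toLp, Lp.edist_toLp_toLp] at h2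
  refine le_trans (le_of_eq (eLpNorm_congr_ae (ae_of_all _ fun x => ?_))) h2
  simp [neg_add_eq_sub]

open scoped Convolution ENNReal in
/-- Mollifications converge in `L²(ℝ²)`. -/
theorem exists_eLpNorm_sub_convolution_le {f : ℝ × ℝ → ℂ} (hf : MemLp f 2) {ε : ℝ≥0∞}
    (hε : 0 < ε) :
    ∃ δ : ℝ, 0 < δ ∧ ∀ ρ : ContDiffBump (0 : ℝ × ℝ), ρ.rOut < δ →
      eLpNorm (fun x => f x - (ρ.normed volume ⋆[ContinuousLinearMap.lsmul ℝ ℝ, volume] f) x) 2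
        ≤ ε := by
  -- A strongly measurable representative makes (x, t) ↦ f (x − t) jointly measurable, as the
  -- interchange of integrals below requires.
  wlog hsm : StronglyMeasurable f generalizing f
  · obtain ⟨f', hf', hff'⟩ := hf.1
    obtain ⟨δ, hδ, h⟩ := this (hf.ae_eq hff') hf'
    refine ⟨δ, hδ, fun ρ hρ => ?_⟩
    rw [convolution_congr _ (EventuallyEq.refl _ _) hff']
    refine le_trans (le_of_eq (eLpNorm_congr_ae ?_)) (h ρ hρ)
    filter_upwards [hff'] with x hx
    rw [hx]
  obtain ⟨δ, hδ, hδt⟩ := exists_eLpNorm_translate_sub_le hf hε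
  refine ⟨δ, hδ, fun ρ hρ => ?_⟩
  set r : ℝ × ℝ → ℝ := ρ.normed volume with hr
  have hrc : Continuous r := ρ.continuous_normed
  -- The mollifier is read as a probability density. The mollification error is then an average of
  -- differences f (x − t) − f x over small t, and Jensen's inequality bounds its square.
  set ν : Measure (ℝ × ℝ) := volume.withDensity (fun t => ENNReal.ofReal (r t)) with hν
  have hrm : Measurable fun t => ENNReal.ofReal (r t) := hrc.measurable.ennreal_ofReal
  have : IsProbabilityMeasure ν := by
    refine ⟨?_⟩
    rw [hν, withDensity_apply _ MeasurableSet.univ, Measure.restrict_univ,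
      ← ofReal_integral_eq_lintegral_ofReal ρ.integrable_normed
        (ae_of_all _ fun t => ρ.nonneg_normed t), ρ.integral_normed, ENNReal.ofReal_one]
  have hball : ∀ᵐ t ∂ν, ‖t‖ < δ := by
    rw [hν, ae_withDensity_iff hrm]
    refine ae_of_all _ fun t ht => ?_
    have : t ∈ Function.support r := fun h => ht (by simp [h])
    rw [hr, ρ.support_normed_eq] at this
    have h2 : ‖t‖ < ρ.rOut := by simpa using this
    exact h2.trans hρ
  have hconv : ∀ x, (r ⋆[ContinuousLinearMap.lsmul ℝ ℝ, volume] f) x - f x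
      = ∫ t, (f (x - t) - f x) ∂ν := by
    intro x
    rw [hν, integral_withDensity_eq_integral_toReal_smul hrm (ae_of_all _ fun _ => by simp)]
    have e : ∀ t, (ENNReal.ofReal (r t)).toReal = r t := fun t =>
      ENNReal.toReal_ofReal (ρ.nonneg_normed t)
    simp_rw [e, smul_sub]
    have i1 : Integrable fun t => r t • f (x - t) :=
      ρ.hasCompactSupport_normed.convolutionExists_left (ContinuousLinearMap.lsmul ℝ ℝ)
        ρ.continuous_normed (hf.locallyIntegrable (by norm_num)) x
    rw [integral_sub i1 (ρ.integrable_normed.smul_const _), integral_smul_const,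
      ρ.integral_normed, one_smul]
    rfl
  have hmeas : StronglyMeasurable fun p : (ℝ × ℝ) × (ℝ × ℝ) => f (p.1 - p.2) - f p.1 :=
    (hsm.comp_measurable (measurable_fst.sub measurable_snd)).sub
      (hsm.comp_measurable measurable_fst)
  have sq : ∀ (μ : Measure (ℝ × ℝ)) (h : ℝ × ℝ → ℂ), eLpNorm h 2 μ ^ (2 : ℝ)
      = ∫⁻ x, ‖h x‖ₑ ^ (2 : ℝ) ∂μ := fun μ h => by
    have := eLpNorm_nnreal_pow_eq_lintegral (μ := μ) (f := h) (p := 2) (by norm_num)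
    simpa using this
  have hpt : ∀ x, ‖f x - (r ⋆[ContinuousLinearMap.lsmul ℝ ℝ, volume] f) x‖ₑ ^ (2 : ℝ)
      ≤ ∫⁻ t, ‖f (x - t) - f x‖ₑ ^ (2 : ℝ) ∂ν := by
    intro x
    rw [← sq, ← neg_sub, enorm_neg, hconv]
    gcongr
    refine (enorm_integral_le_lintegral_enorm _).trans ?_
    rw [← eLpNorm_one_eq_lintegral_enorm]
    refine eLpNorm_le_eLpNorm_of_exponent_le (by norm_num) ?_
    exact (hmeas.comp_measurable measurable_prodMk_left).aestronglyMeasurable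
  rw [← ENNReal.rpow_le_rpow_iff (z := 2) (by norm_num), sq]
  calc ∫⁻ x, ‖f x - (r ⋆[ContinuousLinearMap.lsmul ℝ ℝ, volume] f) x‖ₑ ^ (2 : ℝ)
      ≤ ∫⁻ x, ∫⁻ t, ‖f (x - t) - f x‖ₑ ^ (2 : ℝ) ∂ν := lintegral_mono hpt
    _ = ∫⁻ t, (∫⁻ x, ‖f (x - t) - f x‖ₑ ^ (2 : ℝ)) ∂ν := by
        rw [lintegral_lintegral_swap]
        exact (hmeas.enorm.pow_const _).aemeasurable
    _ ≤ ∫⁻ _, ε ^ (2 : ℝ) ∂ν := by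
        refine lintegral_mono_ae ?_
        filter_upwards [hball] with t ht
        rw [← sq]
        gcongr
        exact hδt t ht
    _ = ε ^ (2 : ℝ) := by simp

open scoped Convolution ENNReal in
/-- Mollification commutes with weak derivatives. -/
theorem IsWeakDeriv.fderiv_convolution {v : ℝ × ℝ} {u g : ℝ × ℝ → ℂ}
    (h : IsWeakDeriv univ v u g) (ρ : ContDiffBump (0 : ℝ × ℝ)) (x : ℝ × ℝ) :
    fderiv ℝ (ρ.normed volume ⋆[ContinuousLinearMap.lsmul ℝ ℝ, volume] u) x v
      = (ρ.normed volume ⋆[ContinuousLinearMap.lsmul ℝ ℝ, volume] g) x := by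
  have hu : LocallyIntegrable u := locallyIntegrableOn_univ.1 h.1
  set r : ℝ × ℝ → ℝ := ρ.normed volume with hr
  have hrs : ContDiff ℝ ∞ r := ρ.contDiff_normed
  have hrc : HasCompactSupport r := ρ.hasCompactSupport_normed
  rw [(hrc.hasFDerivAt_convolution_left (ContinuousLinearMap.lsmul ℝ ℝ)
    (hrs.of_le (by norm_cast)) hu x).fderiv]
  have hex : Integrable fun t => (ContinuousLinearMap.precompL (ℝ × ℝ)
      (ContinuousLinearMap.lsmul ℝ ℝ : ℝ →L[ℝ] ℂ →L[ℝ] ℂ)) (fderiv ℝ r t) (u (x - t)) :=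
    (hrc.fderiv ℝ).convolutionExists_left _ (hrs.continuous_fderiv (by simp)) hu x
  have e1 : (fderiv ℝ r ⋆[(ContinuousLinearMap.lsmul ℝ ℝ).precompL (ℝ × ℝ), volume] u) x v
      = ∫ t, fderiv ℝ r t v • u (x - t) := by
    rw [convolution_def, ContinuousLinearMap.integral_apply hex]
    rfl
  rw [e1, convolution_def, ← integral_sub_left_eq_self _ volume x,
    ← integral_sub_left_eq_self (fun t => (ContinuousLinearMap.lsmul ℝ ℝ) (r t) (g (x - t))) volume x]
  have hφ : ContDiff ℝ ∞ fun y => r (x - y) := hrs.comp (contDiff_const.sub contDiff_id)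
  have hφc : HasCompactSupport fun y => r (x - y) :=
    hrc.comp_homeomorph (Homeomorph.subLeft x)
  have key := h.3 _ hφ hφc (subset_univ _)
  have hd : ∀ y, fderiv ℝ (fun y => r (x - y)) y v = - fderiv ℝ r (x - y) v := by
    intro y
    have h1 : HasFDerivAt (fun y => r (x - y)) ((fderiv ℝ r (x - y)).comp
        (-ContinuousLinearMap.id ℝ (ℝ × ℝ))) y :=
      (hrs.differentiable (by simp) (x - y)).hasFDerivAt.comp y
        ((hasFDerivAt_id y).const_sub x)
    rw [h1.fderiv]
    simp
  simp only [hd, Measure.restrict_univ, neg_smul, integral_neg, neg_inj] at key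
  simpa using key

open scoped Convolution ENNReal in
/-- A weakly differentiable function with compact support in `Ω` is approximated by smooth functions
with compact support in `Ω`. -/
theorem exists_smooth_approx {Ω K : Set (ℝ × ℝ)} (hΩ : IsOpen Ω) (hK : IsCompact K) (hKΩ : K ⊆ Ω)
    {u g₁ g₂ : ℝ × ℝ → ℂ} (hu : MemLp u 2) (hg₁ : MemLp g₁ 2) (hg₂ : MemLp g₂ 2)
    (hw : IsWeakGrad univ u g₁ g₂) (hs : Function.support u ⊆ K) {ε : ℝ≥0∞} (hε : 0 < ε) :
    ∃ φ : ℝ × ℝ → ℂ, ContDiff ℝ ∞ φ ∧ HasCompactSupport φ ∧ tsupport φ ⊆ Ω ∧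
      eLpNorm (fun x => u x - φ x) 2 ≤ ε ∧
      eLpNorm (fun x => g₁ x - fderiv ℝ φ x (1, 0)) 2 ≤ ε ∧
      eLpNorm (fun x => g₂ x - fderiv ℝ φ x (0, 1)) 2 ≤ ε := by
  obtain ⟨δ₀, hδ₀, h0⟩ := exists_eLpNorm_sub_convolution_le hu hε
  obtain ⟨δ₁, hδ₁, h1⟩ := exists_eLpNorm_sub_convolution_le hg₁ hε
  obtain ⟨δ₂, hδ₂, h2⟩ := exists_eLpNorm_sub_convolution_le hg₂ hε
  obtain ⟨δ₃, hδ₃, h3⟩ := hK.exists_cthickening_subset_open hΩ hKΩ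
  obtain ⟨δ, hδ, hlt⟩ := exists_between (lt_min (lt_min hδ₀ hδ₁) (lt_min hδ₂ hδ₃))
  simp only [lt_min_iff] at hlt
  let ρ : ContDiffBump (0 : ℝ × ℝ) := ⟨δ / 2, δ, by positivity, by linarith⟩
  have hsub : tsupport (ρ.normed volume ⋆[ContinuousLinearMap.lsmul ℝ ℝ, volume] u)
      ⊆ Metric.cthickening δ₃ K := by
    refine closure_minimal ?_ Metric.isClosed_cthickening
    refine (support_convolution_subset _).trans ?_
    rintro _ ⟨a, ha, b, hb, rfl⟩
    rw [ρ.support_normed_eq] at ha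
    refine Metric.mem_cthickening_of_dist_le (a + b) b δ₃ K (hs hb) ?_
    have : ‖a‖ < δ := by simpa [ρ] using ha
    simpa using (this.trans hlt.2.2).le
  refine ⟨ρ.normed volume ⋆[ContinuousLinearMap.lsmul ℝ ℝ, volume] u, ?_, ?_, hsub.trans h3,
    h0 ρ hlt.1.1, ?_, ?_⟩
  · exact ρ.hasCompactSupport_normed.contDiff_convolution_left _ ρ.contDiff_normed
      (hu.locallyIntegrable (by norm_num))
  · exact hK.cthickening.of_isClosed_subset (isClosed_tsupport _) hsub
  · simp_rw [hw.1.fderiv_convolution]; exact h1 ρ hlt.1.2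
  · simp_rw [hw.2.fderiv_convolution]; exact h2 ρ hlt.2.1

/-! ### The spaces `H¹` and `H¹₀` -/

open scoped ENNReal in
-- Cauchy–Schwarz, as Hölder's inequality with exponents 2, 2 and 1.
theorem enorm_integral_mul_le {a f : ℝ × ℝ → ℂ} (ha : AEStronglyMeasurable a)
    (hf : AEStronglyMeasurable f) :
    ‖∫ x, a x * f x‖ₑ ≤ eLpNorm a 2 volume * eLpNorm f 2 volume := by
  refine (enorm_integral_le_lintegral_enorm _).trans ?_
  rw [← eLpNorm_one_eq_lintegral_enorm]
  have h : eLpNorm (a • f) 1 volume ≤ eLpNorm a 2 volume * eLpNorm f 2 volume :=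
    eLpNorm_smul_le_mul_eLpNorm hf ha
  exact h

/-- Weak derivatives are stable under `L²` limits. -/
theorem IsWeakDeriv.of_approx {v : ℝ × ℝ} {u g : ℝ × ℝ → ℂ} (hu : MemLp u 2) (hg : MemLp g 2)
    (h : ∀ ε : ℝ, 0 < ε → ∃ ψ : ℝ × ℝ → ℂ, ContDiff ℝ ∞ ψ ∧
      eLpNorm (fun x => u x - ψ x) 2 ≤ ENNReal.ofReal ε ∧
      eLpNorm (fun x => g x - fderiv ℝ ψ x v) 2 ≤ ENNReal.ofReal ε) :
    IsWeakDeriv univ v u g := by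
  have hul := (hu.locallyIntegrable (by norm_num)).locallyIntegrableOn univ
  have hgl := (hg.locallyIntegrable (by norm_num)).locallyIntegrableOn univ
  rw [isWeakDeriv_iff]
  refine ⟨hul, hgl, fun φ h1 h2 h3 => ?_⟩
  have hdc := continuous_fderiv_apply_const h1 v
  have hds := hasCompactSupport_fderiv_apply h2 v
  have hφL : MemLp φ 2 := h1.continuous.memLp_of_hasCompactSupport h2
  have hdL : MemLp (fun x => fderiv ℝ φ x v) 2 := hdc.memLp_of_hasCompactSupport hds
  -- The defect of the integration by parts is linear in (u, g) and vanishes for smooth functions,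
  -- so an approximation within ε bounds it by a multiple of ε.
  set A := (∫ x, fderiv ℝ φ x v * u x) + ∫ x, φ x * g x with hA
  set C := eLpNorm (fun x => fderiv ℝ φ x v) 2 volume + eLpNorm φ 2 volume with hC
  have hCtop : C ≠ ⊤ := ENNReal.add_ne_top.2 ⟨hdL.2.ne, hφL.2.ne⟩
  have bound : ∀ ε : ℝ, 0 < ε → ‖A‖ ≤ C.toReal * ε := by
    intro ε hε
    obtain ⟨ψ, hψ, b1, b2⟩ := h ε hε
    have hψl := (hψ.continuous.locallyIntegrable (μ := volume)).locallyIntegrableOn univ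
    have hdψl := ((continuous_fderiv_apply_const hψ v).locallyIntegrable
      (μ := volume)).locallyIntegrableOn univ
    have key := (isWeakDeriv_iff.1 (IsWeakDeriv.of_contDiff (Ω := univ) (v := v) hψ)).2.2 φ h1 h2 h3
    have eA : A = (∫ x, fderiv ℝ φ x v * (u x - ψ x)) + ∫ x, φ x * (g x - fderiv ℝ ψ x v) := by
      simp_rw [mul_sub]
      rw [integral_sub (integrable_fderiv_mul h1 h2 h3 hul v)
          (integrable_fderiv_mul h1 h2 h3 hψl v),
        integral_sub (integrable_mul_of_tsupport_subset h1.continuous h2 h3 hgl)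
          (integrable_mul_of_tsupport_subset h1.continuous h2 h3 hdψl), key, hA]
      ring
    have hA' : ‖A‖ₑ ≤ C * ENNReal.ofReal ε := by
      rw [eA, hC, add_mul]
      refine (enorm_add_le _ _).trans (add_le_add ?_ ?_)
      · refine (enorm_integral_mul_le hdL.1 (hu.1.sub hψ.continuous.aestronglyMeasurable)).trans ?_
        gcongr
        exact b1
      · refine (enorm_integral_mul_le hφL.1 (hg.1.sub
          (continuous_fderiv_apply_const hψ v).aestronglyMeasurable)).trans ?_
        gcongr
        exact b2
    have := ENNReal.toReal_mono (ENNReal.mul_ne_top hCtop ENNReal.ofReal_ne_top) hA'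
    rwa [toReal_enorm, ENNReal.toReal_mul, ENNReal.toReal_ofReal hε.le] at this
  have hzero : A = 0 := by
    by_contra hne
    have hpos : 0 < ‖A‖ := norm_pos_iff.2 hne
    have hC0 : 0 ≤ C.toReal := ENNReal.toReal_nonneg
    have := bound (‖A‖ / (2 * (C.toReal + 1))) (by positivity)
    rw [mul_div_assoc', le_div_iff₀ (by positivity)] at this
    nlinarith
  exact eq_neg_of_add_eq_zero_left hzero

section

variable {Ω Ω' : Set (ℝ × ℝ)} {u g₁ g₂ u' g₁' g₂' : ℝ × ℝ → ℂ}

theorem MemLp.mul_of_bound {χ u : ℝ × ℝ → ℂ} {μ : Measure (ℝ × ℝ)} (hu : MemLp u 2 μ)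
    (hχ : Continuous χ) {M : ℝ} (hM : ∀ᵐ x ∂μ, ‖χ x‖ ≤ M) : MemLp (fun x => χ x * u x) 2 μ := by
  refine MemLp.of_le_mul (c := M) hu (hχ.aestronglyMeasurable.mul hu.1) ?_
  filter_upwards [hM] with x hx
  rw [norm_mul]
  gcongr

theorem MemH1.mono (h : MemH1 Ω u g₁ g₂) (hΩ : Ω' ⊆ Ω) : MemH1 Ω' u g₁ g₂ where
  memLp := h.1.mono_measure (Measure.restrict_mono_set _ hΩ)
  memLp₁ := h.2.mono_measure (Measure.restrict_mono_set _ hΩ)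
  memLp₂ := h.3.mono_measure (Measure.restrict_mono_set _ hΩ)
  weakGrad := ⟨h.4.1.mono hΩ, h.4.2.mono hΩ⟩

theorem MemH1.congr (h : MemH1 Ω u g₁ g₂) (hΩ : MeasurableSet Ω) (hu : EqOn u u' Ω)
    (hg₁ : EqOn g₁ g₁' Ω) (hg₂ : EqOn g₂ g₂' Ω) : MemH1 Ω u' g₁' g₂' where
  memLp := h.1.ae_eq (ae_restrict_of_forall_mem hΩ hu)
  memLp₁ := h.2.ae_eq (ae_restrict_of_forall_mem hΩ hg₁)
  memLp₂ := h.3.ae_eq (ae_restrict_of_forall_mem hΩ hg₂)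
  weakGrad := ⟨h.4.1.congr hΩ hu hg₁, h.4.2.congr hΩ hu hg₂⟩

theorem MemH1.add (h : MemH1 Ω u g₁ g₂) (h' : MemH1 Ω u' g₁' g₂') :
    MemH1 Ω (fun x => u x + u' x) (fun x => g₁ x + g₁' x) (fun x => g₂ x + g₂' x) where
  memLp := h.1.add h'.1
  memLp₁ := h.2.add h'.2
  memLp₂ := h.3.add h'.3
  weakGrad := ⟨h.4.1.add h'.4.1, h.4.2.add h'.4.2⟩

theorem MemH1.mul_smooth (h : MemH1 Ω u g₁ g₂) (hΩ : IsOpen Ω) {χ : ℝ × ℝ → ℂ}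
    (hχ : ContDiff ℝ ∞ χ) {M : ℝ} (hM : ∀ x, ‖χ x‖ ≤ M) (hM₁ : ∀ x, ‖fderiv ℝ χ x (1, 0)‖ ≤ M)
    (hM₂ : ∀ x, ‖fderiv ℝ χ x (0, 1)‖ ≤ M) :
    MemH1 Ω (fun x => χ x * u x) (fun x => χ x * g₁ x + fderiv ℝ χ x (1, 0) * u x)
      (fun x => χ x * g₂ x + fderiv ℝ χ x (0, 1) * u x) where
  memLp := MemLp.mul_of_bound h.1 hχ.continuous (ae_of_all _ hM)
  memLp₁ := (MemLp.mul_of_bound h.2 hχ.continuous (ae_of_all _ hM)).add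
    (MemLp.mul_of_bound h.1 (continuous_fderiv_apply_const hχ _) (ae_of_all _ hM₁))
  memLp₂ := (MemLp.mul_of_bound h.3 hχ.continuous (ae_of_all _ hM)).add
    (MemLp.mul_of_bound h.1 (continuous_fderiv_apply_const hχ _) (ae_of_all _ hM₂))
  weakGrad := ⟨h.4.1.mul_smooth hΩ hχ, h.4.2.mul_smooth hΩ hχ⟩

theorem measurePreserving_sub_restrict (a : ℝ × ℝ) (hΩ : MeasurableSet Ω) :
    MeasurePreserving (fun x : ℝ × ℝ => x - a) (volume.restrict ((fun x => x - a) ⁻¹' Ω))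
      (volume.restrict Ω) :=
  (measurePreserving_sub_right (volume : Measure (ℝ × ℝ)) a).restrict_preimage hΩ

theorem MemH1.translate (h : MemH1 Ω u g₁ g₂) (hΩ : MeasurableSet Ω) (a : ℝ × ℝ) :
    MemH1 ((fun x => x - a) ⁻¹' Ω) (fun x => u (x - a)) (fun x => g₁ (x - a))
      (fun x => g₂ (x - a)) where
  memLp := h.1.comp_measurePreserving (measurePreserving_sub_restrict a hΩ)
  memLp₁ := h.2.comp_measurePreserving (measurePreserving_sub_restrict a hΩ)
  memLp₂ := h.3.comp_measurePreserving (measurePreserving_sub_restrict a hΩ)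
  weakGrad := ⟨h.4.1.translate a, h.4.2.translate a⟩

/-- It suffices to approximate up to a fixed multiple of `ε`. -/
theorem MemH10.of_approx_le (h : MemH1 Ω u g₁ g₂) {C : ℝ} (hC : 0 < C)
    (happ : ∀ ε : ℝ, 0 < ε → ∃ φ : ℝ × ℝ → ℂ,
      ContDiff ℝ ∞ φ ∧ HasCompactSupport φ ∧ tsupport φ ⊆ Ω ∧
      eLpNorm (fun x => u x - φ x) 2 (volume.restrict Ω) ≤ ENNReal.ofReal (C * ε) ∧
      eLpNorm (fun x => g₁ x - fderiv ℝ φ x (1, 0)) 2 (volume.restrict Ω)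
        ≤ ENNReal.ofReal (C * ε) ∧
      eLpNorm (fun x => g₂ x - fderiv ℝ φ x (0, 1)) 2 (volume.restrict Ω)
        ≤ ENNReal.ofReal (C * ε)) : MemH10 Ω u g₁ g₂ := by
  refine ⟨h, fun ε hε => ?_⟩
  obtain ⟨φ, h1, h2, h3, h4, h5, h6⟩ := happ (ε / (2 * C)) (by positivity)
  have hlt : ENNReal.ofReal (C * (ε / (2 * C))) < ENNReal.ofReal ε := by
    rw [ENNReal.ofReal_lt_ofReal_iff hε]
    field_simp
    norm_num
  exact ⟨φ, h1, h2, h3, h4.trans_lt hlt, h5.trans_lt hlt, h6.trans_lt hlt⟩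

theorem MemH10.congr (h : MemH10 Ω u g₁ g₂) (hΩ : MeasurableSet Ω) (hu : EqOn u u' Ω)
    (hg₁ : EqOn g₁ g₁' Ω) (hg₂ : EqOn g₂ g₂' Ω) : MemH10 Ω u' g₁' g₂' := by
  refine ⟨h.1.congr hΩ hu hg₁ hg₂, fun ε hε => ?_⟩
  obtain ⟨φ, h1, h2, h3, h4, h5, h6⟩ := h.2 ε hε
  have e : ∀ {w w' : ℝ × ℝ → ℂ} (f : ℝ × ℝ → ℂ), EqOn w w' Ω →
      eLpNorm (fun x => w' x - f x) 2 (volume.restrict Ω) =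
        eLpNorm (fun x => w x - f x) 2 (volume.restrict Ω) := fun f hw =>
    eLpNorm_congr_ae (ae_restrict_of_forall_mem hΩ fun x hx => by simp only [hw hx])
  refine ⟨φ, h1, h2, h3, ?_, ?_, ?_⟩
  · rwa [e φ hu]
  · rwa [e _ hg₁]
  · rwa [e _ hg₂]

theorem MemH10.add (h : MemH10 Ω u g₁ g₂) (h' : MemH10 Ω u' g₁' g₂') :
    MemH10 Ω (fun x => u x + u' x) (fun x => g₁ x + g₁' x) (fun x => g₂ x + g₂' x) := by
  refine MemH10.of_approx_le (h.1.add h'.1) (C := 2) two_pos fun ε hε => ?_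
  obtain ⟨φ, h1, h2, h3, h4, h5, h6⟩ := h.2 ε hε
  obtain ⟨ψ, k1, k2, k3, k4, k5, k6⟩ := h'.2 ε hε
  have key : ∀ {w w' f f' : ℝ × ℝ → ℂ}, MemLp w 2 (volume.restrict Ω) →
      MemLp w' 2 (volume.restrict Ω) → Continuous f → Continuous f' →
      eLpNorm (fun x => w x - f x) 2 (volume.restrict Ω) < ENNReal.ofReal ε →
      eLpNorm (fun x => w' x - f' x) 2 (volume.restrict Ω) < ENNReal.ofReal ε →
      eLpNorm (fun x => w x + w' x - (f x + f' x)) 2 (volume.restrict Ω)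
        ≤ ENNReal.ofReal (2 * ε) := by
    intro w w' f f' hw hw' hf hf' b b'
    have e : (fun x => w x + w' x - (f x + f' x)) =
        (fun x => w x - f x) + fun x => w' x - f' x := by
      ext x; simp only [Pi.add_apply]; ring
    rw [e, two_mul, ENNReal.ofReal_add hε.le hε.le]
    exact (eLpNorm_add_le (hw.1.sub hf.aestronglyMeasurable) (hw'.1.sub hf'.aestronglyMeasurable)
      (by norm_num)).trans (add_le_add b.le b'.le)
  have hd : ∀ x, fderiv ℝ (fun x => φ x + ψ x) x = fderiv ℝ φ x + fderiv ℝ ψ x := fun x =>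
    fderiv_fun_add (h1.differentiable (by simp) x) (k1.differentiable (by simp) x)
  refine ⟨fun x => φ x + ψ x, h1.add k1, h2.add k2,
    (tsupport_add φ ψ).trans (union_subset h3 k3),
    key h.1.1 h'.1.1 h1.continuous k1.continuous h4 k4, ?_, ?_⟩
  · simp_rw [hd]
    exact key h.1.2 h'.1.2 (continuous_fderiv_apply_const h1 _)
      (continuous_fderiv_apply_const k1 _) h5 k5
  · simp_rw [hd]
    exact key h.1.3 h'.1.3 (continuous_fderiv_apply_const h1 _)
      (continuous_fderiv_apply_const k1 _) h6 k6

theorem MemH10.of_contDiff {φ : ℝ × ℝ → ℂ} (h1 : ContDiff ℝ ∞ φ) (h2 : HasCompactSupport φ)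
    (h3 : tsupport φ ⊆ Ω) :
    MemH10 Ω φ (fun x => fderiv ℝ φ x (1, 0)) (fun x => fderiv ℝ φ x (0, 1)) where
  memH1 :=
    { memLp := (h1.continuous.memLp_of_hasCompactSupport h2).restrict _
      memLp₁ := ((continuous_fderiv_apply_const h1 _).memLp_of_hasCompactSupport
        (hasCompactSupport_fderiv_apply h2 _)).restrict _
      memLp₂ := ((continuous_fderiv_apply_const h1 _).memLp_of_hasCompactSupport
        (hasCompactSupport_fderiv_apply h2 _)).restrict _
      weakGrad := ⟨.of_contDiff h1, .of_contDiff h1⟩ }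
  approx := fun ε hε => ⟨φ, h1, h2, h3, by simpa using hε, by simpa using hε, by simpa using hε⟩

theorem MemH10.zero : MemH10 Ω (fun _ => 0) (fun _ => 0) (fun _ => 0) := by
  have h : HasCompactSupport fun _ : ℝ × ℝ => (0 : ℂ) := HasCompactSupport.zero
  have h' : tsupport (fun _ : ℝ × ℝ => (0 : ℂ)) ⊆ Ω := by
    simp [tsupport, Function.support_fun_zero]
  simpa using MemH10.of_contDiff (Ω := Ω) contDiff_const h h'

theorem MemH10.sum {ι : Type*} (s : Finset ι) {U G₁ G₂ : ι → ℝ × ℝ → ℂ}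
    (h : ∀ i ∈ s, MemH10 Ω (U i) (G₁ i) (G₂ i)) :
    MemH10 Ω (fun x => ∑ i ∈ s, U i x) (fun x => ∑ i ∈ s, G₁ i x) (fun x => ∑ i ∈ s, G₂ i x) := by
  classical
  induction s using Finset.induction_on with
  | empty => simpa using MemH10.zero
  | insert i s hi ih =>
    simp_rw [Finset.sum_insert hi]
    exact (h i (Finset.mem_insert_self _ _)).add
      (ih fun j hj => h j (Finset.mem_insert_of_mem hj))

theorem MemH10.mul_smooth (h : MemH10 Ω u g₁ g₂) (hΩ : IsOpen Ω) {χ : ℝ × ℝ → ℂ}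
    (hχ : ContDiff ℝ ∞ χ) {M : ℝ} (hM : ∀ x, ‖χ x‖ ≤ M) (hM₁ : ∀ x, ‖fderiv ℝ χ x (1, 0)‖ ≤ M)
    (hM₂ : ∀ x, ‖fderiv ℝ χ x (0, 1)‖ ≤ M) :
    MemH10 Ω (fun x => χ x * u x) (fun x => χ x * g₁ x + fderiv ℝ χ x (1, 0) * u x)
      (fun x => χ x * g₂ x + fderiv ℝ χ x (0, 1) * u x) := by
  have hM0 : 0 ≤ M := (norm_nonneg _).trans (hM 0)
  refine MemH10.of_approx_le (h.1.mul_smooth hΩ hχ hM hM₁ hM₂) (C := 2 * M + 1) (by positivity)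
    fun ε hε => ?_
  obtain ⟨φ, h1, h2, h3, h4, h5, h6⟩ := h.2 ε hε
  have step : ∀ {a w : ℝ × ℝ → ℂ}, (∀ x, ‖a x‖ ≤ M) →
      eLpNorm w 2 (volume.restrict Ω) < ENNReal.ofReal ε →
      eLpNorm (fun x => a x * w x) 2 (volume.restrict Ω) ≤ ENNReal.ofReal (M * ε) := by
    intro a w ha hw
    have : eLpNorm (fun x => a x * w x) 2 (volume.restrict Ω)
        ≤ ENNReal.ofReal M * eLpNorm w 2 (volume.restrict Ω) :=
      eLpNorm_le_mul_eLpNorm_of_ae_le_mul (ae_of_all _ fun x => by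
        rw [norm_mul]; exact mul_le_mul_of_nonneg_right (ha x) (norm_nonneg _)) 2
    rw [ENNReal.ofReal_mul hM0]
    exact this.trans (by gcongr)
  have key : ∀ {v : ℝ × ℝ} {g : ℝ × ℝ → ℂ}, (∀ x, ‖fderiv ℝ χ x v‖ ≤ M) →
      MemLp g 2 (volume.restrict Ω) →
      eLpNorm (fun x => g x - fderiv ℝ φ x v) 2 (volume.restrict Ω) < ENNReal.ofReal ε →
      eLpNorm (fun x => χ x * g x + fderiv ℝ χ x v * u x - fderiv ℝ (fun x => χ x * φ x) x v) 2
        (volume.restrict Ω) ≤ ENNReal.ofReal ((2 * M + 1) * ε) := by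
    intro v g hv hg hb
    have e : (fun x => χ x * g x + fderiv ℝ χ x v * u x - fderiv ℝ (fun x => χ x * φ x) x v) =
        (fun x => χ x * (g x - fderiv ℝ φ x v)) + fun x => fderiv ℝ χ x v * (u x - φ x) := by
      ext x
      rw [fderiv_fun_mul (hχ.differentiable (by simp) x) (h1.differentiable (by simp) x)]
      simp; ring
    rw [e]
    refine (eLpNorm_add_le ?_ ?_ (by norm_num)).trans
      ((add_le_add (step hM hb) (step hv h4)).trans ?_)
    · exact hχ.continuous.aestronglyMeasurable.mul
        (hg.1.sub (continuous_fderiv_apply_const h1 _).aestronglyMeasurable)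
    · exact (continuous_fderiv_apply_const hχ _).aestronglyMeasurable.mul
        (h.1.1.1.sub h1.continuous.aestronglyMeasurable)
    · rw [← ENNReal.ofReal_add (by positivity) (by positivity)]
      exact ENNReal.ofReal_le_ofReal (by nlinarith)
  refine ⟨fun x => χ x * φ x, hχ.mul h1, h2.mul_left, tsupport_mul_subset_right.trans h3, ?_,
    key hM₁ h.1.2 h5, key hM₂ h.1.3 h6⟩
  simp_rw [← mul_sub]
  exact (step hM h4).trans (ENNReal.ofReal_le_ofReal (by nlinarith))

theorem MemH10.translate (h : MemH10 Ω u g₁ g₂) (hΩ : MeasurableSet Ω) (a : ℝ × ℝ) :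
    MemH10 ((fun x => x - a) ⁻¹' Ω) (fun x => u (x - a)) (fun x => g₁ (x - a))
      (fun x => g₂ (x - a)) := by
  refine ⟨h.1.translate hΩ a, fun ε hε => ?_⟩
  obtain ⟨φ, h1, h2, h3, h4, h5, h6⟩ := h.2 ε hε
  have hts : tsupport (fun x => φ (x - a)) = (fun x => x - a) ⁻¹' tsupport φ :=
    tsupport_comp_eq_preimage φ (Homeomorph.subRight a)
  have key : ∀ {w f : ℝ × ℝ → ℂ}, MemLp w 2 (volume.restrict Ω) → Continuous f →
      eLpNorm (fun x => w x - f x) 2 (volume.restrict Ω) < ENNReal.ofReal ε →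
      eLpNorm (fun x => w (x - a) - f (x - a)) 2 (volume.restrict ((fun x => x - a) ⁻¹' Ω))
        < ENNReal.ofReal ε := by
    intro w f hw hf hb
    have hm : AEStronglyMeasurable (fun x => w x - f x) (volume.restrict Ω) :=
      hw.1.sub hf.aestronglyMeasurable
    have := eLpNorm_comp_measurePreserving (p := 2) hm (measurePreserving_sub_restrict a hΩ)
    have e : (fun x => w (x - a) - f (x - a)) = (fun x => w x - f x) ∘ fun x => x - a := rfl
    rw [e, this]
    exact hb
  have hφa : ContDiff ℝ ∞ fun x => φ (x - a) := h1.comp (contDiff_id.sub contDiff_const)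
  refine ⟨fun x => φ (x - a), hφa,
    h2.comp_homeomorph (Homeomorph.subRight a), ?_, ?_, ?_, ?_⟩
  · rw [hts]; exact preimage_mono h3
  · exact key h.1.1 h1.continuous h4
  · simp_rw [fderiv_comp_sub]
    exact key (f := fun x => fderiv ℝ φ x (1, 0)) h.1.2 (continuous_fderiv_apply_const h1 _) h5
  · simp_rw [fderiv_comp_sub]
    exact key (f := fun x => fderiv ℝ φ x (0, 1)) h.1.3 (continuous_fderiv_apply_const h1 _) h6

/-- Extension by zero. -/
theorem MemH10.extend (h : MemH10 Ω u g₁ g₂) (hΩ : MeasurableSet Ω) (hsub : Ω ⊆ Ω') :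
    MemH10 Ω' (Ω.indicator u) (Ω.indicator g₁) (Ω.indicator g₂) := by
  have hL : ∀ {w : ℝ × ℝ → ℂ}, MemLp w 2 (volume.restrict Ω) → MemLp (Ω.indicator w) 2 volume :=
    fun hw => (memLp_indicator_iff_restrict hΩ).2 hw
  have hnorm : ∀ {w f : ℝ × ℝ → ℂ}, tsupport f ⊆ Ω →
      eLpNorm (fun x => Ω.indicator w x - f x) 2 volume =
        eLpNorm (fun x => w x - f x) 2 (volume.restrict Ω) := by
    intro w f hf
    rw [← eLpNorm_indicator_eq_eLpNorm_restrict hΩ]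
    congr 1
    ext x
    by_cases hx : x ∈ Ω
    · simp [hx]
    · have : f x = 0 := by
        by_contra h0; exact hx (hf (subset_tsupport _ h0))
      simp [hx, this]
  have hnorm' : ∀ {w f : ℝ × ℝ → ℂ}, tsupport f ⊆ Ω →
      eLpNorm (fun x => Ω.indicator w x - f x) 2 (volume.restrict Ω') ≤
        eLpNorm (fun x => w x - f x) 2 (volume.restrict Ω) := fun hf =>
    (eLpNorm_mono_measure _ Measure.restrict_le_self).trans (hnorm hf).le
  -- The approximants are smooth on the whole plane and vanish off Ω, so they approximate the zero
  -- extension on the plane, and no boundary term arises in the limit.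
  have hw : IsWeakGrad univ (Ω.indicator u) (Ω.indicator g₁) (Ω.indicator g₂) := by
    constructor
    · refine IsWeakDeriv.of_approx (hL h.1.1) (hL h.1.2) fun ε hε => ?_
      obtain ⟨φ, h1, h2, h3, h4, h5, h6⟩ := h.2 ε hε
      refine ⟨φ, h1, ?_, ?_⟩
      · rw [hnorm h3]; exact h4.le
      · rw [hnorm ((tsupport_fderiv_apply_subset' φ _).trans h3)]; exact h5.le
    · refine IsWeakDeriv.of_approx (hL h.1.1) (hL h.1.3) fun ε hε => ?_
      obtain ⟨φ, h1, h2, h3, h4, h5, h6⟩ := h.2 ε hε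
      refine ⟨φ, h1, ?_, ?_⟩
      · rw [hnorm h3]; exact h4.le
      · rw [hnorm ((tsupport_fderiv_apply_subset' φ _).trans h3)]; exact h6.le
  refine ⟨⟨(hL h.1.1).restrict _, (hL h.1.2).restrict _, (hL h.1.3).restrict _,
    hw.1.mono (subset_univ _), hw.2.mono (subset_univ _)⟩, fun ε hε => ?_⟩
  obtain ⟨φ, h1, h2, h3, h4, h5, h6⟩ := h.2 ε hε
  exact ⟨φ, h1, h2, h3.trans hsub, (hnorm' h3).trans_lt h4,
    (hnorm' ((tsupport_fderiv_apply_subset' φ _).trans h3)).trans_lt h5,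
    (hnorm' ((tsupport_fderiv_apply_subset' φ _).trans h3)).trans_lt h6⟩

/-- The product of an `H¹` function with a smooth cutoff is in `H¹₀`. -/
theorem MemH1.mul_cutoff (h : MemH1 Ω u g₁ g₂) (hΩ : IsOpen Ω) {χ : ℝ × ℝ → ℂ}
    (hχ : ContDiff ℝ ∞ χ) (hc : HasCompactSupport χ) (hs : tsupport χ ⊆ Ω) :
    MemH10 Ω (fun x => χ x * u x) (fun x => χ x * g₁ x + fderiv ℝ χ x (1, 0) * u x)
      (fun x => χ x * g₂ x + fderiv ℝ χ x (0, 1) * u x) := by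
  obtain ⟨M₀, hM₀⟩ := hc.exists_bound_of_continuous hχ.continuous
  obtain ⟨M₁, hM₁⟩ := (hasCompactSupport_fderiv_apply hc (1, 0)).exists_bound_of_continuous
    (continuous_fderiv_apply_const hχ _)
  obtain ⟨M₂, hM₂⟩ := (hasCompactSupport_fderiv_apply hc (0, 1)).exists_bound_of_continuous
    (continuous_fderiv_apply_const hχ _)
  have hH := h.mul_smooth hΩ hχ (M := max M₀ (max M₁ M₂)) (fun x => (hM₀ x).trans (le_max_left _ _))
    (fun x => (hM₁ x).trans ((le_max_left _ _).trans (le_max_right _ _)))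
    (fun x => (hM₂ x).trans ((le_max_right _ _).trans (le_max_right _ _)))
  have hχ0 : ∀ x ∉ Ω, χ x = 0 := fun x hx => by
    by_contra h0; exact hx (hs (subset_tsupport _ h0))
  have hdχ0 : ∀ (v : ℝ × ℝ), ∀ x ∉ Ω, fderiv ℝ χ x v = 0 := fun v x hx => by
    by_contra h0
    exact hx (hs (tsupport_fderiv_apply_subset' χ v (subset_tsupport _ h0)))
  have hL : ∀ {w : ℝ × ℝ → ℂ}, (∀ x ∉ Ω, w x = 0) → MemLp w 2 (volume.restrict Ω) →
      MemLp w 2 volume := by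
    intro w h0 hw
    rw [← memLp_indicator_iff_restrict hΩ.measurableSet] at hw
    rwa [indicator_eq_self.2 fun x hx => by_contra fun h => hx (h0 x h)] at hw
  have L0 := hL (fun x hx => by simp [hχ0 x hx]) hH.1
  have L1 := hL (fun x hx => by simp [hχ0 x hx, hdχ0 _ x hx]) hH.2
  have L2 := hL (fun x hx => by simp [hχ0 x hx, hdχ0 _ x hx]) hH.3
  -- For an arbitrary test function φ on the plane, φχ is supported in Ω and may be tested against u
  -- there. Once the product is weakly differentiable on the plane, mollification supplies the
  -- approximants.
  have hWD : ∀ {v : ℝ × ℝ} {g : ℝ × ℝ → ℂ}, IsWeakDeriv Ω v u g →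
      MemLp (fun x => χ x * g x + fderiv ℝ χ x v * u x) 2 volume →
      IsWeakDeriv univ v (fun x => χ x * u x) (fun x => χ x * g x + fderiv ℝ χ x v * u x) := by
    intro v g hg hgL
    rw [isWeakDeriv_iff]
    refine ⟨(L0.locallyIntegrable (by norm_num)).locallyIntegrableOn _,
      (hgL.locallyIntegrable (by norm_num)).locallyIntegrableOn _, fun φ h1 h2 _ => ?_⟩
    have hg' := isWeakDeriv_iff.1 hg
    have hts : tsupport (fun x => φ x * χ x) ⊆ Ω := tsupport_mul_subset_right.trans hs
    have key := hg'.2.2 (fun x => φ x * χ x) (h1.mul hχ) h2.mul_right hts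
    have hd : ∀ x, fderiv ℝ (fun x => φ x * χ x) x v = φ x * fderiv ℝ χ x v
        + χ x * fderiv ℝ φ x v := by
      intro x
      rw [fderiv_fun_mul (h1.differentiable (by simp) x) (hχ.differentiable (by simp) x)]
      simp
    have i1 : Integrable (fun x => (χ x * fderiv ℝ φ x v) * u x) :=
      integrable_mul_of_tsupport_subset (hχ.continuous.mul (continuous_fderiv_apply_const h1 v))
        hc.mul_right (tsupport_mul_subset_left.trans hs) hg.1
    have i2 : Integrable (fun x => (φ x * fderiv ℝ χ x v) * u x) :=
      integrable_mul_of_tsupport_subset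
        (h1.continuous.mul (continuous_fderiv_apply_const hχ v)) h2.mul_right
        (tsupport_mul_subset_right.trans ((tsupport_fderiv_apply_subset' χ v).trans hs)) hg.1
    have i3 : Integrable (fun x => (φ x * χ x) * g x) :=
      integrable_mul_of_tsupport_subset (h1.continuous.mul hχ.continuous) h2.mul_right hts hg.2
    simp_rw [hd, add_mul] at key
    rw [integral_add i2 i1] at key
    have e1 : ∀ x, fderiv ℝ φ x v * (χ x * u x) = χ x * fderiv ℝ φ x v * u x := fun x => by ring
    have e2 : ∀ x, φ x * (χ x * g x + fderiv ℝ χ x v * u x) =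
        φ x * χ x * g x + φ x * fderiv ℝ χ x v * u x := fun x => by ring
    simp_rw [e1, e2]
    rw [integral_add i3 i2]
    linear_combination key
  refine MemH10.of_approx_le hH (C := 1) one_pos fun ε hε => ?_
  obtain ⟨φ, h1, h2, h3, h4, h5, h6⟩ := exists_smooth_approx hΩ hc hs L0 L1 L2
    ⟨hWD h.4.1 L1, hWD h.4.2 L2⟩
    (fun x hx => subset_tsupport _ fun h0 => hx (by simp [h0])) (ε := ENNReal.ofReal ε)
    (by simpa using hε)
  rw [one_mul]
  exact ⟨φ, h1, h2, h3, (eLpNorm_mono_measure _ Measure.restrict_le_self).trans h4,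
    (eLpNorm_mono_measure _ Measure.restrict_le_self).trans h5,
    (eLpNorm_mono_measure _ Measure.restrict_le_self).trans h6⟩

end

/-! ### Squares and their partition into cells -/

theorem isOpen_Q (R : ℝ) : IsOpen (Q R) := isOpen_Ioo.prod isOpen_Ioo

theorem measurableSet_Q (R : ℝ) : MeasurableSet (Q R) := (isOpen_Q R).measurableSet

theorem mem_Q {R : ℝ} {x : ℝ × ℝ} :
    x ∈ Q R ↔ (-R / 2 < x.1 ∧ x.1 < R / 2) ∧ (-R / 2 < x.2 ∧ x.2 < R / 2) := Iff.rfl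

theorem Q_mono {R R' : ℝ} (h : R ≤ R') : Q R ⊆ Q R' := by
  intro x hx
  rw [mem_Q] at hx ⊢
  refine ⟨⟨?_, ?_⟩, ?_, ?_⟩ <;> linarith [hx.1.1, hx.1.2, hx.2.1, hx.2.2]

theorem volume_Q (R : ℝ) : volume (Q R) = ENNReal.ofReal R * ENNReal.ofReal R := by
  rw [Q, Measure.volume_eq_prod, Measure.prod_prod, Real.volume_Ioo]
  congr 2 <;> ring

theorem volume_Q_lt_top (R : ℝ) : volume (Q R) < ⊤ := by
  rw [volume_Q]; exact ENNReal.mul_lt_top ENNReal.ofReal_lt_top ENNReal.ofReal_lt_top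

theorem volume_real_Q {R : ℝ} (hR : 0 ≤ R) : volume.real (Q R) = R ^ 2 := by
  rw [measureReal_def, volume_Q, ENNReal.toReal_mul, ENNReal.toReal_ofReal hR, sq]

/-- The half-open square with the same interior as `Q R`. -/
def halfOpenQ (R : ℝ) : Set (ℝ × ℝ) := Ico (-R / 2) (R / 2) ×ˢ Ico (-R / 2) (R / 2)

theorem Q_ae_eq_halfOpenQ (R : ℝ) : Q R =ᵐ[volume] halfOpenQ R := by
  rw [Measure.volume_eq_prod]
  exact Measure.set_prod_ae_eq Ioo_ae_eq_Ico Ioo_ae_eq_Ico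

/-- The centre of the cell with index `k` of the square lattice of side `R`. -/
def cellCenter (R : ℝ) (k : ℤ × ℤ) : ℝ × ℝ := (R * k.1, R * k.2)

/-- The index of the half-open cell that contains `x`. -/
noncomputable def cellIndex (R : ℝ) (x : ℝ × ℝ) : ℤ × ℤ := (round (x.1 / R), round (x.2 / R))

/-- The indices of the cells that tile the square of side `(2 n + 1) R`. -/
noncomputable def cellRange (n : ℕ) : Finset (ℤ × ℤ) :=
  Finset.Icc (-(n : ℤ)) n ×ˢ Finset.Icc (-(n : ℤ)) n

theorem card_cellRange (n : ℕ) : ((cellRange n).card : ℝ) = (2 * n + 1) ^ 2 := by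
  rw [cellRange, Finset.card_product, Int.card_Icc]
  have : ((n : ℤ) + 1 - -(n : ℤ)).toNat = 2 * n + 1 := by omega
  rw [this]; push_cast; ring

/-- Halves are rounded up, so the cells are closed on the left and open on the right, and each point
belongs to exactly one of them. -/
theorem round_div_eq_iff {R : ℝ} (hR : 0 < R) (t : ℝ) (k : ℤ) :
    round (t / R) = k ↔ t - R * k ∈ Ico (-R / 2) (R / 2) := by
  rw [round_eq, Int.floor_eq_iff, mem_Ico]
  have e : t / R + 1 / 2 = (t + R / 2) / R := by field_simp
  rw [e, le_div_iff₀ hR, div_lt_iff₀ hR]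
  constructor <;> rintro ⟨h1, h2⟩ <;> constructor <;> nlinarith

theorem cellIndex_eq_iff {R : ℝ} (hR : 0 < R) (x : ℝ × ℝ) (k : ℤ × ℤ) :
    cellIndex R x = k ↔ x - cellCenter R k ∈ halfOpenQ R := by
  rw [cellIndex, Prod.ext_iff, round_div_eq_iff hR, round_div_eq_iff hR]
  rfl

theorem Q_subset_halfOpenQ (R : ℝ) : Q R ⊆ halfOpenQ R :=
  prod_mono Ioo_subset_Ico_self Ioo_subset_Ico_self

theorem cellIndex_add_center {R : ℝ} (hR : 0 < R) {x : ℝ × ℝ} (hx : x ∈ Q R) (k : ℤ × ℤ) :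
    cellIndex R (x + cellCenter R k) = k := by
  rw [cellIndex_eq_iff hR, add_sub_cancel_right]
  exact Q_subset_halfOpenQ R hx

/-- The odd factor 2n + 1 makes the large square a union of cells with the origin at the centre of
the middle one, so no shift of the magnetic potential is needed. -/
theorem cell_coord_mem_iff {R : ℝ} (hR : 0 < R) (n : ℕ) (t : ℝ) :
    t ∈ Ico (-((2 * n + 1) * R) / 2) (((2 * n + 1) * R) / 2) ↔
      round (t / R) ∈ Finset.Icc (-(n : ℤ)) n := by
  obtain ⟨h1, h2⟩ := (round_div_eq_iff hR t _).1 rfl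
  set k := round (t / R)
  rw [Finset.mem_Icc, mem_Ico]
  constructor
  · rintro ⟨h3, h4⟩
    constructor
    · by_contra h
      have h5 : k ≤ -(n : ℤ) - 1 := by omega
      have h6 : (k : ℝ) ≤ -(n : ℝ) - 1 := by exact_mod_cast h5
      nlinarith
    · by_contra h
      have h5 : (n : ℤ) + 1 ≤ k := by omega
      have h6 : (n : ℝ) + 1 ≤ k := by exact_mod_cast h5
      nlinarith
  · rintro ⟨h3, h4⟩
    have h5 : -(n : ℝ) ≤ k := by exact_mod_cast h3
    have h6 : (k : ℝ) ≤ n := by exact_mod_cast h4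
    constructor <;> nlinarith

theorem mem_halfOpenQ_iff_cellIndex_mem {R : ℝ} (hR : 0 < R) (n : ℕ) (x : ℝ × ℝ) :
    x ∈ halfOpenQ ((2 * n + 1) * R) ↔ cellIndex R x ∈ cellRange n := by
  rw [cellRange, Finset.mem_product, halfOpenQ, mem_prod]
  exact and_congr (cell_coord_mem_iff hR n x.1) (cell_coord_mem_iff hR n x.2)

theorem halfOpenQ_eq_biUnion {R : ℝ} (hR : 0 < R) (n : ℕ) :
    halfOpenQ ((2 * n + 1) * R) =
      ⋃ k ∈ cellRange n, (fun x => x - cellCenter R k) ⁻¹' halfOpenQ R := by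
  ext x
  rw [mem_halfOpenQ_iff_cellIndex_mem hR]
  simp only [mem_iUnion, mem_preimage, exists_prop]
  constructor
  · intro h
    exact ⟨_, h, (cellIndex_eq_iff hR x _).1 rfl⟩
  · rintro ⟨k, hk, hx⟩
    rwa [(cellIndex_eq_iff hR x k).2 hx]

theorem measurableSet_halfOpenQ (R : ℝ) : MeasurableSet (halfOpenQ R) :=
  measurableSet_Ico.prod measurableSet_Ico

theorem Q_subset_of_cell {R : ℝ} (hR : 0 < R) {n : ℕ} {k : ℤ × ℤ} (hk : k ∈ cellRange n) :
    Q R ⊆ (fun x => x + cellCenter R k) ⁻¹' Q ((2 * n + 1) * R) := by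
  intro x hx
  rw [cellRange, Finset.mem_product, Finset.mem_Icc, Finset.mem_Icc] at hk
  obtain ⟨⟨h1, h2⟩, h3, h4⟩ := hk
  have h1' : -(n : ℝ) ≤ k.1 := by exact_mod_cast h1
  have h2' : (k.1 : ℝ) ≤ n := by exact_mod_cast h2
  have h3' : -(n : ℝ) ≤ k.2 := by exact_mod_cast h3
  have h4' : (k.2 : ℝ) ≤ n := by exact_mod_cast h4
  rw [mem_Q] at hx
  rw [mem_preimage, mem_Q]
  simp only [cellCenter, Prod.fst_add, Prod.snd_add]
  refine ⟨⟨?_, ?_⟩, ?_, ?_⟩ <;> nlinarith [hx.1.1, hx.1.2, hx.2.1, hx.2.2]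

theorem setIntegral_translate_cell (R : ℝ) (f : ℝ × ℝ → ℝ) (a : ℝ × ℝ) :
    ∫ x in (fun x => x - a) ⁻¹' halfOpenQ R, f x = ∫ x in Q R, f (x + a) := by
  rw [setIntegral_congr_set (Q_ae_eq_halfOpenQ R)]
  have h := (measurePreserving_sub_right (volume : Measure (ℝ × ℝ)) a).setIntegral_preimage_emb
    (MeasurableEquiv.subRight a).measurableEmbedding (fun x => f (x + a)) (halfOpenQ R)
  simpa using h

theorem integrableOn_translate_cell_iff (R : ℝ) (f : ℝ × ℝ → ℝ) (a : ℝ × ℝ) :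
    IntegrableOn f ((fun x => x - a) ⁻¹' halfOpenQ R) ↔ IntegrableOn (fun x => f (x + a)) (Q R) := by
  rw [integrableOn_congr_set_ae (Q_ae_eq_halfOpenQ R)]
  have h := (measurePreserving_sub_right (volume : Measure (ℝ × ℝ)) a).integrableOn_comp_preimage
    (MeasurableEquiv.subRight a).measurableEmbedding (f := fun x => f (x + a)) (s := halfOpenQ R)
  simpa [Function.comp_def] using h

theorem integrableOn_Q_iff_cells {R : ℝ} (hR : 0 < R) (n : ℕ) (f : ℝ × ℝ → ℝ) :
    IntegrableOn f (Q ((2 * n + 1) * R)) ↔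
      ∀ k ∈ cellRange n, IntegrableOn (fun x => f (x + cellCenter R k)) (Q R) := by
  rw [integrableOn_congr_set_ae (Q_ae_eq_halfOpenQ _), halfOpenQ_eq_biUnion hR,
    integrableOn_finset_iUnion]
  simp_rw [integrableOn_translate_cell_iff]

theorem setIntegral_Q_eq_sum_cells {R : ℝ} (hR : 0 < R) (n : ℕ) {f : ℝ × ℝ → ℝ}
    (hf : IntegrableOn f (Q ((2 * n + 1) * R))) :
    ∫ x in Q ((2 * n + 1) * R), f x =
      ∑ k ∈ cellRange n, ∫ x in Q R, f (x + cellCenter R k) := by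
  rw [setIntegral_congr_set (Q_ae_eq_halfOpenQ _), halfOpenQ_eq_biUnion hR,
    integral_biUnion_finset]
  · simp_rw [setIntegral_translate_cell]
  · intro k _
    exact (measurable_id.sub_const _) (measurableSet_halfOpenQ R)
  · intro k _ l _ hkl
    refine disjoint_left.2 fun x hk hl => hkl ?_
    rw [← (cellIndex_eq_iff hR x k).2 hk, (cellIndex_eq_iff hR x l).2 hl]
  · intro k hk
    rw [integrableOn_translate_cell_iff]
    exact (integrableOn_Q_iff_cells hR n f).1 hf k hk

/-! ### Magnetic translations -/

/-- The phase of the magnetic translation by `a`, with an additional constant phase `c`. -/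
noncomputable def magPhase (a : ℝ × ℝ) (c : ℝ) (x : ℝ × ℝ) : ℂ :=
  Complex.exp (Complex.I * (((a.1 * x.2 - a.2 * x.1) / 2 + c : ℝ) : ℂ))

theorem norm_magPhase (a : ℝ × ℝ) (c : ℝ) (x : ℝ × ℝ) : ‖magPhase a c x‖ = 1 := by
  rw [magPhase, mul_comm]; exact Complex.norm_exp_ofReal_mul_I _

theorem contDiff_magPhase (a : ℝ × ℝ) (c : ℝ) : ContDiff ℝ ∞ (magPhase a c) := by
  unfold magPhase
  have h : ContDiff ℝ ∞ fun x : ℝ × ℝ => (((a.1 * x.2 - a.2 * x.1) / 2 + c : ℝ) : ℂ) :=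
    have h' : ContDiff ℝ ∞ fun x : ℝ × ℝ => (a.1 * x.2 - a.2 * x.1) / 2 + c := by fun_prop
    Complex.ofRealCLM.contDiff.comp h'
  exact (contDiff_const.mul h).cexp

theorem fderiv_magPhase (a : ℝ × ℝ) (c : ℝ) (x v : ℝ × ℝ) :
    fderiv ℝ (magPhase a c) x v =
      Complex.I * (((a.1 * v.2 - a.2 * v.1) / 2 : ℝ) : ℂ) * magPhase a c x := by
  have h1 : HasFDerivAt (fun x : ℝ × ℝ => (a.1 * x.2 - a.2 * x.1) / 2 + c)
      ((1 / 2 : ℝ) • (a.1 • ContinuousLinearMap.snd ℝ ℝ ℝ - a.2 • ContinuousLinearMap.fst ℝ ℝ ℝ))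
      x := by
    have := (((hasFDerivAt_snd (𝕜 := ℝ) (p := x)).const_smul a.1).sub
      ((hasFDerivAt_fst (𝕜 := ℝ) (p := x)).const_smul a.2)).const_smul (1 / 2 : ℝ) |>.add_const c
    refine this.congr_of_eventuallyEq (Eventually.of_forall fun y => ?_)
    simp; ring
  have h2 := ((Complex.ofRealCLM.hasFDerivAt.comp x h1).const_mul Complex.I).cexp
  have h3 : HasFDerivAt (magPhase a c) _ x := h2
  rw [h3.fderiv]
  simp [magPhase]
  ring

/-- The magnetic translation of a function. -/
noncomputable def magT (a : ℝ × ℝ) (c : ℝ) (u : ℝ × ℝ → ℂ) (x : ℝ × ℝ) : ℂ :=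
  magPhase a c x * u (x - a)

/-- The derivative of a magnetic translate in the direction `v`. -/
noncomputable def magTDeriv (v a : ℝ × ℝ) (c : ℝ) (u g : ℝ × ℝ → ℂ) (x : ℝ × ℝ) : ℂ :=
  magPhase a c x * g (x - a) + fderiv ℝ (magPhase a c) x v * u (x - a)

theorem norm_fderiv_magPhase_le (a : ℝ × ℝ) (c : ℝ) (x v : ℝ × ℝ) :
    ‖fderiv ℝ (magPhase a c) x v‖ ≤ 1 + |(a.1 * v.2 - a.2 * v.1) / 2| := by
  rw [fderiv_magPhase, norm_mul, norm_mul, norm_magPhase, Complex.norm_I, Complex.norm_real,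
    Real.norm_eq_abs]
  linarith

section

variable {Ω : Set (ℝ × ℝ)} {u g₁ g₂ : ℝ × ℝ → ℂ}

theorem MemH1.magT (h : MemH1 Ω u g₁ g₂) (hΩ : IsOpen Ω) (a : ℝ × ℝ) (c : ℝ) :
    MemH1 ((fun x => x - a) ⁻¹' Ω) (magT a c u) (magTDeriv (1, 0) a c u g₁)
      (magTDeriv (0, 1) a c u g₂) :=
  (h.translate hΩ.measurableSet a).mul_smooth (hΩ.preimage (by fun_prop)) (contDiff_magPhase a c)
    (M := 1 + |a.1| + |a.2|)
    (fun x => by rw [norm_magPhase]; linarith [abs_nonneg a.1, abs_nonneg a.2])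
    (fun x => (norm_fderiv_magPhase_le a c x _).trans (by
      simp only [mul_zero, mul_one, zero_sub, abs_div, abs_neg, abs_two]
      linarith [abs_nonneg a.1, abs_nonneg a.2]))
    (fun x => (norm_fderiv_magPhase_le a c x _).trans (by
      simp only [mul_zero, mul_one, sub_zero, abs_div, abs_two]
      linarith [abs_nonneg a.1, abs_nonneg a.2]))

theorem MemH10.magT (h : MemH10 Ω u g₁ g₂) (hΩ : IsOpen Ω) (a : ℝ × ℝ) (c : ℝ) :
    MemH10 ((fun x => x - a) ⁻¹' Ω) (magT a c u) (magTDeriv (1, 0) a c u g₁)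
      (magTDeriv (0, 1) a c u g₂) :=
  (h.translate hΩ.measurableSet a).mul_smooth (hΩ.preimage (by fun_prop)) (contDiff_magPhase a c)
    (M := 1 + |a.1| + |a.2|)
    (fun x => by rw [norm_magPhase]; linarith [abs_nonneg a.1, abs_nonneg a.2])
    (fun x => (norm_fderiv_magPhase_le a c x _).trans (by
      simp only [mul_zero, mul_one, zero_sub, abs_div, abs_neg, abs_two]
      linarith [abs_nonneg a.1, abs_nonneg a.2]))
    (fun x => (norm_fderiv_magPhase_le a c x _).trans (by
      simp only [mul_zero, mul_one, sub_zero, abs_div, abs_two]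
      linarith [abs_nonneg a.1, abs_nonneg a.2]))

end

theorem norm_magT (a : ℝ × ℝ) (c : ℝ) (u : ℝ × ℝ → ℂ) (x : ℝ × ℝ) :
    ‖magT a c u x‖ = ‖u (x - a)‖ := by
  rw [magT, norm_mul, norm_magPhase, one_mul]

/-- Magnetic translations commute with the covariant derivative. -/
theorem kinetic_magT (a : ℝ × ℝ) (c : ℝ) (u g₁ g₂ : ℝ × ℝ → ℂ) (x : ℝ × ℝ) :
    kinetic (magT a c u) (magTDeriv (1, 0) a c u g₁) (magTDeriv (0, 1) a c u g₂) x =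
      kinetic u g₁ g₂ (x - a) := by
  -- The phase has gradient A₀(a), which equals A₀(x) − A₀(x − a) because A₀ is linear.
  have h1 : covDeriv₁ (magT a c u) (magTDeriv (1, 0) a c u g₁) x =
      magPhase a c x * covDeriv₁ u g₁ (x - a) := by
    simp only [covDeriv₁, magT, magTDeriv, fderiv_magPhase, A₁, Prod.snd_sub]
    push_cast; ring
  have h2 : covDeriv₂ (magT a c u) (magTDeriv (0, 1) a c u g₂) x =
      magPhase a c x * covDeriv₂ u g₂ (x - a) := by
    simp only [covDeriv₂, magT, magTDeriv, fderiv_magPhase, A₂, Prod.fst_sub]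
    push_cast; ring
  rw [kinetic, h1, h2, norm_mul, norm_mul, norm_magPhase, one_mul, one_mul, kinetic]

/-- The energy density of `energyBlk`. -/
noncomputable def density (b : ℝ) (u g₁ g₂ : ℝ × ℝ → ℂ) (x : ℝ × ℝ) : ℝ :=
  b * kinetic u g₁ g₂ x - ‖u x‖ ^ 2 + 1 / 2 * ‖u x‖ ^ 4

theorem density_magT (b : ℝ) (a : ℝ × ℝ) (c : ℝ) (u g₁ g₂ : ℝ × ℝ → ℂ) (x : ℝ × ℝ) :
    density b (magT a c u) (magTDeriv (1, 0) a c u g₁) (magTDeriv (0, 1) a c u g₂) x =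
      density b u g₁ g₂ (x - a) := by
  rw [density, kinetic_magT, norm_magT, density]

theorem density_congr {b : ℝ} {u g₁ g₂ u' g₁' g₂' : ℝ × ℝ → ℂ} {x : ℝ × ℝ} (h : u x = u' x)
    (h₁ : g₁ x = g₁' x) (h₂ : g₂ x = g₂' x) : density b u g₁ g₂ x = density b u' g₁' g₂' x := by
  simp only [density, kinetic, covDeriv₁, covDeriv₂, h, h₁, h₂]

/-! ### Elementary properties of the ground state energy -/

theorem energyBlk_eq (b R : ℝ) (u g₁ g₂ : ℝ × ℝ → ℂ) :
    energyBlk b R u g₁ g₂ = ∫ x in Q R, density b u g₁ g₂ x := rfl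

theorem kinetic_nonneg (u g₁ g₂ : ℝ × ℝ → ℂ) (x : ℝ × ℝ) : 0 ≤ kinetic u g₁ g₂ x := by
  unfold kinetic; positivity

/-- Completing the square: −t² + t⁴/2 = (t² − 1)²/2 − 1/2. -/
theorem neg_half_le_density {b : ℝ} (hb : 0 ≤ b) (u g₁ g₂ : ℝ × ℝ → ℂ) (x : ℝ × ℝ) :
    -(1 / 2) ≤ density b u g₁ g₂ x := by
  have := mul_nonneg hb (kinetic_nonneg u g₁ g₂ x)
  unfold density
  nlinarith [sq_nonneg (‖u x‖ ^ 2 - 1)]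

theorem neg_half_le_energyBlk {b R : ℝ} (hb : 0 ≤ b) (hR : 0 ≤ R) (u g₁ g₂ : ℝ × ℝ → ℂ) :
    -(1 / 2) * R ^ 2 ≤ energyBlk b R u g₁ g₂ := by
  rw [energyBlk_eq]
  by_cases hi : IntegrableOn (density b u g₁ g₂) (Q R)
  · have : ∫ _ in Q R, (-(1 / 2) : ℝ) = -(1 / 2) * R ^ 2 := by
      rw [setIntegral_const, volume_real_Q hR, smul_eq_mul, mul_comm]
    rw [← this]
    exact setIntegral_mono (integrableOn_const (volume_Q_lt_top R).ne) hi
      (fun x => neg_half_le_density hb u g₁ g₂ x)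
  -- The integral of a non-integrable density is 0 by convention, which respects the lower bound.
  · rw [integral_undef hi]
    nlinarith [sq_nonneg R]

theorem isConfig_zero (c : BC) (R : ℝ) : IsConfig c R (fun _ => 0) (fun _ => 0) (fun _ => 0) := by
  cases c
  · exact MemH10.zero
  · exact MemH10.zero.memH1
  · have h1 : covDeriv₁ (fun _ => 0) (fun _ => 0) = fun _ => 0 := by
      ext x; simp [covDeriv₁]
    have h2 : covDeriv₂ (fun _ => 0) (fun _ => 0) = fun _ => 0 := by
      ext x; simp [covDeriv₂]
    have h0 : MemL2loc fun _ => 0 := fun K _ => MemLp.zero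
    exact ⟨h0, ⟨.zero, .zero⟩, by rwa [h1], by rwa [h2], by simp, by simp⟩

theorem bddBelow_energies (c : BC) {b R : ℝ} (hb : 0 ≤ b) (hR : 0 ≤ R) :
    BddBelow {E | ∃ u g₁ g₂ : ℝ × ℝ → ℂ, IsConfig c R u g₁ g₂ ∧ E = energyBlk b R u g₁ g₂} :=
  ⟨-(1 / 2) * R ^ 2, by
    rintro _ ⟨u, g₁, g₂, _, rfl⟩
    exact neg_half_le_energyBlk hb hR u g₁ g₂⟩

theorem e_le {c : BC} {b R : ℝ} (hb : 0 ≤ b) (hR : 0 ≤ R) {u g₁ g₂ : ℝ × ℝ → ℂ}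
    (h : IsConfig c R u g₁ g₂) : e c b R ≤ energyBlk b R u g₁ g₂ :=
  csInf_le (bddBelow_energies c hb hR) ⟨u, g₁, g₂, h, rfl⟩

theorem le_e {c : BC} {b R B : ℝ}
    (h : ∀ u g₁ g₂ : ℝ × ℝ → ℂ, IsConfig c R u g₁ g₂ → B ≤ energyBlk b R u g₁ g₂) :
    B ≤ e c b R := by
  refine le_csInf ⟨_, _, _, _, isConfig_zero c R, rfl⟩ ?_
  rintro _ ⟨u, g₁, g₂, hc, rfl⟩
  exact h u g₁ g₂ hc

/-- The zero function competes. The bound also settles later cases in which a non-integrable density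
gets the integral 0. -/
theorem e_nonpos (c : BC) {b R : ℝ} (hb : 0 ≤ b) (hR : 0 ≤ R) : e c b R ≤ 0 := by
  refine (e_le hb hR (isConfig_zero c R)).trans (le_of_eq ?_)
  simp [energyBlk, kinetic, covDeriv₁, covDeriv₂]

theorem neg_half_le_e (c : BC) {b R : ℝ} (hb : 0 ≤ b) (hR : 0 ≤ R) : -(1 / 2) * R ^ 2 ≤ e c b R :=
  le_e fun u g₁ g₂ _ => neg_half_le_energyBlk hb hR u g₁ g₂

theorem exists_Q_superset {K : Set (ℝ × ℝ)} (hK : IsCompact K) {R : ℝ} (hR : 0 < R) :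
    ∃ n : ℕ, K ⊆ Q ((2 * n + 1) * R) := by
  obtain ⟨M, hM⟩ := hK.isBounded.exists_norm_le
  obtain ⟨n, hn⟩ := exists_nat_gt (M / R)
  rw [div_lt_iff₀ hR] at hn
  refine ⟨n, fun x hx => ?_⟩
  have h1 := (norm_fst_le x).trans (hM x hx)
  have h2 := (norm_snd_le x).trans (hM x hx)
  rw [Real.norm_eq_abs, abs_le] at h1 h2
  rw [mem_Q]
  refine ⟨⟨?_, ?_⟩, ?_, ?_⟩ <;> nlinarith [h1.1, h1.2, h2.1, h2.2]

theorem ae_norm_potential_le (R : ℝ) (A : ℝ × ℝ → ℝ) (hA : ∀ x ∈ Q R, |A x| ≤ |R|) :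
    ∀ᵐ x ∂volume.restrict (Q R), ‖Complex.I * (A x : ℂ)‖ ≤ |R| :=
  ae_restrict_of_forall_mem (measurableSet_Q R) fun x hx => by
    rw [norm_mul, Complex.norm_I, one_mul, Complex.norm_real, Real.norm_eq_abs]
    exact hA x hx

theorem abs_A₁_le {R : ℝ} {x : ℝ × ℝ} (hx : x ∈ Q R) : |A₁ x| ≤ |R| := by
  rw [mem_Q] at hx
  rw [A₁, abs_le]
  constructor <;> linarith [hx.2.1, hx.2.2, le_abs_self R]

theorem abs_A₂_le {R : ℝ} {x : ℝ × ℝ} (hx : x ∈ Q R) : |A₂ x| ≤ |R| := by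
  rw [mem_Q] at hx
  rw [A₂, abs_le]
  constructor <;> linarith [hx.1.1, hx.1.2, le_abs_self R]

theorem continuous_I_mul_A₁ : Continuous fun x => Complex.I * (A₁ x : ℂ) := by
  unfold A₁; fun_prop

theorem continuous_I_mul_A₂ : Continuous fun x => Complex.I * (A₂ x : ℂ) := by
  unfold A₂; fun_prop

section

variable {R : ℝ} {u g₁ g₂ : ℝ × ℝ → ℂ}

theorem MemH1.memLp_covDeriv₁ (h : MemH1 (Q R) u g₁ g₂) :
    MemLp (covDeriv₁ u g₁) 2 (volume.restrict (Q R)) :=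
  h.2.sub (MemLp.mul_of_bound h.1 continuous_I_mul_A₁ (ae_norm_potential_le R _ fun _ => abs_A₁_le))

theorem MemH1.memLp_covDeriv₂ (h : MemH1 (Q R) u g₁ g₂) :
    MemLp (covDeriv₂ u g₂) 2 (volume.restrict (Q R)) :=
  h.3.sub (MemLp.mul_of_bound h.1 continuous_I_mul_A₂ (ae_norm_potential_le R _ fun _ => abs_A₂_le))

theorem MemH1.integrableOn_kinetic (h : MemH1 (Q R) u g₁ g₂) :
    IntegrableOn (kinetic u g₁ g₂) (Q R) :=
  (h.memLp_covDeriv₁.integrable_norm_pow two_ne_zero).add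
    (h.memLp_covDeriv₂.integrable_norm_pow two_ne_zero)

theorem MemH1.integrableOn_norm_sq (h : MemH1 (Q R) u g₁ g₂) :
    IntegrableOn (fun x => ‖u x‖ ^ 2) (Q R) :=
  h.1.integrable_norm_pow two_ne_zero

theorem MemH1.integrableOn_lin (h : MemH1 (Q R) u g₁ g₂) (b : ℝ) :
    IntegrableOn (fun x => b * kinetic u g₁ g₂ x - ‖u x‖ ^ 2) (Q R) :=
  (h.integrableOn_kinetic.const_mul b).sub h.integrableOn_norm_sq

/-- The kinetic and quadratic terms are always integrable, so only the quartic term matters.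
Splitting into cases on its integrability replaces the embedding of H¹ into L⁴. -/
theorem MemH1.integrableOn_density_iff (h : MemH1 (Q R) u g₁ g₂) (b : ℝ) :
    IntegrableOn (density b u g₁ g₂) (Q R) ↔ IntegrableOn (fun x => ‖u x‖ ^ 4) (Q R) := by
  constructor
  · intro hi
    have := (hi.sub (h.integrableOn_lin b)).const_mul 2
    refine this.congr (ae_of_all _ fun x => ?_)
    simp only [density, Pi.sub_apply]; ring
  · intro hi
    exact (h.integrableOn_lin b).add (hi.const_mul (1 / 2))

/-- A₀ is bounded on the square, so the ordinary and the covariant gradient are square integrable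
there together. -/
theorem MemH1per.memH1 (h : MemH1per R u g₁ g₂) : MemH1 (Q R) u g₁ g₂ := by
  have hL : ∀ {w : ℝ × ℝ → ℂ}, MemL2loc w → MemLp w 2 (volume.restrict (Q R)) := fun hw =>
    (hw (Icc (-R / 2) (R / 2) ×ˢ Icc (-R / 2) (R / 2)) (isCompact_Icc.prod isCompact_Icc)).mono_measure
      (Measure.restrict_mono_set _ (prod_mono Ioo_subset_Icc_self Ioo_subset_Icc_self))
  have hu := hL h.1
  refine ⟨hu, ?_, ?_, h.2.1.mono (subset_univ _), h.2.2.mono (subset_univ _)⟩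
  · refine ((hL h.3).add (MemLp.mul_of_bound hu continuous_I_mul_A₁
      (ae_norm_potential_le R _ fun _ => abs_A₁_le))).ae_eq (ae_of_all _ fun x => ?_)
    simp [covDeriv₁]
  · refine ((hL h.4).add (MemLp.mul_of_bound hu continuous_I_mul_A₂
      (ae_norm_potential_le R _ fun _ => abs_A₂_le))).ae_eq (ae_of_all _ fun x => ?_)
    simp [covDeriv₂]

theorem IsConfig.memH1 {c : BC} (h : IsConfig c R u g₁ g₂) : MemH1 (Q R) u g₁ g₂ := by
  cases c
  · exact MemH10.memH1 h
  · exact h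
  · exact MemH1per.memH1 h

end

theorem e_N_le (c : BC) {b R : ℝ} (hb : 0 ≤ b) (hR : 0 ≤ R) : e BC.N b R ≤ e c b R :=
  le_e fun _ _ _ h => e_le (c := BC.N) hb hR h.memH1

/-- Extension by zero. -/
theorem e_D_antitone {b R R' : ℝ} (hb : 0 ≤ b) (hR : 0 ≤ R) (h : R ≤ R') :
    e BC.D b R' ≤ e BC.D b R := by
  refine le_e fun u g₁ g₂ hu => ?_
  have hu : MemH10 (Q R) u g₁ g₂ := hu
  refine (e_le (c := BC.D) hb (hR.trans h)
    (hu.extend (measurableSet_Q R) (Q_mono h))).trans (le_of_eq ?_)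
  rw [energyBlk_eq, energyBlk_eq]
  have e1 : density b ((Q R).indicator u) ((Q R).indicator g₁) ((Q R).indicator g₂) =
      (Q R).indicator (density b u g₁ g₂) := by
    ext x
    by_cases hx : x ∈ Q R
    · rw [indicator_of_mem hx]
      exact density_congr (indicator_of_mem hx _) (indicator_of_mem hx _) (indicator_of_mem hx _)
    · simp [hx, density, kinetic, covDeriv₁, covDeriv₂]
  rw [e1, setIntegral_indicator (measurableSet_Q R), inter_eq_self_of_subset_right (Q_mono h)]

/-! ### Magnetic periodic extension -/

/-- The constant part of the phase of the magnetic translation to the cell with index `k`. -/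
noncomputable def cellPhase (R : ℝ) (k : ℤ × ℤ) : ℝ := R ^ 2 * k.1 * k.2 / 2

/-- The magnetic periodic extension of the restriction of `u` to `Q R`. -/
noncomputable def perExt (R : ℝ) (u : ℝ × ℝ → ℂ) (x : ℝ × ℝ) : ℂ :=
  magT (cellCenter R (cellIndex R x)) (cellPhase R (cellIndex R x)) ((Q R).indicator u) x

/-- The derivative in the direction `v` of the magnetic periodic extension. -/
noncomputable def perExtDeriv (v : ℝ × ℝ) (R : ℝ) (u g : ℝ × ℝ → ℂ) (x : ℝ × ℝ) : ℂ :=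
  magTDeriv v (cellCenter R (cellIndex R x)) (cellPhase R (cellIndex R x)) ((Q R).indicator u)
    ((Q R).indicator g) x

section

variable {R : ℝ} {u g₁ g₂ : ℝ × ℝ → ℂ}

theorem density_perExt (b : ℝ) (hR : 0 < R) (u g₁ g₂ : ℝ × ℝ → ℂ) {x : ℝ × ℝ} (hx : x ∈ Q R)
    (k : ℤ × ℤ) :
    density b (perExt R u) (perExtDeriv (1, 0) R u g₁) (perExtDeriv (0, 1) R u g₂)
      (x + cellCenter R k) = density b u g₁ g₂ x := by
  have hk := cellIndex_add_center hR hx k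
  have h1 : density b (perExt R u) (perExtDeriv (1, 0) R u g₁) (perExtDeriv (0, 1) R u g₂)
      (x + cellCenter R k) =
      density b (magT (cellCenter R k) (cellPhase R k) ((Q R).indicator u))
        (magTDeriv (1, 0) (cellCenter R k) (cellPhase R k) ((Q R).indicator u)
          ((Q R).indicator g₁))
        (magTDeriv (0, 1) (cellCenter R k) (cellPhase R k) ((Q R).indicator u)
          ((Q R).indicator g₂)) (x + cellCenter R k) := by
    apply density_congr
    · rw [perExt, hk]
    · rw [perExtDeriv, hk]
    · rw [perExtDeriv, hk]
  rw [h1, density_magT, add_sub_cancel_right]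
  exact density_congr (indicator_of_mem hx _) (indicator_of_mem hx _) (indicator_of_mem hx _)

theorem cellIndex_eq_of_sub_mem (hR : 0 < R) {x : ℝ × ℝ} {k : ℤ × ℤ}
    (h : x - cellCenter R k ∈ Q R) : cellIndex R x = k :=
  (cellIndex_eq_iff hR x k).2 (Q_subset_halfOpenQ R h)

/-- On a large square the magnetic periodic extension is a finite sum of translates. -/
theorem memH10_perExt (hR : 0 < R) (h : MemH10 (Q R) u g₁ g₂) (n : ℕ) :
    MemH10 (Q ((2 * n + 1) * R)) (perExt R u) (perExtDeriv (1, 0) R u g₁)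
      (perExtDeriv (0, 1) R u g₂) := by
  have hterm : ∀ k ∈ cellRange n, MemH10 (Q ((2 * n + 1) * R))
      (((fun x => x - cellCenter R k) ⁻¹' Q R).indicator (magT (cellCenter R k) (cellPhase R k) u))
      (((fun x => x - cellCenter R k) ⁻¹' Q R).indicator
        (magTDeriv (1, 0) (cellCenter R k) (cellPhase R k) u g₁))
      (((fun x => x - cellCenter R k) ⁻¹' Q R).indicator
        (magTDeriv (0, 1) (cellCenter R k) (cellPhase R k) u g₂)) := by
    intro k hk
    refine (h.magT (isOpen_Q R) _ _).extend ((measurable_id.sub_const _) (measurableSet_Q R)) ?_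
    intro x hx
    simpa using Q_subset_of_cell hR hk hx
  -- The translated open cells are disjoint, so only the summand of the cell containing x can
  -- survive.
  have hsum : ∀ {x : ℝ × ℝ}, x ∈ Q ((2 * n + 1) * R) → ∀ F : ℤ × ℤ → ℝ × ℝ → ℂ,
      ∑ k ∈ cellRange n, ((fun x => x - cellCenter R k) ⁻¹' Q R).indicator (F k) x =
        ((fun y => y - cellCenter R (cellIndex R x)) ⁻¹' Q R).indicator
          (F (cellIndex R x)) x := by
    intro x hx F
    refine Finset.sum_eq_single _ ?_ ?_
    · intro k _ hne
      refine indicator_of_notMem (fun hm => hne ?_) _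
      exact (cellIndex_eq_of_sub_mem hR hm).symm
    · intro hn
      exact absurd ((mem_halfOpenQ_iff_cellIndex_mem hR n x).1 (Q_subset_halfOpenQ _ hx)) hn
  refine (MemH10.sum (cellRange n) hterm).congr (measurableSet_Q _) ?_ ?_ ?_
  · intro x hx
    simp only [hsum hx]
    by_cases hm : x - cellCenter R (cellIndex R x) ∈ Q R
    · rw [indicator_of_mem (by exact hm), perExt, magT, magT, indicator_of_mem hm]
    · rw [indicator_of_notMem (by exact hm), perExt, magT, indicator_of_notMem hm, mul_zero]
  · intro x hx
    simp only [hsum hx]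
    by_cases hm : x - cellCenter R (cellIndex R x) ∈ Q R
    · rw [indicator_of_mem (by exact hm), perExtDeriv, magTDeriv, magTDeriv, indicator_of_mem hm,
        indicator_of_mem hm]
    · rw [indicator_of_notMem (by exact hm), perExtDeriv, magTDeriv, indicator_of_notMem hm,
        indicator_of_notMem hm, mul_zero, mul_zero, add_zero]
  · intro x hx
    simp only [hsum hx]
    by_cases hm : x - cellCenter R (cellIndex R x) ∈ Q R
    · rw [indicator_of_mem (by exact hm), perExtDeriv, magTDeriv, magTDeriv, indicator_of_mem hm,
        indicator_of_mem hm]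
    · rw [indicator_of_notMem (by exact hm), perExtDeriv, magTDeriv, indicator_of_notMem hm,
        indicator_of_notMem hm, mul_zero, mul_zero, add_zero]

/-- The constant R²k₁k₂/2 in the phase cancels the term −R²k₂/2 produced by the shift, so this
condition holds for every R > 0. The whole non-commutativity of the two translations is thereby
moved to the second condition. -/
theorem perExt_add_fst (hR : 0 < R) (u : ℝ × ℝ → ℂ) (x : ℝ × ℝ) :
    perExt R u (x.1 + R, x.2) =
      Complex.exp (Complex.I * (R : ℂ) * (x.2 : ℂ) / 2) * perExt R u x := by
  have hidx : cellIndex R (x.1 + R, x.2) = ((cellIndex R x).1 + 1, (cellIndex R x).2) := by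
    simp only [cellIndex]
    rw [add_div, div_self hR.ne', round_add_one]
  rw [perExt, perExt, hidx]
  set k := cellIndex R x
  have hsub : ((x.1 + R, x.2) : ℝ × ℝ) - cellCenter R (k.1 + 1, k.2) = x - cellCenter R k := by
    ext
    · simp [cellCenter]; ring
    · simp [cellCenter]
  rw [magT, magT, hsub, ← mul_assoc]
  congr 1
  rw [magPhase, magPhase, ← Complex.exp_add]
  congr 1
  simp only [cellCenter, cellPhase]
  push_cast
  ring

theorem perExt_add_snd (hR : 0 < R) {N : ℕ} (hN : R ^ 2 = 2 * Real.pi * N) (u : ℝ × ℝ → ℂ)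
    (x : ℝ × ℝ) :
    perExt R u (x.1, x.2 + R) =
      Complex.exp (-(Complex.I * (R : ℂ) * (x.1 : ℂ) / 2)) * perExt R u x := by
  have hidx : cellIndex R (x.1, x.2 + R) = ((cellIndex R x).1, (cellIndex R x).2 + 1) := by
    simp only [cellIndex]
    rw [add_div, div_self hR.ne', round_add_one]
  rw [perExt, perExt, hidx]
  set k := cellIndex R x
  have hsub : ((x.1, x.2 + R) : ℝ × ℝ) - cellCenter R (k.1, k.2 + 1) = x - cellCenter R k := by
    ext
    · simp [cellCenter]
    · simp [cellCenter]; ring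
  rw [magT, magT, hsub, ← mul_assoc]
  congr 1
  rw [magPhase, magPhase, ← Complex.exp_add, Complex.exp_eq_exp_iff_exists_int]
  -- In this direction the contributions add up instead of cancelling: the exponents differ by
  -- iR²k₁, which is 2πi N k₁ by flux quantization.
  refine ⟨N * k.1, ?_⟩
  have hN' : (R : ℂ) ^ 2 = 2 * (Real.pi : ℂ) * N := by exact_mod_cast hN
  simp only [cellCenter, cellPhase]
  push_cast
  linear_combination (Complex.I * (k.1 : ℂ)) * hN'

theorem memH1per_perExt (hR : 0 < R) (hadm : R ∈ admissible BC.p) (h : MemH10 (Q R) u g₁ g₂) :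
    MemH1per R (perExt R u) (perExtDeriv (1, 0) R u g₁) (perExtDeriv (0, 1) R u g₂) := by
  obtain ⟨N, hN⟩ := hadm
  have hH := fun n => (memH10_perExt hR h n).memH1
  have hmono : Monotone fun n : ℕ => Q ((2 * (n : ℝ) + 1) * R) := fun n m hnm =>
    Q_mono (by gcongr)
  have hcov : ⋃ n : ℕ, Q ((2 * (n : ℝ) + 1) * R) = univ := by
    refine eq_univ_of_forall fun x => ?_
    obtain ⟨n, hn⟩ := exists_Q_superset (isCompact_singleton (x := x)) hR
    exact mem_iUnion.2 ⟨n, hn rfl⟩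
  have hL : ∀ {w : ℝ × ℝ → ℂ}, (∀ n : ℕ, MemLp w 2 (volume.restrict (Q ((2 * (n : ℝ) + 1) * R)))) →
      MemL2loc w := by
    intro w hw K hK
    obtain ⟨n, hn⟩ := exists_Q_superset hK hR
    exact (hw n).mono_measure (Measure.restrict_mono_set _ hn)
  exact
    { memL2loc := hL fun n => (hH n).1
      weakGrad := ⟨.of_forall_isOpen_subset (fun n => isOpen_Q _) hmono hcov fun n => (hH n).4.1,
        .of_forall_isOpen_subset (fun n => isOpen_Q _) hmono hcov fun n => (hH n).4.2⟩
      memL2loc₁ := hL fun n => (hH n).memLp_covDeriv₁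
      memL2loc₂ := hL fun n => (hH n).memLp_covDeriv₂
      periodic₁ := ae_of_all _ fun x => perExt_add_fst hR u x
      periodic₂ := ae_of_all _ fun x => perExt_add_snd hR hN u x }

end

/-! ### Dirichlet upper bounds and the tiling inequalities -/

theorem e_p_le_e_D {b R : ℝ} (hb : 0 ≤ b) (hR : 0 < R) (hadm : R ∈ admissible BC.p) :
    e BC.p b R ≤ e BC.D b R := by
  refine le_e fun u g₁ g₂ hu => ?_
  refine (e_le (c := BC.p) hb hR.le (memH1per_perExt hR hadm hu)).trans (le_of_eq ?_)
  rw [energyBlk_eq, energyBlk_eq]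
  refine setIntegral_congr_fun (measurableSet_Q R) fun x hx => ?_
  have h0 : cellCenter R 0 = 0 := by ext <;> simp [cellCenter]
  have h := density_perExt b hR u g₁ g₂ hx 0
  rwa [h0, add_zero] at h

theorem e_le_e_D (c : BC) {b R : ℝ} (hb : 0 ≤ b) (hR : 0 < R) (hadm : R ∈ admissible c) :
    e c b R ≤ e BC.D b R := by
  cases c
  · exact le_rfl
  · exact e_N_le BC.D hb hR.le
  · exact e_p_le_e_D hb hR hadm

/-- Magnetic translates of a Dirichlet configuration to the (2n + 1)² cells are glued together. They
have disjoint supports up to null sets and equal energies. -/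
theorem e_D_tile {b R : ℝ} (hb : 0 ≤ b) (hR : 0 < R) (n : ℕ) :
    e BC.D b ((2 * n + 1) * R) ≤ (2 * n + 1) ^ 2 * e BC.D b R := by
  rw [← div_le_iff₀' (by positivity)]
  refine le_e fun u g₁ g₂ hu => ?_
  rw [div_le_iff₀' (by positivity)]
  by_cases hi : IntegrableOn (density b u g₁ g₂) (Q R)
  · refine (e_le (c := BC.D) hb (by positivity) (memH10_perExt hR hu n)).trans (le_of_eq ?_)
    have hcell : ∀ k : ℤ × ℤ, EqOn (fun x => density b (perExt R u) (perExtDeriv (1, 0) R u g₁)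
        (perExtDeriv (0, 1) R u g₂) (x + cellCenter R k)) (density b u g₁ g₂) (Q R) :=
      fun k x hx => density_perExt b hR u g₁ g₂ hx k
    rw [energyBlk_eq, energyBlk_eq, setIntegral_Q_eq_sum_cells hR n]
    · rw [Finset.sum_congr rfl fun k _ => setIntegral_congr_fun (measurableSet_Q R) (hcell k),
        Finset.sum_const, nsmul_eq_mul, card_cellRange]
    · rw [integrableOn_Q_iff_cells hR]
      exact fun k _ => hi.congr_fun (hcell k).symm (measurableSet_Q R)
  · -- a density bounded below that is not integrable has no negative energy: trivial by `e ≤ 0`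
    rw [energyBlk_eq, integral_undef hi, mul_zero]
    exact e_nonpos _ hb (by positivity)

/-- Dually, a Neumann configuration may be cut: its restriction to each cell, magnetically
translated back to the origin, competes on the small square. -/
theorem e_N_tile {b R : ℝ} (hb : 0 ≤ b) (hR : 0 < R) (n : ℕ) :
    (2 * n + 1) ^ 2 * e BC.N b R ≤ e BC.N b ((2 * n + 1) * R) := by
  refine le_e fun u g₁ g₂ hu => ?_
  have hu : MemH1 (Q ((2 * n + 1) * R)) u g₁ g₂ := hu
  rw [energyBlk_eq]
  by_cases hi : IntegrableOn (density b u g₁ g₂) (Q ((2 * n + 1) * R))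
  · rw [setIntegral_Q_eq_sum_cells hR n hi, ← card_cellRange, ← nsmul_eq_mul]
    refine Finset.card_nsmul_le_sum _ _ _ fun k hk => ?_
    have hsub : Q R ⊆ (fun x => x - -cellCenter R k) ⁻¹' Q ((2 * n + 1) * R) := by
      simpa using Q_subset_of_cell hR hk
    refine (e_le (c := BC.N) hb hR.le
      ((hu.magT (isOpen_Q _) (-cellCenter R k) 0).mono hsub)).trans (le_of_eq ?_)
    rw [energyBlk_eq]
    simp_rw [density_magT, sub_neg_eq_add]
  · -- trivial by `e ≤ 0`, as above
    rw [integral_undef hi]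
    exact mul_nonpos_of_nonneg_of_nonpos (by positivity) (e_nonpos _ hb hR.le)

/-! ### Comparison of the Dirichlet and the Neumann energy -/

/-- The derivative is continuous and vanishes off [0, 1]. -/
theorem exists_bound_deriv_smoothTransition :
    ∃ G : ℝ, 0 ≤ G ∧ ∀ t : ℝ, |deriv Real.smoothTransition t| ≤ G := by
  have hc : Continuous (deriv Real.smoothTransition) :=
    (Real.smoothTransition.contDiff (n := 1)).continuous_deriv le_rfl
  obtain ⟨G, hG⟩ := (isCompact_Icc (a := (0 : ℝ)) (b := 1)).exists_bound_of_continuousOn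
    hc.continuousOn
  have hG0 : 0 ≤ G := (norm_nonneg _).trans (hG 0 (by simp))
  refine ⟨G, hG0, fun t => ?_⟩
  by_cases ht : t ∈ Icc (0 : ℝ) 1
  · exact hG t ht
  · have h0 : deriv Real.smoothTransition t = 0 := by
      rw [mem_Icc, not_and_or, not_le, not_le] at ht
      rcases ht with ht | ht
      · have : Real.smoothTransition =ᶠ[𝓝 t] fun _ => 0 := by
          filter_upwards [Iio_mem_nhds ht] with s hs
          exact Real.smoothTransition.zero_of_nonpos (le_of_lt hs)
        rw [this.deriv_eq]; simp
      · have : Real.smoothTransition =ᶠ[𝓝 t] fun _ => 1 := by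
          filter_upwards [Ioi_mem_nhds ht] with s hs
          exact Real.smoothTransition.one_of_one_le (le_of_lt hs)
        rw [this.deriv_eq]; simp
    rw [h0, abs_zero]; exact hG0

/-- A smooth function on the line that is `1` on `[-(r - 1), r - 1]` and `0` off `(-r, r)`. -/
noncomputable def plateau (r t : ℝ) : ℝ :=
  Real.smoothTransition (r - t) * Real.smoothTransition (r + t)

theorem contDiff_plateau (r : ℝ) : ContDiff ℝ ∞ (plateau r) :=
  (Real.smoothTransition.contDiff.comp (contDiff_const.sub contDiff_id)).mul
    (Real.smoothTransition.contDiff.comp (contDiff_const.add contDiff_id))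

theorem plateau_nonneg (r t : ℝ) : 0 ≤ plateau r t :=
  mul_nonneg (Real.smoothTransition.nonneg _) (Real.smoothTransition.nonneg _)

theorem plateau_le_one (r t : ℝ) : plateau r t ≤ 1 :=
  mul_le_one₀ (Real.smoothTransition.le_one _) (Real.smoothTransition.nonneg _)
    (Real.smoothTransition.le_one _)

theorem plateau_eq_one {r t : ℝ} (h : |t| ≤ r - 1) : plateau r t = 1 := by
  rw [abs_le] at h
  rw [plateau, Real.smoothTransition.one_of_one_le (by linarith),
    Real.smoothTransition.one_of_one_le (by linarith), one_mul]

theorem plateau_eq_zero {r t : ℝ} (h : r ≤ |t|) : plateau r t = 0 := by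
  rcases le_abs.1 h with h | h
  · rw [plateau, Real.smoothTransition.zero_of_nonpos (by linarith), zero_mul]
  · rw [plateau, Real.smoothTransition.zero_of_nonpos (x := r + t) (by linarith), mul_zero]

theorem abs_deriv_plateau_le {G : ℝ} (hG : ∀ t : ℝ, |deriv Real.smoothTransition t| ≤ G)
    (r t : ℝ) : |deriv (plateau r) t| ≤ 2 * G := by
  have hd : Differentiable ℝ Real.smoothTransition :=
    (Real.smoothTransition.contDiff (n := 1)).differentiable one_ne_zero
  have h1 : HasDerivAt (fun t => Real.smoothTransition (r - t))
      (-deriv Real.smoothTransition (r - t)) t := (hd (r - t)).hasDerivAt.comp_const_sub r t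
  have h2 : HasDerivAt (fun t => Real.smoothTransition (r + t))
      (deriv Real.smoothTransition (r + t)) t := (hd (r + t)).hasDerivAt.comp_const_add r t
  have h3 : HasDerivAt (plateau r) _ t := h1.mul h2
  rw [h3.deriv]
  refine (abs_add_le _ _).trans ?_
  rw [abs_mul, abs_mul, abs_neg, abs_of_nonneg (Real.smoothTransition.nonneg _),
    abs_of_nonneg (Real.smoothTransition.nonneg _)]
  have a1 := mul_le_mul (hG (r - t)) (Real.smoothTransition.le_one (r + t))
    (Real.smoothTransition.nonneg _) ((abs_nonneg _).trans (hG 0))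
  have a2 := mul_le_mul (Real.smoothTransition.le_one (r - t)) (hG (r + t))
    (abs_nonneg _) zero_le_one
  linarith

/-- A smooth function that vanishes in the bulk of `Q R` and is `1` near its boundary. -/
noncomputable def boundaryStep (r : ℝ) (x : ℝ × ℝ) : ℝ := 1 - plateau r x.1 * plateau r x.2

theorem contDiff_boundaryStep (r : ℝ) : ContDiff ℝ ∞ (boundaryStep r) :=
  contDiff_const.sub (((contDiff_plateau r).comp contDiff_fst).mul
    ((contDiff_plateau r).comp contDiff_snd))

theorem boundaryStep_mem_Icc (r : ℝ) (x : ℝ × ℝ) : boundaryStep r x ∈ Icc (0 : ℝ) 1 := by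
  have h0 := mul_nonneg (plateau_nonneg r x.1) (plateau_nonneg r x.2)
  have h1 := mul_le_one₀ (plateau_le_one r x.1) (plateau_nonneg r x.2) (plateau_le_one r x.2)
  rw [boundaryStep, mem_Icc]
  constructor <;> linarith

theorem fderiv_boundaryStep (r : ℝ) (x v : ℝ × ℝ) :
    fderiv ℝ (boundaryStep r) x v = -(plateau r x.1 * (v.2 * deriv (plateau r) x.2) +
      plateau r x.2 * (v.1 * deriv (plateau r) x.1)) := by
  have hd : Differentiable ℝ (plateau r) := (contDiff_plateau r).differentiable (by simp)
  have h1 := (hd x.1).hasDerivAt.comp_hasFDerivAt x (hasFDerivAt_fst (𝕜 := ℝ) (p := x))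
  have h2 := (hd x.2).hasDerivAt.comp_hasFDerivAt x (hasFDerivAt_snd (𝕜 := ℝ) (p := x))
  have h3 : HasFDerivAt (boundaryStep r) _ x := (h1.mul h2).const_sub 1
  rw [h3.fderiv]
  simp
  ring

theorem abs_fderiv_boundaryStep_le {G : ℝ} (hG : ∀ t : ℝ, |deriv Real.smoothTransition t| ≤ G)
    (r : ℝ) (x : ℝ × ℝ) : |fderiv ℝ (boundaryStep r) x (1, 0)| ≤ 2 * G ∧
      |fderiv ℝ (boundaryStep r) x (0, 1)| ≤ 2 * G := by
  have key : ∀ s t : ℝ, |plateau r s * deriv (plateau r) t| ≤ 2 * G := by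
    intro s t
    rw [abs_mul, abs_of_nonneg (plateau_nonneg r s)]
    have := mul_le_mul (plateau_le_one r s) (abs_deriv_plateau_le hG r t) (abs_nonneg _)
      zero_le_one
    linarith
  rw [fderiv_boundaryStep, fderiv_boundaryStep]
  constructor
  · simpa using key x.2 x.1
  · simpa using key x.1 x.2

/-- The pointwise localization estimate for one component of the covariant derivative. -/
theorem norm_cutoff_add_sq_le {s σ : ℝ} (hs : s ∈ Icc (0 : ℝ) 1) (w z : ℂ) :
    ‖((1 - s ^ 4 : ℝ) : ℂ) * w + ((-(4 * s ^ 3 * σ) : ℝ) : ℂ) * z‖ ^ 2 ≤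
      ‖w‖ ^ 2 + 16 * s ^ 2 * σ ^ 2 * ‖z‖ ^ 2 := by
  obtain ⟨h0, h1⟩ := hs
  have hs4 : s ^ 4 ≤ 1 := pow_le_one₀ h0 h1
  have hn : ‖((1 - s ^ 4 : ℝ) : ℂ) * w + ((-(4 * s ^ 3 * σ) : ℝ) : ℂ) * z‖ ≤
      (1 - s ^ 4) * ‖w‖ + 4 * s ^ 3 * |σ| * ‖z‖ := by
    refine (norm_add_le _ _).trans (le_of_eq ?_)
    rw [norm_mul, norm_mul, Complex.norm_real, Complex.norm_real, Real.norm_eq_abs,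
      Real.norm_eq_abs, abs_of_nonneg (by linarith), abs_neg, abs_mul,
      abs_of_nonneg (by positivity : 0 ≤ 4 * s ^ 3)]
  have hsq := pow_le_pow_left₀ (norm_nonneg _) hn 2
  refine hsq.trans ?_
  rw [← sq_abs σ]
  -- This is convexity of the square with weights 1 − s⁴ and s⁴ at the points ‖w‖ and 4|σ|‖z‖/s,
  -- written as an identity to avoid dividing by s.
  have e : ‖w‖ ^ 2 + 16 * s ^ 2 * |σ| ^ 2 * ‖z‖ ^ 2 -
      ((1 - s ^ 4) * ‖w‖ + 4 * s ^ 3 * |σ| * ‖z‖) ^ 2 =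
      s ^ 4 * ‖w‖ ^ 2 + (1 - s ^ 4) * (s ^ 2 * ‖w‖ - 4 * s * |σ| * ‖z‖) ^ 2 := by ring
  have h2 : 0 ≤ s ^ 4 * ‖w‖ ^ 2 + (1 - s ^ 4) * (s ^ 2 * ‖w‖ - 4 * s * |σ| * ‖z‖) ^ 2 :=
    add_nonneg (by positivity) (mul_nonneg (by linarith) (sq_nonneg _))
  linarith

/-- The potential terms: the quartic term absorbs the localization error. -/
theorem cutoff_potential_le {s G σ₁ σ₂ z : ℝ} (hs : s ∈ Icc (0 : ℝ) 1) (h₁ : |σ₁| ≤ G)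
    (h₂ : |σ₂| ≤ G) :
    16 * s ^ 2 * (σ₁ ^ 2 + σ₂ ^ 2) * z ^ 2 - ((1 - s ^ 4) * z) ^ 2 +
      1 / 2 * ((1 - s ^ 4) * z) ^ 4 ≤
      -z ^ 2 + 1 / 2 * z ^ 4 + 1 / 2 * (32 * G ^ 2 + 2) ^ 2 := by
  obtain ⟨h0, h1⟩ := hs
  have hs4 : s ^ 4 ≤ 1 := pow_le_one₀ h0 h1
  have hs2 : s ^ 2 ≤ 1 := pow_le_one₀ h0 h1
  have hσ₁ : σ₁ ^ 2 ≤ G ^ 2 := sq_le_sq' (by linarith [(abs_le.1 h₁).1]) (abs_le.1 h₁).2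
  have hσ₂ : σ₂ ^ 2 ≤ G ^ 2 := sq_le_sq' (by linarith [(abs_le.1 h₂).1]) (abs_le.1 h₂).2
  have a1 : 16 * s ^ 2 * (σ₁ ^ 2 + σ₂ ^ 2) * z ^ 2 ≤ 32 * G ^ 2 * (s ^ 2 * z ^ 2) := by
    have : 0 ≤ s ^ 2 * z ^ 2 := by positivity
    nlinarith
  have a2 : z ^ 2 - ((1 - s ^ 4) * z) ^ 2 ≤ 2 * (s ^ 2 * z ^ 2) := by
    have e : 2 * (s ^ 2 * z ^ 2) - (z ^ 2 - ((1 - s ^ 4) * z) ^ 2) =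
      z ^ 2 * s ^ 2 * (2 * (1 - s ^ 2) + s ^ 6) := by ring
    have : 0 ≤ z ^ 2 * s ^ 2 * (2 * (1 - s ^ 2) + s ^ 6) :=
      mul_nonneg (by positivity) (add_nonneg (by linarith) (by positivity))
    linarith
  -- Here the exponent 4 in the cutoff 1 − s⁴ pays off: the quartic gain is quadratic in s²z², while
  -- both losses above are linear in it.
  have a3 : 1 / 2 * ((1 - s ^ 4) * z) ^ 4 ≤ 1 / 2 * z ^ 4 - 1 / 2 * (s ^ 2 * z ^ 2) ^ 2 := by
    have b1 : (1 - s ^ 4) ^ 4 ≤ 1 - s ^ 4 :=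
      pow_le_of_le_one (by linarith) (by linarith [pow_nonneg h0 4]) (by norm_num)
    have b2 := mul_le_mul_of_nonneg_right b1 (by positivity : 0 ≤ z ^ 4)
    rw [mul_pow]
    nlinarith
  -- With y = s²z² and k = 32G² + 2, what remains is ky − y²/2 ≤ k²/2.
  nlinarith [sq_nonneg (s ^ 2 * z ^ 2 - (32 * G ^ 2 + 2))]

/-- A Neumann configuration is multiplied by the cutoff 1 − s⁴, where s rises from 0 to 1 near the
boundary. The density grows by at most a constant, and only in a layer of area O(R). The constant
depends neither on the configuration nor on b. -/
theorem exists_e_D_le_e_N_add : ∃ C : ℝ, 0 < C ∧ ∀ b R : ℝ, 0 ≤ b → b ≤ 1 → 4 ≤ R →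
    e BC.D b R ≤ e BC.N b R + C * R := by
  obtain ⟨G₀, hG₀, hG⟩ := exists_bound_deriv_smoothTransition
  set G := 2 * G₀ with hGdef
  set B := 1 / 2 * (32 * G ^ 2 + 2) ^ 2 with hB
  have hB0 : 0 < B := by positivity
  refine ⟨6 * B, by positivity, fun b R hb hb1 hR => ?_⟩
  rw [← sub_le_iff_le_add]
  refine le_e fun u g₁ g₂ hu => ?_
  have hu : MemH1 (Q R) u g₁ g₂ := hu
  rw [sub_le_iff_le_add]
  by_cases hi : IntegrableOn (density b u g₁ g₂) (Q R)
  swap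
  · -- trivial by `e ≤ 0`, as above
    rw [energyBlk_eq, integral_undef hi]
    have := e_nonpos BC.D hb (by linarith : 0 ≤ R)
    have : 0 ≤ 6 * B * R := by positivity
    linarith
  -- The support stays at distance 1/2 from the boundary, and the cutoff is 1 on `Q (R - 3)` because
  -- r − 1 = (R − 3)/2.
  set r := R / 2 - 1 / 2 with hr
  set s := boundaryStep r with hs
  set χ : ℝ × ℝ → ℂ := fun x => ((1 - s x ^ 4 : ℝ) : ℂ) with hχdef
  have hχr : ContDiff ℝ ∞ fun x => 1 - s x ^ 4 :=
    contDiff_const.sub ((contDiff_boundaryStep r).pow 4)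
  have hχ : ContDiff ℝ ∞ χ := Complex.ofRealCLM.contDiff.comp hχr
  have hdχ : ∀ x v, fderiv ℝ χ x v = ((-(4 * s x ^ 3 * fderiv ℝ s x v) : ℝ) : ℂ) := by
    intro x v
    have hsd : DifferentiableAt ℝ s x := (contDiff_boundaryStep r).differentiable (by simp) x
    rw [hχdef, fderiv_ofReal_comp hχr]
    congr 1
    have h := (hsd.hasFDerivAt.pow 4).const_sub 1
    have h' : HasFDerivAt (fun x => 1 - s x ^ 4) _ x := h
    rw [h'.fderiv]
    simp
  have hsupp : Function.support χ ⊆ Icc (-r) r ×ˢ Icc (-r) r := by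
    intro x hx
    by_contra hn
    apply hx
    have h1 : s x = 1 := by
      rw [hs, boundaryStep]
      rw [mem_prod, mem_Icc, mem_Icc, ← abs_le, ← abs_le, not_and_or, not_le, not_le] at hn
      rcases hn with hn | hn
      · rw [plateau_eq_zero hn.le]; ring
      · rw [plateau_eq_zero hn.le]; ring
    simp [hχdef, h1]
  have hKc : IsCompact (Icc (-r) r ×ˢ Icc (-r) r) := isCompact_Icc.prod isCompact_Icc
  have hts : tsupport χ ⊆ Icc (-r) r ×ˢ Icc (-r) r := closure_minimal hsupp hKc.isClosed
  have hcs : HasCompactSupport χ := hKc.of_isClosed_subset (isClosed_tsupport _) hts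
  have hKQ : Icc (-r) r ×ˢ Icc (-r) r ⊆ Q R := by
    rintro x ⟨h1, h2⟩
    rw [mem_Icc] at h1 h2
    rw [mem_Q]
    refine ⟨⟨?_, ?_⟩, ?_, ?_⟩ <;> linarith [h1.1, h1.2, h2.1, h2.2]
  have hmem := hu.mul_cutoff (isOpen_Q R) hχ hcs (hts.trans hKQ)
  set U : ℝ × ℝ → ℂ := fun x => χ x * u x
  set U₁ : ℝ × ℝ → ℂ := fun x => χ x * g₁ x + fderiv ℝ χ x (1, 0) * u x
  set U₂ : ℝ × ℝ → ℂ := fun x => χ x * g₂ x + fderiv ℝ χ x (0, 1) * u x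
  have hχnorm : ∀ x, ‖χ x‖ = 1 - s x ^ 4 := by
    intro x
    have := boundaryStep_mem_Icc r x
    rw [hχdef, Complex.norm_real, Real.norm_eq_abs, abs_of_nonneg]
    linarith [pow_le_one₀ this.1 this.2 (n := 4)]
  have hkin : ∀ x, kinetic U U₁ U₂ x ≤ kinetic u g₁ g₂ x + 16 * s x ^ 2 *
      (fderiv ℝ s x (1, 0) ^ 2 + fderiv ℝ s x (0, 1) ^ 2) * ‖u x‖ ^ 2 := by
    intro x
    have c1 : covDeriv₁ U U₁ x = χ x * covDeriv₁ u g₁ x + fderiv ℝ χ x (1, 0) * u x := by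
      simp only [covDeriv₁, U, U₁]; ring
    have c2 : covDeriv₂ U U₂ x = χ x * covDeriv₂ u g₂ x + fderiv ℝ χ x (0, 1) * u x := by
      simp only [covDeriv₂, U, U₂]; ring
    have n1 := norm_cutoff_add_sq_le (σ := fderiv ℝ s x (1, 0)) (boundaryStep_mem_Icc r x)
      (covDeriv₁ u g₁ x) (u x)
    have n2 := norm_cutoff_add_sq_le (σ := fderiv ℝ s x (0, 1)) (boundaryStep_mem_Icc r x)
      (covDeriv₂ u g₂ x) (u x)
    rw [kinetic, c1, c2, hdχ, hdχ, kinetic]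
    linarith
  have hpt : ∀ x, density b U U₁ U₂ x ≤ density b u g₁ g₂ x + B := by
    intro x
    have hd := abs_fderiv_boundaryStep_le hG r x
    have p1 := cutoff_potential_le (z := ‖u x‖) (boundaryStep_mem_Icc r x) hd.1 hd.2
    have p2 := mul_le_mul_of_nonneg_left (hkin x) hb
    have p3 : b * (16 * s x ^ 2 * (fderiv ℝ s x (1, 0) ^ 2 + fderiv ℝ s x (0, 1) ^ 2) * ‖u x‖ ^ 2) ≤
        16 * s x ^ 2 * (fderiv ℝ s x (1, 0) ^ 2 + fderiv ℝ s x (0, 1) ^ 2) * ‖u x‖ ^ 2 :=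
      mul_le_of_le_one_left (by positivity) hb1
    have hUn : ‖U x‖ = (1 - s x ^ 4) * ‖u x‖ := by rw [norm_mul, hχnorm]
    rw [density, density, hUn]
    linarith
  have hbulk : ∀ x ∈ Q (R - 3), density b U U₁ U₂ x = density b u g₁ g₂ x := by
    intro x hx
    rw [mem_Q] at hx
    have hs0 : s x = 0 := by
      rw [hs, boundaryStep, plateau_eq_one, plateau_eq_one]
      · ring
      · rw [abs_le]; constructor <;> linarith [hx.2.1, hx.2.2]
      · rw [abs_le]; constructor <;> linarith [hx.1.1, hx.1.2]
    apply density_congr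
    · simp [U, hχdef, hs0]
    · simp only [U₁, hdχ, hs0]; simp [hχdef, hs0]
    · simp only [U₂, hdχ, hs0]; simp [hχdef, hs0]
  have hsub3 : Q (R - 3) ⊆ Q R := Q_mono (by linarith)
  have hiU : IntegrableOn (density b U U₁ U₂) (Q R) := by
    rw [hmem.memH1.integrableOn_density_iff]
    have hi4 := (hu.integrableOn_density_iff b).1 hi
    refine hi4.mono' (hmem.memH1.1.1.norm.pow 4) (ae_of_all _ fun x => ?_)
    have hle : ‖U x‖ ≤ ‖u x‖ := by
      rw [norm_mul, hχnorm]
      exact mul_le_of_le_one_left (norm_nonneg _)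
        (by linarith [pow_nonneg (boundaryStep_mem_Icc r x).1 4])
    rw [norm_pow, norm_norm]
    exact pow_le_pow_left₀ (norm_nonneg _) hle 4
  have hind : IntegrableOn ((Q R \ Q (R - 3)).indicator fun _ => B) (Q R) :=
    (integrableOn_const (volume_Q_lt_top R).ne).indicator
      ((measurableSet_Q R).diff (measurableSet_Q _))
  refine (e_le (c := BC.D) hb (by linarith) hmem).trans ?_
  rw [energyBlk_eq, energyBlk_eq]
  calc ∫ x in Q R, density b U U₁ U₂ x
      ≤ ∫ x in Q R, (density b u g₁ g₂ x + (Q R \ Q (R - 3)).indicator (fun _ => B) x) := by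
        refine setIntegral_mono_on hiU (hi.add hind) (measurableSet_Q R) fun x hx => ?_
        by_cases hx3 : x ∈ Q (R - 3)
        · rw [hbulk x hx3, indicator_of_notMem (fun h => h.2 hx3), add_zero]
        · rw [indicator_of_mem (show x ∈ Q R \ Q (R - 3) from ⟨hx, hx3⟩)]
          exact hpt x
    _ = (∫ x in Q R, density b u g₁ g₂ x) + (R ^ 2 - (R - 3) ^ 2) * B := by
        rw [integral_add hi hind, setIntegral_indicator
          ((measurableSet_Q R).diff (measurableSet_Q _)), setIntegral_const, smul_eq_mul,
          inter_eq_self_of_subset_right sdiff_subset,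
          measureReal_sdiff hsub3 (measurableSet_Q _) (volume_Q_lt_top _).ne,
          volume_real_Q (by linarith), volume_real_Q (by linarith)]
    -- The layer has area 6R − 9.
    _ ≤ (∫ x in Q R, density b u g₁ g₂ x) + 6 * B * R := by nlinarith

/-! ### Scaling, and the relation between `e` and `m` -/

section

variable {c : BC} {b R : ℝ} {u g₁ g₂ : ℝ × ℝ → ℂ}

theorem IsConfig.const_mul (h : IsConfig c R u g₁ g₂) (t : ℂ) :
    IsConfig c R (fun x => t * u x) (fun x => t * g₁ x) (fun x => t * g₂ x) := by
  cases c
  · have h : MemH10 (Q R) u g₁ g₂ := h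
    have := h.mul_smooth (isOpen_Q R) (contDiff_const (c := t)) (M := ‖t‖) (by simp) (by simp)
      (by simp)
    simpa [IsConfig] using this
  · have h : MemH1 (Q R) u g₁ g₂ := h
    have := h.mul_smooth (isOpen_Q R) (contDiff_const (c := t)) (M := ‖t‖) (by simp) (by simp)
      (by simp)
    simpa [IsConfig] using this
  · have h : MemH1per R u g₁ g₂ := h
    have h1 : covDeriv₁ (fun x => t * u x) (fun x => t * g₁ x) = fun x => t * covDeriv₁ u g₁ x := by
      ext x; simp only [covDeriv₁]; ring
    have h2 : covDeriv₂ (fun x => t * u x) (fun x => t * g₂ x) = fun x => t * covDeriv₂ u g₂ x := by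
      ext x; simp only [covDeriv₂]; ring
    exact
      { memL2loc := fun K hK => (h.1 K hK).const_mul t
        weakGrad := ⟨h.2.1.const_mul isOpen_univ t, h.2.2.const_mul isOpen_univ t⟩
        memL2loc₁ := by rw [h1]; exact fun K hK => (h.3 K hK).const_mul t
        memL2loc₂ := by rw [h2]; exact fun K hK => (h.4 K hK).const_mul t
        periodic₁ := by filter_upwards [h.5] with x hx; rw [hx]; ring
        periodic₂ := by filter_upwards [h.6] with x hx; rw [hx]; ring }

theorem kinetic_const_mul (t : ℝ) (u g₁ g₂ : ℝ × ℝ → ℂ) (x : ℝ × ℝ) :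
    kinetic (fun x => (t : ℂ) * u x) (fun x => (t : ℂ) * g₁ x) (fun x => (t : ℂ) * g₂ x) x =
      t ^ 2 * kinetic u g₁ g₂ x := by
  have h1 : covDeriv₁ (fun x => (t : ℂ) * u x) (fun x => (t : ℂ) * g₁ x) x =
      t * covDeriv₁ u g₁ x := by
    simp only [covDeriv₁]; ring
  have h2 : covDeriv₂ (fun x => (t : ℂ) * u x) (fun x => (t : ℂ) * g₂ x) x =
      t * covDeriv₂ u g₂ x := by
    simp only [covDeriv₂]; ring
  rw [kinetic, h1, h2, norm_mul, norm_mul, Complex.norm_real, Real.norm_eq_abs, mul_pow, mul_pow,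
    sq_abs, kinetic]
  ring

theorem MemH1.energyBlk_eq_add (h : MemH1 (Q R) u g₁ g₂) (b : ℝ)
    (hi : IntegrableOn (fun x => ‖u x‖ ^ 4) (Q R)) :
    energyBlk b R u g₁ g₂ = energyLin b R u g₁ g₂ + 1 / 2 * ∫ x in Q R, ‖u x‖ ^ 4 := by
  rw [energyBlk, energyLin, integral_add (h.integrableOn_lin b) (hi.const_mul _),
    integral_const_mul]

theorem MemH1.energyBlk_const_mul (h : MemH1 (Q R) u g₁ g₂) (b t : ℝ)
    (hi : IntegrableOn (fun x => ‖u x‖ ^ 4) (Q R)) :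
    energyBlk b R (fun x => (t : ℂ) * u x) (fun x => (t : ℂ) * g₁ x) (fun x => (t : ℂ) * g₂ x) =
      t ^ 2 * energyLin b R u g₁ g₂ + t ^ 4 * (1 / 2 * ∫ x in Q R, ‖u x‖ ^ 4) := by
  rw [energyBlk, energyLin, ← integral_const_mul, ← integral_const_mul, ← integral_const_mul,
    ← integral_add ((h.integrableOn_lin b).const_mul _) ((hi.const_mul _).const_mul _)]
  congr 1
  ext x
  have h4 : |t| ^ 4 = t ^ 4 := by rw [pow_abs, abs_of_nonneg (by positivity)]
  rw [kinetic_const_mul, norm_mul, Complex.norm_real, Real.norm_eq_abs, mul_pow, mul_pow, sq_abs,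
    h4]
  ring

/-- Otherwise u = 0 almost everywhere, and only the non-negative kinetic term is left. -/
theorem quartic_pos (hb : 0 ≤ b)
    (hi : IntegrableOn (fun x => ‖u x‖ ^ 4) (Q R)) (hneg : energyLin b R u g₁ g₂ < 0) :
    0 < ∫ x in Q R, ‖u x‖ ^ 4 := by
  refine lt_of_le_of_ne (integral_nonneg fun x => by positivity) fun h0 => ?_
  have hz := (integral_eq_zero_iff_of_nonneg (fun x => by positivity) hi).1 h0.symm
  have hE : energyLin b R u g₁ g₂ = ∫ x in Q R, b * kinetic u g₁ g₂ x := by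
    rw [energyLin]
    refine integral_congr_ae ?_
    filter_upwards [hz] with x hx
    have : ‖u x‖ = 0 := pow_eq_zero_iff (n := 4) (by norm_num) |>.1 hx
    rw [this]; ring
  have : 0 ≤ energyLin b R u g₁ g₂ := by
    rw [hE]
    exact integral_nonneg fun x => mul_nonneg hb (kinetic_nonneg _ _ _ _)
  linarith

/-- Optimization over the multiples of a configuration. -/
theorem e_le_neg_sq_div (hb : 0 ≤ b) (hR : 0 ≤ R) (h : IsConfig c R u g₁ g₂)
    (hi : IntegrableOn (fun x => ‖u x‖ ^ 4) (Q R)) (hneg : energyLin b R u g₁ g₂ < 0) :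
    e c b R ≤ -(energyLin b R u g₁ g₂ ^ 2 / (2 * ∫ x in Q R, ‖u x‖ ^ 4)) := by
  have hI := quartic_pos hb hi hneg
  set I := ∫ x in Q R, ‖u x‖ ^ 4 with hIdef
  set E := energyLin b R u g₁ g₂ with hE
  -- This t minimizes t²E + t⁴I/2.
  set t := √(-E / I) with ht
  have ht2 : t ^ 2 = -E / I := Real.sq_sqrt (div_nonneg (by linarith) hI.le)
  refine (e_le hb hR (h.const_mul (t : ℂ))).trans (le_of_eq ?_)
  rw [h.memH1.energyBlk_const_mul b t hi, ← hE, ← hIdef, show t ^ 4 = (t ^ 2) ^ 2 by ring, ht2]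
  field_simp
  ring

/-- Only negative quotients matter, and for these the optimized scaling says that the square of the
quotient is at most −2e. -/
theorem neg_sqrt_le_quotient (hb : 0 ≤ b) (hR : 0 ≤ R) (h : IsConfig c R u g₁ g₂) :
    -√(-2 * e c b R) ≤ energyLin b R u g₁ g₂ / √(∫ x in Q R, ‖u x‖ ^ 4) := by
  have hs := Real.sqrt_nonneg (-2 * e c b R)
  rcases le_or_gt 0 (energyLin b R u g₁ g₂) with hE | hE
  · exact (neg_nonpos.2 hs).trans (div_nonneg hE (Real.sqrt_nonneg _))
  by_cases hi : IntegrableOn (fun x => ‖u x‖ ^ 4) (Q R)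
  swap
  -- Without an integrable quartic term the quotient is a division by 0, with value 0.
  · rw [integral_undef hi, Real.sqrt_zero, div_zero]
    linarith
  have hI := quartic_pos hb hi hE
  have key := e_le_neg_sq_div hb hR h hi hE
  set I := ∫ x in Q R, ‖u x‖ ^ 4
  set E := energyLin b R u g₁ g₂
  rw [neg_le, ← neg_div]
  refine Real.le_sqrt_of_sq_le ?_
  rw [div_pow, Real.sq_sqrt hI.le, neg_sq]
  have : E ^ 2 / I = 2 * (E ^ 2 / (2 * I)) := by field_simp
  rw [this]
  linarith

theorem bddBelow_quotients (c : BC) (hb : 0 ≤ b) (hR : 0 ≤ R) :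
    BddBelow {E | ∃ u g₁ g₂ : ℝ × ℝ → ℂ, IsConfig c R u g₁ g₂ ∧
      ¬ (u =ᵐ[volume.restrict (Q R)] 0) ∧
      E = energyLin b R u g₁ g₂ / √(∫ x in Q R, ‖u x‖ ^ 4)} :=
  ⟨-√(-2 * e c b R), by
    rintro _ ⟨u, g₁, g₂, h, _, rfl⟩
    exact neg_sqrt_le_quotient hb hR h⟩

theorem neg_sqrt_le_m (c : BC) (hb : 0 ≤ b) (hR : 0 ≤ R) : -√(-2 * e c b R) ≤ m c b R := by
  rw [m]
  rcases Set.eq_empty_or_nonempty {E | ∃ u g₁ g₂ : ℝ × ℝ → ℂ, IsConfig c R u g₁ g₂ ∧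
      ¬ (u =ᵐ[volume.restrict (Q R)] 0) ∧
      E = energyLin b R u g₁ g₂ / √(∫ x in Q R, ‖u x‖ ^ 4)} with h | h
  -- Without non-zero configurations, as for R = 0, the infimum takes its default value 0.
  · rw [h, Real.sInf_empty]
    exact neg_nonpos.2 (Real.sqrt_nonneg _)
  · refine le_csInf h ?_
    rintro _ ⟨u, g₁, g₂, h, _, rfl⟩
    exact neg_sqrt_le_quotient hb hR h

/-- Negative energy excludes the default value 0 of the integral, so the quartic term is integrable;
the sign then forces a negative linear part and u ≠ 0. -/
theorem m_le_quotient_of_energyBlk_neg (hb : 0 ≤ b) (hR : 0 ≤ R) (h : IsConfig c R u g₁ g₂)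
    (hneg : energyBlk b R u g₁ g₂ < 0) :
    0 < ∫ x in Q R, ‖u x‖ ^ 4 ∧ energyLin b R u g₁ g₂ < 0 ∧
    m c b R ≤ energyLin b R u g₁ g₂ / √(∫ x in Q R, ‖u x‖ ^ 4) ∧
    energyBlk b R u g₁ g₂ = energyLin b R u g₁ g₂ + 1 / 2 * ∫ x in Q R, ‖u x‖ ^ 4 := by
  have hi : IntegrableOn (fun x => ‖u x‖ ^ 4) (Q R) := by
    rw [← h.memH1.integrableOn_density_iff b]
    by_contra hn
    rw [energyBlk_eq, integral_undef hn] at hneg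
    exact lt_irrefl _ hneg
  have heq := h.memH1.energyBlk_eq_add b hi
  have hI0 : 0 ≤ ∫ x in Q R, ‖u x‖ ^ 4 := integral_nonneg fun x => by positivity
  have hE : energyLin b R u g₁ g₂ < 0 := by linarith
  have hI := quartic_pos hb hi hE
  refine ⟨hI, hE, csInf_le (bddBelow_quotients c hb hR) ⟨u, g₁, g₂, h, fun h0 => ?_, rfl⟩, heq⟩
  have : ∫ x in Q R, ‖u x‖ ^ 4 = 0 := by
    rw [← integral_zero (ℝ × ℝ) ℝ (μ := volume.restrict (Q R))]
    refine integral_congr_ae ?_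
    filter_upwards [h0] with x hx
    simp [hx]
  linarith

/-- With q the square root of the quartic integral, a negative energy is at least mq + q²/2 ≥ −m²/2,
hence e ≥ −m²/2. One competitor of negative energy gives m ≤ 0 and thereby the sign of the root. -/
theorem m_le_neg_sqrt (hb : 0 ≤ b) (hR : 0 ≤ R) (hneg : e c b R < 0) :
    m c b R ≤ -√(-2 * e c b R) := by
  obtain ⟨_, ⟨u, g₁, g₂, hu, rfl⟩, hlt⟩ :=
    exists_lt_of_csInf_lt (s := {E | ∃ u g₁ g₂ : ℝ × ℝ → ℂ, IsConfig c R u g₁ g₂ ∧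
      E = energyBlk b R u g₁ g₂}) ⟨_, _, _, _, isConfig_zero c R, rfl⟩ hneg
  have hm : m c b R ≤ 0 := by
    obtain ⟨hI, hE, hle, _⟩ := m_le_quotient_of_energyBlk_neg hb hR hu hlt
    exact hle.trans (div_nonpos_of_nonpos_of_nonneg hE.le (Real.sqrt_nonneg _))
  have he : -(m c b R ^ 2 / 2) ≤ e c b R := by
    refine le_e fun u g₁ g₂ hu => ?_
    rcases le_or_gt 0 (energyBlk b R u g₁ g₂) with h0 | h0
    · nlinarith [sq_nonneg (m c b R)]
    · obtain ⟨hI, hE, hle, heq⟩ := m_le_quotient_of_energyBlk_neg hb hR hu h0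
      rw [heq]
      set I := ∫ x in Q R, ‖u x‖ ^ 4
      have hq : 0 < √I := Real.sqrt_pos.2 hI
      have hqs : √I ^ 2 = I := Real.sq_sqrt hI.le
      rw [le_div_iff₀ hq] at hle
      nlinarith [sq_nonneg (m c b R + √I)]
  rw [le_neg]
  exact Real.sqrt_le_iff.2 ⟨by linarith, by nlinarith⟩

end

/-! ### A trial state: the truncated Gaussian -/

theorem integrable_gauss : Integrable fun t : ℝ => Real.exp (-(1 / 2) * t ^ 2) :=
  integrable_exp_neg_mul_sq (by norm_num)

theorem integrable_sq_mul_gauss : Integrable fun t : ℝ => t ^ 2 * Real.exp (-(1 / 2) * t ^ 2) := by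
  have := integrable_rpow_mul_exp_neg_mul_sq (b := 1 / 2) (by norm_num) (s := 2) (by norm_num)
  simpa using this

/-- Integration by parts of t against the derivative of the Gaussian. -/
theorem integral_sq_mul_gauss :
    ∫ t : ℝ, t ^ 2 * Real.exp (-(1 / 2) * t ^ 2) = ∫ t : ℝ, Real.exp (-(1 / 2) * t ^ 2) := by
  have hd : ∀ t : ℝ, HasDerivAt (fun t => Real.exp (-(1 / 2) * t ^ 2))
      (-(t * Real.exp (-(1 / 2) * t ^ 2))) t := by
    intro t
    have h := ((hasDerivAt_pow 2 t).const_mul (-(1 / 2) : ℝ)).exp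
    convert h using 1
    simp; ring
  have i1 : Integrable fun t : ℝ => t * Real.exp (-(1 / 2) * t ^ 2) := by
    have := integrable_mul_exp_neg_mul_sq (b := 1 / 2) (by norm_num)
    simpa using this
  have h := integral_mul_deriv_eq_deriv_mul_of_integrable (u := fun t : ℝ => t)
    (v := fun t => Real.exp (-(1 / 2) * t ^ 2)) (u' := fun _ => 1)
    (v' := fun t => -(t * Real.exp (-(1 / 2) * t ^ 2))) (fun t _ => hasDerivAt_id t)
    (fun t _ => hd t)
    (by
      refine integrable_sq_mul_gauss.neg.congr (ae_of_all _ fun t => ?_)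
      simp; ring)
    (integrable_gauss.congr (ae_of_all _ fun t => by simp)) i1
  have e1 : ∀ t : ℝ, t * -(t * Real.exp (-(1 / 2) * t ^ 2)) =
      -(t ^ 2 * Real.exp (-(1 / 2) * t ^ 2)) := fun t => by ring
  simp_rw [e1, one_mul, integral_neg, neg_inj] at h
  exact h

theorem exp_sq_split (x : ℝ × ℝ) : Real.exp (-(1 / 2) * (x.1 ^ 2 + x.2 ^ 2)) =
    Real.exp (-(1 / 2) * x.1 ^ 2) * Real.exp (-(1 / 2) * x.2 ^ 2) := by
  rw [← Real.exp_add]; ring_nf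

theorem integrable_gauss_prod :
    Integrable fun x : ℝ × ℝ => Real.exp (-(1 / 2) * (x.1 ^ 2 + x.2 ^ 2)) := by
  simp_rw [exp_sq_split]
  exact integrable_gauss.mul_prod integrable_gauss

theorem integrable_sq_mul_gauss_prod : Integrable fun x : ℝ × ℝ =>
    (x.1 ^ 2 + x.2 ^ 2) * Real.exp (-(1 / 2) * (x.1 ^ 2 + x.2 ^ 2)) := by
  refine ((integrable_sq_mul_gauss.mul_prod integrable_gauss).add
    (integrable_gauss.mul_prod integrable_sq_mul_gauss)).congr (ae_of_all _ fun x => ?_)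
  simp only [Pi.add_apply, exp_sq_split]
  ring

theorem integral_gauss_prod_pos :
    0 < ∫ x : ℝ × ℝ, Real.exp (-(1 / 2) * (x.1 ^ 2 + x.2 ^ 2)) :=
  integral_exp_pos integrable_gauss_prod

/-- The lowest eigenvalue of the constant field is attained by the Gaussian. -/
theorem integral_sq_mul_gauss_prod :
    ∫ x : ℝ × ℝ, (x.1 ^ 2 + x.2 ^ 2) * Real.exp (-(1 / 2) * (x.1 ^ 2 + x.2 ^ 2)) =
      2 * ∫ x : ℝ × ℝ, Real.exp (-(1 / 2) * (x.1 ^ 2 + x.2 ^ 2)) := by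
  have e : ∀ x : ℝ × ℝ, (x.1 ^ 2 + x.2 ^ 2) * Real.exp (-(1 / 2) * (x.1 ^ 2 + x.2 ^ 2)) =
      (x.1 ^ 2 * Real.exp (-(1 / 2) * x.1 ^ 2)) * Real.exp (-(1 / 2) * x.2 ^ 2) +
      Real.exp (-(1 / 2) * x.1 ^ 2) * (x.2 ^ 2 * Real.exp (-(1 / 2) * x.2 ^ 2)) := by
    intro x; rw [exp_sq_split]; ring
  simp_rw [e, exp_sq_split]
  rw [Measure.volume_eq_prod, integral_add (integrable_sq_mul_gauss.mul_prod integrable_gauss)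
    (integrable_gauss.mul_prod integrable_sq_mul_gauss),
    integral_prod_mul (fun t : ℝ => t ^ 2 * Real.exp (-(1 / 2) * t ^ 2))
      (fun t : ℝ => Real.exp (-(1 / 2) * t ^ 2)),
    integral_prod_mul (fun t : ℝ => Real.exp (-(1 / 2) * t ^ 2))
      (fun t : ℝ => t ^ 2 * Real.exp (-(1 / 2) * t ^ 2)),
    integral_prod_mul (fun t : ℝ => Real.exp (-(1 / 2) * t ^ 2))
      (fun t : ℝ => Real.exp (-(1 / 2) * t ^ 2)), integral_sq_mul_gauss]
  ring

/-- The truncation of the Gaussian to the square of side `2 r`. -/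
noncomputable def trialState (r : ℝ) (x : ℝ × ℝ) : ℝ :=
  (1 - boundaryStep r x) * Real.exp (-(1 / 4) * (x.1 ^ 2 + x.2 ^ 2))

theorem contDiff_trialState (r : ℝ) : ContDiff ℝ ∞ (trialState r) := by
  refine (contDiff_const.sub (contDiff_boundaryStep r)).mul ?_
  fun_prop

theorem fderiv_trialState (r : ℝ) (x v : ℝ × ℝ) :
    fderiv ℝ (trialState r) x v = (-(fderiv ℝ (boundaryStep r) x v) -
      (1 - boundaryStep r x) * (x.1 * v.1 + x.2 * v.2) / 2) *
        Real.exp (-(1 / 4) * (x.1 ^ 2 + x.2 ^ 2)) := by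
  have h1 := ((contDiff_boundaryStep r).differentiable (by simp) x).hasFDerivAt.const_sub 1
  have hf : HasFDerivAt (fun x : ℝ × ℝ => x.1 ^ 2) _ x :=
    (hasFDerivAt_fst (𝕜 := ℝ) (p := x)).pow 2
  have hs : HasFDerivAt (fun x : ℝ × ℝ => x.2 ^ 2) _ x :=
    (hasFDerivAt_snd (𝕜 := ℝ) (p := x)).pow 2
  have h2 := ((hf.add hs).const_mul (-(1 / 4) : ℝ)).exp
  have h3 : HasFDerivAt (trialState r) _ x := h1.mul h2
  rw [h3.fderiv]
  simp
  ring

/-- For real f, ∇f and iA₀f are the real and imaginary parts, so there is no cross term; moreover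
|A₀|² = |x|²/4. -/
theorem kinetic_ofReal {f : ℝ × ℝ → ℝ} (hf : ContDiff ℝ ∞ f) (x : ℝ × ℝ) :
    kinetic (fun y => (f y : ℂ)) (fun y => fderiv ℝ (fun z => (f z : ℂ)) y (1, 0))
      (fun y => fderiv ℝ (fun z => (f z : ℂ)) y (0, 1)) x =
      fderiv ℝ f x (1, 0) ^ 2 + fderiv ℝ f x (0, 1) ^ 2 + (x.1 ^ 2 + x.2 ^ 2) / 4 * f x ^ 2 := by
  have key : ∀ p q : ℝ, ‖(p : ℂ) - Complex.I * (q : ℂ)‖ ^ 2 = p ^ 2 + q ^ 2 := by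
    intro p q
    rw [← Complex.normSq_eq_norm_sq, Complex.normSq_apply]
    simp; ring
  have h1 : covDeriv₁ (fun y => (f y : ℂ)) (fun y => fderiv ℝ (fun z => (f z : ℂ)) y (1, 0)) x =
      ((fderiv ℝ f x (1, 0) : ℝ) : ℂ) - Complex.I * ((A₁ x * f x : ℝ) : ℂ) := by
    rw [covDeriv₁, fderiv_ofReal_comp hf]; push_cast; ring
  have h2 : covDeriv₂ (fun y => (f y : ℂ)) (fun y => fderiv ℝ (fun z => (f z : ℂ)) y (0, 1)) x =
      ((fderiv ℝ f x (0, 1) : ℝ) : ℂ) - Complex.I * ((A₂ x * f x : ℝ) : ℂ) := by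
    rw [covDeriv₂, fderiv_ofReal_comp hf]; push_cast; ring
  rw [kinetic, h1, h2, key, key, A₁, A₂]
  ring

/-- The density of `energyLin` at the trial state. -/
noncomputable def trialDensity (b r : ℝ) (x : ℝ × ℝ) : ℝ :=
  b * (fderiv ℝ (trialState r) x (1, 0) ^ 2 + fderiv ℝ (trialState r) x (0, 1) ^ 2 +
    (x.1 ^ 2 + x.2 ^ 2) / 4 * trialState r x ^ 2) - trialState r x ^ 2

theorem exp_quarter_sq (x : ℝ × ℝ) : Real.exp (-(1 / 4) * (x.1 ^ 2 + x.2 ^ 2)) ^ 2 =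
    Real.exp (-(1 / 2) * (x.1 ^ 2 + x.2 ^ 2)) := by
  rw [← Real.exp_nat_mul]; congr 1; push_cast; ring

theorem boundaryStep_eventuallyEq_zero {r : ℝ} {x : ℝ × ℝ} (h : ‖x‖ < r - 1) :
    boundaryStep r =ᶠ[𝓝 x] fun _ => 0 := by
  have hn : {y : ℝ × ℝ | ‖y‖ < r - 1} ∈ 𝓝 x :=
    (isOpen_lt continuous_norm continuous_const).mem_nhds h
  filter_upwards [hn] with y hy
  have h1 := (norm_fst_le y).trans (le_of_lt hy)
  have h2 := (norm_snd_le y).trans (le_of_lt hy)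
  rw [Real.norm_eq_abs] at h1 h2
  rw [boundaryStep, plateau_eq_one h1, plateau_eq_one h2]
  ring

/-- Dominated convergence: near any fixed point the truncation is eventually inactive, and the full
Gaussian has kinetic density (|x|²/2) exp(−|x|²/2), whose integral is the mass. -/
theorem tendsto_integral_trialDensity {b : ℝ} (hb : 0 ≤ b) (hb1 : b ≤ 1) :
    Tendsto (fun n : ℕ => ∫ x, trialDensity b n x) atTop
      (𝓝 ((b - 1) * ∫ x : ℝ × ℝ, Real.exp (-(1 / 2) * (x.1 ^ 2 + x.2 ^ 2)))) := by
  obtain ⟨G₀, hG₀, hG⟩ := exists_bound_deriv_smoothTransition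
  have hlim : (b - 1) * ∫ x : ℝ × ℝ, Real.exp (-(1 / 2) * (x.1 ^ 2 + x.2 ^ 2)) =
      ∫ x : ℝ × ℝ, (b / 2 * ((x.1 ^ 2 + x.2 ^ 2) * Real.exp (-(1 / 2) * (x.1 ^ 2 + x.2 ^ 2))) -
        Real.exp (-(1 / 2) * (x.1 ^ 2 + x.2 ^ 2))) := by
    rw [integral_sub (integrable_sq_mul_gauss_prod.const_mul _) integrable_gauss_prod,
      integral_const_mul, integral_sq_mul_gauss_prod]
    ring
  rw [hlim]
  have hform : ∀ (n : ℕ) (x : ℝ × ℝ), trialDensity b n x =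
      (b * ((-(fderiv ℝ (boundaryStep n) x (1, 0)) - (1 - boundaryStep n x) * x.1 / 2) ^ 2 +
        (-(fderiv ℝ (boundaryStep n) x (0, 1)) - (1 - boundaryStep n x) * x.2 / 2) ^ 2 +
        (x.1 ^ 2 + x.2 ^ 2) / 4 * (1 - boundaryStep n x) ^ 2) - (1 - boundaryStep n x) ^ 2) *
      Real.exp (-(1 / 2) * (x.1 ^ 2 + x.2 ^ 2)) := by
    intro n x
    rw [trialDensity, fderiv_trialState, fderiv_trialState, trialState, ← exp_quarter_sq]
    ring
  refine tendsto_integral_of_dominated_convergence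
    -- The cutoff has partial derivatives at most 2G₀, and 2(p² + q²) ≤ 16G₀² for the two of them;
    -- the extra 1 covers the mass term.
    (fun x => (x.1 ^ 2 + x.2 ^ 2) * Real.exp (-(1 / 2) * (x.1 ^ 2 + x.2 ^ 2)) +
      (16 * G₀ ^ 2 + 1) * Real.exp (-(1 / 2) * (x.1 ^ 2 + x.2 ^ 2))) ?_ ?_ ?_ ?_
  · intro n
    have hc := (contDiff_trialState n).continuous
    have hd : ∀ v : ℝ × ℝ, Continuous fun x => fderiv ℝ (trialState n) x v := fun v =>
      ((contDiff_trialState n).continuous_fderiv (by simp)).clm_apply continuous_const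
    have hd1 := hd (1, 0)
    have hd2 := hd (0, 1)
    have : Continuous (trialDensity b n) := by
      unfold trialDensity
      fun_prop
    exact this.aestronglyMeasurable
  · exact integrable_sq_mul_gauss_prod.add (integrable_gauss_prod.const_mul _)
  · intro n
    refine ae_of_all _ fun x => ?_
    have hE := (Real.exp_pos (-(1 / 2) * (x.1 ^ 2 + x.2 ^ 2))).le
    rw [hform, norm_mul, Real.norm_eq_abs, Real.norm_eq_abs, abs_of_nonneg hE, ← add_mul]
    refine mul_le_mul_of_nonneg_right ?_ hE
    obtain ⟨d1, d2⟩ := abs_fderiv_boundaryStep_le hG n x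
    obtain ⟨s0, s1⟩ := boundaryStep_mem_Icc n x
    set p := fderiv ℝ (boundaryStep n) x (1, 0)
    set q := fderiv ℝ (boundaryStep n) x (0, 1)
    set w := 1 - boundaryStep n x
    have w0 : 0 ≤ w := by simp only [w]; linarith
    have w1 : w ≤ 1 := by simp only [w]; linarith
    have hp : p ^ 2 ≤ 4 * G₀ ^ 2 := by
      have := sq_le_sq' (abs_le.1 d1).1 (abs_le.1 d1).2; linarith
    have hq : q ^ 2 ≤ 4 * G₀ ^ 2 := by
      have := sq_le_sq' (abs_le.1 d2).1 (abs_le.1 d2).2; linarith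
    have hw : w ^ 2 ≤ 1 := pow_le_one₀ w0 w1
    have k1 : ∀ y z : ℝ, (-y - w * z / 2) ^ 2 ≤ 2 * y ^ 2 + z ^ 2 / 2 := by
      intro y z
      nlinarith [sq_nonneg (y - w * z / 2), sq_nonneg z]
    have k2 : (x.1 ^ 2 + x.2 ^ 2) / 4 * w ^ 2 ≤ (x.1 ^ 2 + x.2 ^ 2) / 4 :=
      mul_le_of_le_one_right (by positivity) hw
    set S := (-p - w * x.1 / 2) ^ 2 + (-q - w * x.2 / 2) ^ 2 + (x.1 ^ 2 + x.2 ^ 2) / 4 * w ^ 2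
      with hS
    have hS0 : 0 ≤ S := by positivity
    have hS1 : S ≤ 16 * G₀ ^ 2 + (x.1 ^ 2 + x.2 ^ 2) := by
      have := k1 p x.1
      have := k1 q x.2
      nlinarith [sq_nonneg x.1, sq_nonneg x.2]
    have hbS : b * S ≤ S := mul_le_of_le_one_left hS0 hb1
    have hbS0 : 0 ≤ b * S := mul_nonneg hb hS0
    rw [abs_le]
    constructor <;> nlinarith [sq_nonneg w, sq_nonneg G₀, sq_nonneg x.1, sq_nonneg x.2]
  · refine ae_of_all _ fun x => ?_
    obtain ⟨N, hN⟩ := exists_nat_gt (‖x‖ + 1)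
    refine tendsto_const_nhds.congr' ?_
    filter_upwards [eventually_ge_atTop N] with n hn
    have hn' : (N : ℝ) ≤ n := by exact_mod_cast hn
    have hev := boundaryStep_eventuallyEq_zero (r := n) (x := x) (by linarith)
    rw [hform, hev.eq_of_nhds, hev.fderiv_eq]
    simp
    ring

theorem exists_e_D_neg {b : ℝ} (hb : 0 ≤ b) (hb1 : b < 1) : ∃ R : ℝ, 0 < R ∧ e BC.D b R < 0 := by
  have hneg : (b - 1) * ∫ x : ℝ × ℝ, Real.exp (-(1 / 2) * (x.1 ^ 2 + x.2 ^ 2)) < 0 :=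
    mul_neg_of_neg_of_pos (by linarith) integral_gauss_prod_pos
  obtain ⟨n, hn⟩ := ((tendsto_integral_trialDensity hb hb1.le).eventually_lt_const hneg).exists
  have hf := contDiff_trialState n
  set f : ℝ × ℝ → ℂ := fun x => (trialState n x : ℂ) with hfdef
  have hfC : ContDiff ℝ ∞ f := Complex.ofRealCLM.contDiff.comp hf
  set K : Set (ℝ × ℝ) := Icc (-(n : ℝ)) n ×ˢ Icc (-(n : ℝ)) n with hK
  have hKc : IsCompact K := isCompact_Icc.prod isCompact_Icc
  have h0 : ∀ x ∉ K, trialState n x = 0 := by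
    intro x hx
    rw [hK, mem_prod, mem_Icc, mem_Icc, ← abs_le, ← abs_le, not_and_or, not_le, not_le] at hx
    rw [trialState, boundaryStep]
    rcases hx with hx | hx <;> rw [plateau_eq_zero hx.le] <;> ring
  have hsupp : tsupport f ⊆ K := by
    refine closure_minimal (fun x hx => ?_) hKc.isClosed
    by_contra hn
    exact hx (by simp [hfdef, h0 x hn])
  have hsuppR : tsupport (trialState n) ⊆ K := by
    refine closure_minimal (fun x hx => ?_) hKc.isClosed
    by_contra hn
    exact hx (h0 x hn)
  have hcs : HasCompactSupport f := hKc.of_isClosed_subset (isClosed_tsupport _) hsupp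
  -- A side larger than 2n puts the closed support inside the open square.
  set R : ℝ := 2 * n + 1 with hR
  have hRpos : 0 < R := by positivity
  have hKQ : K ⊆ Q R := by
    rintro x ⟨h1, h2⟩
    rw [mem_Icc] at h1 h2
    rw [mem_Q]
    refine ⟨⟨?_, ?_⟩, ?_, ?_⟩ <;> linarith [h1.1, h1.2, h2.1, h2.2]
  have hmem : IsConfig BC.D R f (fun x => fderiv ℝ f x (1, 0)) (fun x => fderiv ℝ f x (0, 1)) :=
    MemH10.of_contDiff hfC hcs (hsupp.trans hKQ)
  have hlin : energyLin b R f (fun x => fderiv ℝ f x (1, 0)) (fun x => fderiv ℝ f x (0, 1)) =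
      ∫ x, trialDensity b n x := by
    have e : ∀ x, b * kinetic f (fun x => fderiv ℝ f x (1, 0)) (fun x => fderiv ℝ f x (0, 1)) x -
        ‖f x‖ ^ 2 = trialDensity b n x := by
      intro x
      rw [kinetic_ofReal hf, Complex.norm_real, Real.norm_eq_abs, sq_abs, trialDensity]
    rw [energyLin]
    simp_rw [e]
    refine setIntegral_eq_integral_of_forall_compl_eq_zero fun x hx => ?_
    have hx' : x ∉ K := fun h => hx (hKQ h)
    have hd : ∀ v, fderiv ℝ (trialState n) x v = 0 := by
      intro v
      by_contra hne
      exact hx' (hsuppR (tsupport_fderiv_apply_subset ℝ v (subset_tsupport _ hne)))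
    rw [trialDensity, hd, hd, h0 x hx']
    ring
  have hint : IntegrableOn (fun x => ‖f x‖ ^ 4) (Q R) := by
    have hc : Continuous fun x => ‖f x‖ ^ 4 := hfC.continuous.norm.pow 4
    have hcs4 : HasCompactSupport fun x => ‖f x‖ ^ 4 :=
      hcs.comp_left (g := fun z : ℂ => ‖z‖ ^ 4) (by simp)
    exact (hc.integrable_of_hasCompactSupport hcs4).integrableOn
  have hlt : energyLin b R f (fun x => fderiv ℝ f x (1, 0)) (fun x => fderiv ℝ f x (0, 1)) < 0 := by
    rw [hlin]; exact hn
  refine ⟨R, hRpos, (e_le_neg_sq_div hb hRpos.le hmem hint hlt).trans_lt ?_⟩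
  have hI := quartic_pos hb hint hlt
  rw [neg_lt_zero]
  exact div_pos (sq_pos_of_ne_zero hlt.ne) (by positivity)

/-! ### The bulk energy -/

theorem toInfty_D : toInfty BC.D = atTop := by
  simp [toInfty, admissible]

/-- A Fekete argument: tiling by a nearly optimal square, with monotonicity for the remainder,
forces convergence to the infimum. -/
theorem exists_tendsto_e_D {b : ℝ} (hb : 0 ≤ b) :
    ∃ E : ℝ, Tendsto (fun R => e BC.D b R / R ^ 2) atTop (𝓝 E) ∧
      ∀ R : ℝ, 0 < R → E ≤ e BC.D b R / R ^ 2 := by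
  set S : Set ℝ := (fun R => e BC.D b R / R ^ 2) '' Ioi 0 with hS
  have hbdd : BddBelow S := by
    refine ⟨-(1 / 2), ?_⟩
    rintro _ ⟨R, hR, rfl⟩
    have hR : 0 < R := hR
    rw [le_div_iff₀ (by positivity)]
    exact neg_half_le_e _ hb hR.le
  have hne : S.Nonempty := ⟨_, 1, by simp, rfl⟩
  have hle : ∀ R : ℝ, 0 < R → sInf S ≤ e BC.D b R / R ^ 2 := fun R hR =>
    csInf_le hbdd ⟨R, hR, rfl⟩
  refine ⟨sInf S, tendsto_order.2 ⟨fun a ha => ?_, fun a ha => ?_⟩, hle⟩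
  · filter_upwards [eventually_gt_atTop 0] with R hR
    exact ha.trans_le (hle R hR)
  obtain ⟨_, ⟨R₁, hR₁, rfl⟩, hlt⟩ := exists_lt_of_csInf_lt hne ha
  have hR₁ : 0 < R₁ := hR₁
  have hlim : Tendsto (fun R : ℝ => (1 - 2 * R₁ / R) ^ 2 * (e BC.D b R₁ / R₁ ^ 2)) atTop
      (𝓝 ((1 - 0) ^ 2 * (e BC.D b R₁ / R₁ ^ 2))) :=
    ((tendsto_const_nhds.sub (tendsto_const_nhds.div_atTop tendsto_id)).pow 2).mul_const _
  rw [sub_zero, one_pow, one_mul] at hlim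
  filter_upwards [hlim.eventually_lt_const hlt, eventually_ge_atTop (2 * R₁)] with R h1 h2
  refine lt_of_le_of_lt ?_ h1
  have hR : 0 < R := by linarith
  -- The largest n with (2n + 1)R₁ ≤ R. The tiled square then has side greater than R − 2R₁. As the
  -- energy per area is non-positive, a lower bound on the tiled fraction is what is needed.
  set n := ⌊(R / R₁ - 1) / 2⌋₊ with hn
  have hq : 2 ≤ R / R₁ := by rw [le_div_iff₀ hR₁]; exact h2
  have n1 : (n : ℝ) ≤ (R / R₁ - 1) / 2 := Nat.floor_le (by linarith)
  have n2 : (R / R₁ - 1) / 2 < n + 1 := Nat.lt_floor_add_one _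
  have n3 : (2 * n + 1) * R₁ ≤ R := by
    rw [← le_div_iff₀ hR₁]; linarith
  have n4 : R < (2 * n + 3) * R₁ := by
    rw [← div_lt_iff₀ hR₁]; linarith
  have k1 : e BC.D b R ≤ (2 * n + 1) ^ 2 * e BC.D b R₁ :=
    (e_D_antitone hb (by positivity) n3).trans (e_D_tile hb hR₁ n)
  have hneg : e BC.D b R₁ / R₁ ^ 2 ≤ 0 :=
    div_nonpos_of_nonpos_of_nonneg (e_nonpos _ hb hR₁.le) (by positivity)
  have k2 : (1 - 2 * R₁ / R) ^ 2 ≤ ((2 * n + 1) * R₁ / R) ^ 2 := by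
    have : 2 * R₁ / R ≤ 1 := by rw [div_le_one hR]; exact h2
    refine pow_le_pow_left₀ (by linarith) ?_ 2
    rw [sub_le_iff_le_add, ← add_div, le_div_iff₀ hR]
    linarith
  have k3 : e BC.D b R / R ^ 2 ≤ ((2 * n + 1) * R₁ / R) ^ 2 * (e BC.D b R₁ / R₁ ^ 2) := by
    rw [div_le_iff₀ (by positivity)]
    refine k1.trans (le_of_eq ?_)
    field_simp
  exact k3.trans (mul_le_mul_of_nonpos_right k2 hneg)

theorem tendsto_e_D {b : ℝ} (hb : 0 ≤ b) :
    Tendsto (fun R => e BC.D b R / R ^ 2) atTop (𝓝 (Eblk b)) := by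
  obtain ⟨E, hE, _⟩ := exists_tendsto_e_D hb
  have : Eblk b = E := by
    rw [Eblk, toInfty_D]; exact hE.limUnder_eq
  rwa [this]

theorem Eblk_mul_sq_le_e_D {b R : ℝ} (hb : 0 ≤ b) (hR : 0 < R) : Eblk b * R ^ 2 ≤ e BC.D b R := by
  obtain ⟨E, hE, hle⟩ := exists_tendsto_e_D hb
  rw [tendsto_nhds_unique (tendsto_e_D hb) hE, ← le_div_iff₀ (by positivity)]
  exact hle R hR

/-- Cutting gives (2n + 1)² e^N(R) ≤ e^D((2n + 1)R). Dividing by the area and letting n → ∞ uses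
only the Dirichlet limit. -/
theorem e_N_le_Eblk_mul_sq {b R : ℝ} (hb : 0 ≤ b) (hR : 0 < R) : e BC.N b R ≤ Eblk b * R ^ 2 := by
  have hX : Tendsto (fun n : ℕ => (2 * (n : ℝ) + 1) * R) atTop atTop :=
    (tendsto_atTop_add_const_right _ _
      (tendsto_natCast_atTop_atTop.const_mul_atTop two_pos)).atTop_mul_const hR
  rw [← div_le_iff₀ (by positivity)]
  refine ge_of_tendsto ((tendsto_e_D hb).comp hX) (Eventually.of_forall fun n => ?_)
  simp only [Function.comp_apply]
  have h := (e_N_tile hb hR n).trans (e_N_le BC.D hb (by positivity))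
  rw [div_le_div_iff₀ (by positivity) (by positivity)]
  calc e BC.N b R * ((2 * n + 1) * R) ^ 2 = ((2 * n + 1) ^ 2 * e BC.N b R) * R ^ 2 := by ring
    _ ≤ _ := mul_le_mul_of_nonneg_right h (by positivity)

/-- Both e^∘ and E_blk R² lie between e^N and e^D, which differ by at most CR. -/
theorem exists_abs_e_sub_le : ∃ C : ℝ, 0 < C ∧ ∀ (b R : ℝ) (c : BC), 0 ≤ b → b ≤ 1 → 4 ≤ R →
    R ∈ admissible c → |e c b R / R ^ 2 - Eblk b| ≤ C / R := by
  obtain ⟨C, hC, h⟩ := exists_e_D_le_e_N_add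
  refine ⟨C, hC, fun b R c hb hb1 hR hadm => ?_⟩
  have hR0 : 0 < R := by linarith
  have h1 := h b R hb hb1 hR
  have h2 := e_N_le c hb hR0.le
  have h3 := e_le_e_D c hb hR0 hadm
  have h4 := Eblk_mul_sq_le_e_D hb hR0
  have h5 := e_N_le_Eblk_mul_sq hb hR0
  have e1 : e c b R / R ^ 2 - Eblk b = (e c b R - Eblk b * R ^ 2) / R ^ 2 := by field_simp
  have e2 : C / R = (C * R) / R ^ 2 := by field_simp
  rw [e1, abs_div, abs_of_pos (by positivity : 0 < R ^ 2), e2]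
  refine div_le_div_of_nonneg_right ?_ (by positivity)
  rw [abs_le]
  constructor <;> linarith

theorem eventually_toInfty (c : BC) (R₀ : ℝ) : ∀ᶠ R in toInfty c, R₀ ≤ R ∧ R ∈ admissible c :=
  ((eventually_ge_atTop R₀).filter_mono inf_le_left).and
    ((eventually_principal.2 fun _ h => h).filter_mono inf_le_right)

theorem tendsto_const_div_toInfty (c : BC) (C : ℝ) :
    Tendsto (fun R => C / R) (toInfty c) (𝓝 0) :=
  (tendsto_const_nhds.div_atTop tendsto_id).mono_left inf_le_left

theorem tendsto_e (c : BC) {b : ℝ} (hb : 0 ≤ b) (hb1 : b ≤ 1) :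
    Tendsto (fun R => e c b R / R ^ 2) (toInfty c) (𝓝 (Eblk b)) := by
  obtain ⟨C, _, h⟩ := exists_abs_e_sub_le
  rw [tendsto_iff_norm_sub_tendsto_zero]
  refine squeeze_zero' (Eventually.of_forall fun _ => norm_nonneg _) ?_
    (tendsto_const_div_toInfty c C)
  filter_upwards [eventually_toInfty c 4] with R hR
  exact h b R c hb hb1 hR.1 hR.2

theorem Eblk_nonpos {b : ℝ} (hb : 0 ≤ b) : Eblk b ≤ 0 := by
  have h := (Eblk_mul_sq_le_e_D hb one_pos).trans (e_nonpos BC.D hb zero_le_one)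
  simpa using h

theorem Eblk_neg {b : ℝ} (hb : 0 ≤ b) (hb1 : b < 1) : Eblk b < 0 := by
  obtain ⟨R, hR, hneg⟩ := exists_e_D_neg hb hb1
  have h := (Eblk_mul_sq_le_e_D hb hR).trans_lt hneg
  by_contra hn
  rw [not_lt] at hn
  exact absurd h (not_lt.2 (by positivity))

/-! ### Asymptotics of `m` -/

theorem sqrt_div_sq {a R : ℝ} (hR : 0 < R) : √a / R = √(a / R ^ 2) := by
  rw [Real.sqrt_div' a (sq_nonneg R), Real.sqrt_sq hR.le]

/-- For large R the energy is negative, so m/R = −√(−2e/R²), and the radicand is within 2C/R of S² =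
−2E_blk. Taking the root divides the error by S. -/
theorem exists_m_bounds {b : ℝ} (hb : 0 ≤ b) (hb1 : b < 1) :
    ∃ C R₀ : ℝ, 0 < C ∧ 1 < R₀ ∧ ∀ R : ℝ, R₀ ≤ R → ∀ c : BC, R ∈ admissible c →
      -√(-2 * Eblk b) - C / R * (√(-2 * Eblk b))⁻¹ ≤ m c b R / R ∧
      m c b R / R ≤ -√(-2 * Eblk b) + C / R := by
  obtain ⟨C, hC, h⟩ := exists_abs_e_sub_le
  have hE := Eblk_neg hb hb1
  set S := √(-2 * Eblk b) with hS
  have hSpos : 0 < S := Real.sqrt_pos.2 (by linarith)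
  have hS2 : S ^ 2 = -2 * Eblk b := Real.sq_sqrt (by linarith)
  -- The summand 2C/S serves the upper bound, where no factor 1/S is displayed. The threshold makes
  -- C/R ≤ −E_blk/2, which keeps e negative.
  refine ⟨C + 2 * C / S, max 4 (2 * C / -Eblk b), by positivity,
    lt_of_lt_of_le (by norm_num) (le_max_left _ _), fun R hR c hadm => ?_⟩
  have hR4 : 4 ≤ R := (le_max_left _ _).trans hR
  have hR0 : 0 < R := by linarith
  have hRC : C / R ≤ -Eblk b / 2 := by
    have := (le_max_right _ _).trans hR
    rw [div_le_iff₀ (by linarith)] at this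
    rw [div_le_iff₀ hR0]
    linarith
  have habs := abs_le.1 (h b R c hb hb1.le hR4 hadm)
  have heneg : e c b R < 0 := by
    have : e c b R / R ^ 2 < 0 := by linarith [habs.2]
    by_contra hn
    exact absurd this (not_lt.2 (div_nonneg (not_lt.1 hn) (by positivity)))
  have hm : m c b R = -√(-2 * e c b R) :=
    le_antisymm (m_le_neg_sqrt hb hR0.le heneg) (neg_sqrt_le_m c hb hR0.le)
  have hmR : m c b R / R = -√(-2 * (e c b R / R ^ 2)) := by
    rw [hm, neg_div, sqrt_div_sq hR0, mul_div_assoc]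
  have hCR : 0 < C / R := by positivity
  rw [hmR]
  constructor
  · have hle : √(-2 * (e c b R / R ^ 2)) ≤ S + C / R * S⁻¹ := by
      refine Real.sqrt_le_iff.2 ⟨by positivity, ?_⟩
      have : (S + C / R * S⁻¹) ^ 2 = S ^ 2 + 2 * (C / R) + (C / R * S⁻¹) ^ 2 := by
        field_simp
        ring
      rw [this, hS2]
      nlinarith [habs.1, sq_nonneg (C / R * S⁻¹)]
    have h2 : C / R * S⁻¹ ≤ (C + 2 * C / S) / R * S⁻¹ := by
      gcongr
      linarith [show 0 < 2 * C / S by positivity]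
    linarith
  · set d := 2 * C / S / R with hd
    have hdpos : 0 < d := by positivity
    have hdS : d * S = 2 * (C / R) := by rw [hd]; field_simp
    have hle : S - d ≤ √(-2 * (e c b R / R ^ 2)) := by
      rcases le_or_gt (S - d) 0 with h0 | h0
      · exact h0.trans (Real.sqrt_nonneg _)
      · refine Real.le_sqrt_of_sq_le ?_
        -- For 0 < d < S, (S − d)² ≤ S² − dS = S² − 2C/R.
        nlinarith [habs.2]
    have h2 : d ≤ (C + 2 * C / S) / R := by
      rw [hd]; gcongr; linarith
    linarith

theorem tendsto_m (c : BC) {b : ℝ} (hb : 0 ≤ b) (hb1 : b < 1) :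
    Tendsto (fun R => m c b R / R) (toInfty c) (𝓝 (-√(-2 * Eblk b))) := by
  obtain ⟨C, R₀, _, _, h⟩ := exists_m_bounds hb hb1
  have h1 : Tendsto (fun R => -√(-2 * Eblk b) - C / R * (√(-2 * Eblk b))⁻¹) (toInfty c)
      (𝓝 (-√(-2 * Eblk b))) := by
    simpa using ((tendsto_const_div_toInfty c C).mul_const (√(-2 * Eblk b))⁻¹).const_sub
      (-√(-2 * Eblk b))
  have h2 : Tendsto (fun R => -√(-2 * Eblk b) + C / R) (toInfty c) (𝓝 (-√(-2 * Eblk b))) := by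
    simpa using (tendsto_const_div_toInfty c C).const_add (-√(-2 * Eblk b))
  refine tendsto_of_tendsto_of_tendsto_of_le_of_le' h1 h2 ?_ ?_
  · filter_upwards [eventually_toInfty c R₀] with R hR
    exact (h R hR.1 c hR.2).1
  · filter_upwards [eventually_toInfty c R₀] with R hR
    exact (h R hR.1 c hR.2).2

/-- E_blk is the infimum of e^D/R², not only its limit, so there is no error term and R need not be
large. -/
theorem neg_sqrt_Eblk_le_m_D {b R : ℝ} (hb : 0 ≤ b) (hR : 0 < R) :
    -√(-2 * Eblk b) ≤ m BC.D b R / R := by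
  rw [le_div_iff₀ hR]
  refine le_trans ?_ (neg_sqrt_le_m BC.D hb hR.le)
  rw [neg_mul, neg_le_neg_iff]
  refine Real.sqrt_le_iff.2 ⟨by positivity, ?_⟩
  rw [mul_pow, Real.sq_sqrt (by linarith [Eblk_nonpos hb])]
  linarith [Eblk_mul_sq_le_e_D hb hR]

end MagneticSquare

open MagneticSquare in
/-- The first conjunct says that the bulk energy is well defined (the limit exists, does not depend
on the boundary condition and is not positive). -/
theorem theorem1p1 :
    (∀ b : ℝ, 0 < b → b ≤ 1 → Eblk b ≤ 0 ∧
      ∀ c : BC, Tendsto (fun R => e c b R / R ^ 2) (toInfty c) (𝓝 (Eblk b))) ∧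
    (∀ b : ℝ, 0 < b → b < 1 → Eblk b < 0 ∧
      (∃ C R₀ : ℝ, 0 < C ∧ 1 < R₀ ∧ ∀ R : ℝ, R₀ ≤ R → ∀ c : BC, R ∈ admissible c →
        -√(-2 * Eblk b) - C / R * (√(-2 * Eblk b))⁻¹ ≤ m c b R / R ∧
        m c b R / R ≤ -√(-2 * Eblk b) + C / R) ∧
      (∀ c : BC, ∃ L : ℝ, Tendsto (fun R => m c b R / R) (toInfty c) (𝓝 L) ∧
        Eblk b = -(1 / 2) * L ^ 2)) ∧
    (∀ b : ℝ, 0 < b → b ≤ 1 → ∀ R : ℝ, 1 ≤ R →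
      -√(-2 * Eblk b) ≤ m BC.D b R / R) := by
  refine ⟨fun b hb hb1 => ⟨Eblk_nonpos hb.le, fun c => tendsto_e c hb.le hb1⟩,
    fun b hb hb1 => ⟨Eblk_neg hb.le hb1, exists_m_bounds hb.le hb1, fun c =>
      ⟨_, tendsto_m c hb.le hb1, ?_⟩⟩,
    fun b hb _ R hR => neg_sqrt_Eblk_le_m_D hb.le (by linarith)⟩
  rw [neg_sq, Real.sq_sqrt (by linarith [Eblk_nonpos hb.le])]
  ring
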